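/- Let $\mathbb{K}$ be a field and let $(R,\mathfrak{m})$ be a parameter $\mathbb{K}$-algebra, i.e. a complete local noetherian commutative $\mathbb{K}$-algebra with maximal ideal $\mathfrak{m}$ and residue field $R/\mathfrak{m}=\mathbb{K}$. Let $X$ be an algebraic variety over $\mathbb{K}$ (an integral separated $\mathbb{K}$-scheme of finite type; it may be smooth, but need not be), let $U\subset X$ be an affine open set, let $\mathcal{O}_U$ be the structure sheaf of $U$, and let $C:=\Gamma(U,\mathcal{O}_U)$. Definitions. An associative $R$-deformation of $C$ is an associative unital $R$-algebra $A$ that is flat and $\mathfrak{m}$-adically complete (that is, $A\to\varprojlim_i (R/\mathfrak{m}^{i+1})\otimes_R A$ is bijective) as an $R$-module, together with an isomorphism of $\mathbb{K}$-algebras $\mathbb{K}\otimes_R A\to C$, called the augmentation. A Poisson $R$-deformation of $C$ is the same with $A$ commutative and equipped with an $R$-bilinear Poisson bracket (antisymmetric, satisfying the Jacobi identity, and a derivation in each argument), such that the augmentation is an isomorphism of Poisson algebras, where $C$ has the zero bracket. An associative (resp. Poisson) $R$-deformation of $\mathcal{O}_U$ is a sheaf $\mathcal{A}$ on $U$ of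 associative unital $R$-algebras (resp. commutative $R$-algebras with an $R$-bilinear Poisson bracket) that is flat (all stalks are flat $R$-modules) and $\mathfrak{m}$-adically complete (that is, $\mathcal{A}\to\varprojlim_i (R/\mathfrak{m}^{i+1})\otimes_R\mathcal{A}$ is an isomorphism, the tensor products being sheafified), together with an isomorphism of sheaves of $\mathbb{K}$-algebras (resp. of Poisson $\mathbb{K}$-algebras, where $\mathcal{O}_U$ has the zero bracket) $\mathbb{K}\otimes_R\mathcal{A}\to\mathcal{O}_U$, called the augmentation. A gauge transformation between two deformations of the same kind is an isomorphism of (sheaves of) $R$-algebras, respecting the Poisson brackets in the Poisson case, that commutes with the augmentations. For an $R$-deformation $\mathcal{A}$ of $\mathcal{O}_U$, the $R$-algebra $\Gamma(U,\mathcal{A})$ is given the augmentation $\mathbb{K}\otimes_R\Gamma(U,\mathcal{A})\to\Gamma(U,\mathbb{K}\otimes_R\mathcal{A})\to C$. The following hold both for associative and for Poisson deformations. (0) If $\mathcal{A}$ is an $R$-deformation of $\mathcal{O}_U$, then $\Gamma(U,\mathcal{A})$ is an $R$-deformation of $C$. (1) If $A$ is an $R$-deformation of $C$, then there exist an $R$-deformation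 $\mathcal{A}$ of $\mathcal{O}_U$ and a gauge transformation $g:A\to\Gamma(U,\mathcal{A})$ of deformations of $C$. (2) If $\mathcal{A}$ and $\mathcal{A}'$ are $R$-deformations of $\mathcal{O}_U$ and $h:\Gamma(U,\mathcal{A})\to\Gamma(U,\mathcal{A}')$ is a gauge transformation of deformations of $C$, then there is a unique gauge transformation $\tilde h:\mathcal{A}\to\mathcal{A}'$ such that $\Gamma(U,\tilde h)=h$. -/

import Mathlib

open CategoryTheory Limits TopologicalSpace Opposite AlgebraicGeometry
open scoped TensorProduct

universe u

noncomputable section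

/-! ### Parameter algebras and deformations of algebras -/

/-- A local `K`-algebra `R` is a *parameter `K`-algebra* if it is noetherian and complete with
respect to its maximal ideal `𝔪`, and its residue field `R / 𝔪` is `K`. -/
structure IsParameterAlgebra (K R : Type u) [Field K] [CommRing R] [IsLocalRing R]
    [Algebra K R] : Prop where
  noetherian : IsNoetherianRing R
  complete : IsAdicComplete (IsLocalRing.maximalIdeal R) R
  residue : Function.Bijective (algebraMap K (IsLocalRing.ResidueField R))

/-- A Poisson structure on an associative unital `R`-algebra `A`: the algebra is commutative, and
it carries an `R`-bilinear Lie bracket which is a derivation in each argument. -/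
structure PoissonStructure (R A : Type u) [CommRing R] [Ring A] [Algebra R A] where
  mul_comm : ∀ a b : A, a * b = b * a
  bracket : A →ₗ[R] A →ₗ[R] A
  antisymm : ∀ a b, bracket a b = -bracket b a
  jacobi : ∀ a b c,
    bracket a (bracket b c) + bracket b (bracket c a) + bracket c (bracket a b) = 0
  leibniz_right : ∀ a b c, bracket a (b * c) = bracket a b * c + b * bracket a c
  leibniz_left : ∀ a b c, bracket (a * b) c = bracket a c * b + a * bracket b c

section

variable (K R : Type u) [Field K] [CommRing R] [IsLocalRing R] [Algebra K R]

/-- The functor `A ↦ (R / 𝔪) ⊗_R A` from `R`-algebras to `K`-algebras. For a parameter algebra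
`R` the field `R / 𝔪` is `K`, and this is `A ↦ K ⊗_R A`. -/
def residueTensor : AlgCat.{u} R ⥤ AlgCat.{u} K where
  obj A := AlgCat.of K (IsLocalRing.ResidueField R ⊗[R] A)
  map g := AlgCat.ofHom
    ((Algebra.TensorProduct.map
      (AlgHom.id (IsLocalRing.ResidueField R) (IsLocalRing.ResidueField R)) g.hom).restrictScalars
        K)
  map_id A := by
    ext x
    exact congrArg (fun φ => φ x) (Algebra.TensorProduct.map_id (R := R)
      (S := IsLocalRing.ResidueField R) (A := IsLocalRing.ResidueField R) (B := A))
  map_comp {A B C} g h := by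
    ext x
    refine x.induction_on ?_ ?_ ?_
    · simp
    · intro k a
      rfl
    · intro y z hy hz
      rw [map_add, map_add, hy, hz]

/-- An associative unital `R`-algebra `A` with a homomorphism of `K`-algebras
`K ⊗_R A → C`. -/
structure AugAlgebra (C : Type u) [Ring C] [Algebra K C] where
  alg : AlgCat.{u} R
  aug : (residueTensor K R).obj alg ⟶ AlgCat.of K C

/-- An augmented commutative `R`-algebra with a Poisson bracket. -/
structure PoissonAugAlgebra (C : Type u) [Ring C] [Algebra K C] extends AugAlgebra K R C where
  poisson : PoissonStructure R alg

variable {K R} {C : Type u} [Ring C] [Algebra K C]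

/-- `A` is an associative `R`-deformation of `C`: it is flat and `𝔪`-adically complete over `R`,
and the augmentation `K ⊗_R A → C` is an isomorphism. -/
structure AugAlgebra.IsDeformation (A : AugAlgebra K R C) : Prop where
  flat : Module.Flat R A.alg
  complete : IsAdicComplete (IsLocalRing.maximalIdeal R) A.alg
  isIso_aug : IsIso A.aug

/-- `A` is a Poisson `R`-deformation of `C`: moreover the augmentation `K ⊗_R A → C` is a
homomorphism of Poisson algebras. The bracket of `k ⊗ a` and `l ⊗ b` is
`kl ⊗ {a, b}`, and the bracket of `C` is zero. -/
structure PoissonAugAlgebra.IsDeformation (A : PoissonAugAlgebra K R C) : Prop where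
  isDeformation : A.toAugAlgebra.IsDeformation
  aug_bracket : ∀ (k l : IsLocalRing.ResidueField R) (a b : A.alg),
    A.aug ((k * l) ⊗ₜ[R] A.poisson.bracket a b : IsLocalRing.ResidueField R ⊗[R] A.alg) = 0

/-- A gauge transformation: an isomorphism of `R`-algebras commuting with the augmentations. -/
@[ext]
structure AugAlgebra.Gauge (A A' : AugAlgebra K R C) where
  iso : A.alg ≅ A'.alg
  comm : (residueTensor K R).map iso.hom ≫ A'.aug = A.aug

/-- A gauge transformation of Poisson algebras also respects the Poisson brackets. -/
@[ext]
structure PoissonAugAlgebra.Gauge (A A' : PoissonAugAlgebra K R C) extends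
    AugAlgebra.Gauge A.toAugAlgebra A'.toAugAlgebra where
  map_bracket : ∀ a b : A.alg,
    iso.hom (A.poisson.bracket a b) = A'.poisson.bracket (iso.hom a) (iso.hom b)

end

/-! ### Flat and complete sheaves of modules -/

section

variable {R : Type u} [CommRing R] {X : TopCat.{u}}

/-- A sheaf of `R`-modules is flat if all its stalks are flat `R`-modules. -/
def SheafFlat (M : TopCat.Sheaf (ModuleCat.{u} R) X) : Prop :=
  ∀ x : X, Module.Flat R (M.presheaf.stalk x)

/-- The functor `M ↦ N ⊗_R M` on `R`-modules, for a fixed `R`-module `N`. -/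
def tensorFunctor (N : Type u) [AddCommGroup N] [Module R N] :
    ModuleCat.{u} R ⥤ ModuleCat.{u} R where
  obj M := ModuleCat.of R (N ⊗[R] M)
  map g := ModuleCat.ofHom (g.hom.lTensor N)
  map_id M := by ext : 1; exact LinearMap.lTensor_id N M
  map_comp g h := by ext : 1; exact LinearMap.lTensor_comp N h.hom g.hom

/-- The homomorphism `M → (R / I) ⊗_R M`, `m ↦ 1 ⊗ m`, natural in the `R`-module `M`. -/
def toTensorFunctor (I : Ideal R) : 𝟭 (ModuleCat.{u} R) ⟶ tensorFunctor (R ⧸ I) where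
  app M := ModuleCat.ofHom (TensorProduct.mk R (R ⧸ I) M 1)
  naturality M N g := by ext m; rfl

/-- The homomorphism `(R / I) ⊗_R M → (R / J) ⊗_R M` for `I ≤ J`, natural in the `R`-module
`M`. -/
def tensorFunctorTransition {I J : Ideal R} (h : I ≤ J) :
    tensorFunctor (R := R) (R ⧸ I) ⟶ tensorFunctor (R := R) (R ⧸ J) where
  app M := ModuleCat.ofHom (LinearMap.rTensor M (Submodule.factor h : (R ⧸ I) →ₗ[R] (R ⧸ J)))
  naturality M N g := by
    ext : 1
    exact TensorProduct.ext' fun _ _ => rfl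

/-- The sheaf `(R / I) ⊗_R M`: the sheaf associated to `V ↦ (R / I) ⊗_R Γ(V, M)`. -/
def quotTensor (M : TopCat.Sheaf (ModuleCat.{u} R) X) (I : Ideal R) :
    TopCat.Sheaf (ModuleCat.{u} R) X :=
  (presheafToSheaf (Opens.grothendieckTopology X) (ModuleCat.{u} R)).obj
    (M.presheaf ⋙ tensorFunctor (R ⧸ I))

/-- The canonical homomorphism `M → (R / I) ⊗_R M`, `m ↦ 1 ⊗ m`. -/
def toQuotTensor (M : TopCat.Sheaf (ModuleCat.{u} R) X) (I : Ideal R) :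
    M.presheaf ⟶ (quotTensor M I).presheaf :=
  M.presheaf.rightUnitor.inv ≫ Functor.whiskerLeft M.presheaf (toTensorFunctor I) ≫
    toSheafify (Opens.grothendieckTopology X) (M.presheaf ⋙ tensorFunctor (R ⧸ I))

/-- The canonical homomorphism `(R / I) ⊗_R M → (R / J) ⊗_R M` for `I ≤ J`. -/
def quotTensorTransition (M : TopCat.Sheaf (ModuleCat.{u} R) X) {I J : Ideal R} (h : I ≤ J) :
    (quotTensor M I).presheaf ⟶ (quotTensor M J).presheaf :=
  sheafifyMap (Opens.grothendieckTopology X)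
    (Functor.whiskerLeft M.presheaf (tensorFunctorTransition h))

/-- A sheaf of `R`-modules `M` is `I`-adically complete if the canonical homomorphism from `M`
to the inverse limit over `i` of the sheaves `(R / I ^ (i + 1)) ⊗_R M` is an isomorphism. The
sections of this limit over `V` are the compatible families of sections over `V`. -/
def SheafComplete (I : Ideal R) (M : TopCat.Sheaf (ModuleCat.{u} R) X) : Prop :=
  ∀ (V : (Opens X)ᵒᵖ) (s : ∀ i : ℕ, (quotTensor M (I ^ (i + 1))).presheaf.obj V),
    (∀ i, (quotTensorTransition M (Ideal.pow_le_pow_right (Nat.le_succ (i + 1)))).app V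
      (s (i + 1)) = s i) →
    ∃! m : M.presheaf.obj V, ∀ i, (toQuotTensor M (I ^ (i + 1))).app V m = s i

end

/-! ### Deformations of sheaves of algebras -/

/-- The forgetful functor from commutative algebras preserves limits. -/
instance forget_commAlgCat_preservesLimits (K : Type u) [CommRing K] :
    PreservesLimits (forget (CommAlgCat.{u} K)) :=
  inferInstanceAs (PreservesLimits ((commAlgCatEquivUnder (CommRingCat.of K)).functor ⋙
    Under.forget (CommRingCat.of K) ⋙ forget CommRingCat.{u}))

instance forget₂_commAlgCat_preservesLimits (K : Type u) [CommRing K] :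
    PreservesLimits (forget₂ (CommAlgCat.{u} K) (AlgCat.{u} K)) :=
  have : PreservesLimits
      (forget₂ (CommAlgCat.{u} K) (AlgCat.{u} K) ⋙ forget (AlgCat.{u} K)) :=
    inferInstanceAs (PreservesLimits (forget (CommAlgCat.{u} K)))
  have : ReflectsLimits (forget (AlgCat.{u} K)) := reflectsLimits_of_reflectsIsomorphisms
  preservesLimits_of_reflects_of_preserves _ (forget (AlgCat.{u} K))

section

variable (K R : Type u) [Field K] [CommRing R] [IsLocalRing R] [Algebra K R] {X : TopCat.{u}}

/-- A sheaf of commutative `K`-algebras, viewed as a sheaf of associative `K`-algebras. -/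
def commToAlgSheaf (O : TopCat.Sheaf (CommAlgCat.{u} K) X) : TopCat.Sheaf (AlgCat.{u} K) X :=
  (sheafCompose (Opens.grothendieckTopology X)
    (forget₂ (CommAlgCat.{u} K) (AlgCat.{u} K))).obj O

/-- The sheaf of `R`-modules underlying a sheaf of `R`-algebras. -/
def algToModuleSheaf {R : Type u} [CommRing R] (A : TopCat.Sheaf (AlgCat.{u} R) X) :
    TopCat.Sheaf (ModuleCat.{u} R) X :=
  (sheafCompose (Opens.grothendieckTopology X)
    (forget₂ (AlgCat.{u} R) (ModuleCat.{u} R))).obj A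

/-- The functor sending a sheaf `A` of `R`-algebras to the sheaf `K ⊗_R A` of `K`-algebras,
which is the sheaf associated to `V ↦ K ⊗_R Γ(V, A)`. -/
def sheafResidueTensor : TopCat.Sheaf (AlgCat.{u} R) X ⥤ TopCat.Sheaf (AlgCat.{u} K) X :=
  Sheaf.composeAndSheafify (Opens.grothendieckTopology X) (residueTensor K R)

/-- A sheaf `A` of associative unital `R`-algebras with a homomorphism of sheaves of
`K`-algebras `K ⊗_R A → O`. -/
structure AugSheaf (O : TopCat.Sheaf (CommAlgCat.{u} K) X) where
  sheaf : TopCat.Sheaf (AlgCat.{u} R) X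
  aug : (sheafResidueTensor K R).obj sheaf ⟶ commToAlgSheaf K O

/-- An augmented sheaf of commutative `R`-algebras with a Poisson bracket. -/
structure PoissonAugSheaf (O : TopCat.Sheaf (CommAlgCat.{u} K) X) extends AugSheaf K R O where
  poisson : ∀ V : (Opens X)ᵒᵖ, PoissonStructure R (sheaf.presheaf.obj V)
  map_bracket : ∀ {V W : (Opens X)ᵒᵖ} (i : V ⟶ W) (a b : sheaf.presheaf.obj V),
    sheaf.presheaf.map i ((poisson V).bracket a b) =
      (poisson W).bracket (sheaf.presheaf.map i a) (sheaf.presheaf.map i b)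

variable {K R} {O : TopCat.Sheaf (CommAlgCat.{u} K) X}

/-- The `R`-algebra `Γ(V, A)` with the augmentation
`K ⊗_R Γ(V, A) → Γ(V, K ⊗_R A) → Γ(V, O)`. -/
def AugSheaf.sections (A : AugSheaf K R O) (V : Opens X) :
    AugAlgebra K R (O.presheaf.obj (op V)) where
  alg := A.sheaf.presheaf.obj (op V)
  aug := (toSheafify (Opens.grothendieckTopology X)
    (A.sheaf.presheaf ⋙ residueTensor K R) ≫ A.aug.hom).app (op V)

/-- The `R`-algebra `Γ(V, A)` with its augmentation and Poisson bracket. -/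
def PoissonAugSheaf.sections (A : PoissonAugSheaf K R O) (V : Opens X) :
    PoissonAugAlgebra K R (O.presheaf.obj (op V)) where
  toAugAlgebra := A.toAugSheaf.sections V
  poisson := A.poisson (op V)

/-- `A` is an associative `R`-deformation of `O`: it is flat and `𝔪`-adically complete over `R`,
and the augmentation `K ⊗_R A → O` is an isomorphism. -/
structure AugSheaf.IsDeformation (A : AugSheaf K R O) : Prop where
  flat : SheafFlat (algToModuleSheaf A.sheaf)
  complete : SheafComplete (IsLocalRing.maximalIdeal R) (algToModuleSheaf A.sheaf)
  isIso_aug : IsIso A.aug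

/-- `A` is a Poisson `R`-deformation of `O`: moreover the augmentation `K ⊗_R A → O` is a
homomorphism of sheaves of Poisson algebras, where `O` has the zero bracket. The bracket of
`K ⊗_R A` is induced by that of the presheaf `V ↦ K ⊗_R Γ(V, A)`, so this is tested on the
sections of the latter. -/
structure PoissonAugSheaf.IsDeformation (A : PoissonAugSheaf K R O) : Prop where
  isDeformation : A.toAugSheaf.IsDeformation
  aug_bracket : ∀ (V : Opens X) (k l : IsLocalRing.ResidueField R)
    (a b : A.sheaf.presheaf.obj (op V)),
    (A.sections V).aug ((k * l) ⊗ₜ[R] (A.poisson (op V)).bracket a b :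
      IsLocalRing.ResidueField R ⊗[R] A.sheaf.presheaf.obj (op V)) = 0

/-- A gauge transformation: an isomorphism of sheaves of `R`-algebras commuting with the
augmentations. -/
@[ext]
structure AugSheaf.Gauge (A A' : AugSheaf K R O) where
  iso : A.sheaf ≅ A'.sheaf
  comm : (sheafResidueTensor K R).map iso.hom ≫ A'.aug = A.aug

/-- A gauge transformation of sheaves of Poisson algebras also respects the Poisson brackets. -/
@[ext]
structure PoissonAugSheaf.Gauge (A A' : PoissonAugSheaf K R O) extends
    AugSheaf.Gauge A.toAugSheaf A'.toAugSheaf where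
  map_bracket : ∀ (V : (Opens X)ᵒᵖ) (a b : A.sheaf.presheaf.obj V),
    iso.hom.hom.app V ((A.poisson V).bracket a b) =
      (A'.poisson V).bracket (iso.hom.hom.app V a) (iso.hom.hom.app V b)

/-- The gauge transformation `Γ(V, g) : Γ(V, A) → Γ(V, A')` induced by `g : A → A'`. -/
def AugSheaf.Gauge.sections {A A' : AugSheaf K R O} (g : A.Gauge A') (V : Opens X) :
    (A.sections V).Gauge (A'.sections V) where
  iso := ((sheafToPresheaf _ _).mapIso g.iso).app (op V)
  comm := by
    have h := toSheafify_naturality (Opens.grothendieckTopology X)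
      (Functor.whiskerRight g.iso.hom.hom (residueTensor K R))
    have h₁ := congrArg (fun φ => φ.app (op V) ≫ A'.aug.hom.app (op V)) h
    have h₂ := congrArg (fun φ => (toSheafify (Opens.grothendieckTopology X)
      (A.sheaf.presheaf ⋙ residueTensor K R)).app (op V) ≫ φ.hom.app (op V)) g.comm
    exact h₁.trans h₂

/-- The Poisson gauge transformation `Γ(V, g) : Γ(V, A) → Γ(V, A')` induced by `g : A → A'`. -/
def PoissonAugSheaf.Gauge.sections {A A' : PoissonAugSheaf K R O} (g : A.Gauge A')
    (V : Opens X) : (A.sections V).Gauge (A'.sections V) where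
  toGauge := g.toGauge.sections V
  map_bracket := g.map_bracket (op V)

end

/-! ### The structure sheaf of a scheme over a field -/

section

variable {K : Type u} [Field K] {Y : Scheme.{u}} (f : Y ⟶ Spec (CommRingCat.of K))

/-- The homomorphism `K → Γ(Y, O_Y) → Γ(V, O_Y)` given by the structure morphism `Y → Spec K`. -/
def scalarMap (V : (Opens Y)ᵒᵖ) : CommRingCat.of K ⟶ Y.presheaf.obj V :=
  (Scheme.ΓSpecIso (CommRingCat.of K)).inv ≫ f.appTop ≫ Y.presheaf.map (homOfLE le_top).op

/-- The ring `Γ(V, O_Y)` as a commutative `K`-algebra. -/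
def sectionsAlg (V : (Opens Y)ᵒᵖ) : CommAlgCat.{u} K :=
  letI := (scalarMap f V).hom.toAlgebra
  CommAlgCat.of K (Y.presheaf.obj V)

/-- The structure sheaf of the `K`-scheme `Y`, as a presheaf of commutative `K`-algebras. -/
def structurePresheafAlg : TopCat.Presheaf (CommAlgCat.{u} K) Y where
  obj V := sectionsAlg f V
  map {V W} i :=
    letI := (scalarMap f V).hom.toAlgebra
    letI := (scalarMap f W).hom.toAlgebra
    CommAlgCat.ofHom
      { (Y.presheaf.map i).hom with
        commutes' := fun k => by
          have h : scalarMap f V ≫ Y.presheaf.map i = scalarMap f W := by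
            simp only [scalarMap, Category.assoc, ← Functor.map_comp]
            rfl
          exact congrArg (fun φ => φ.hom k) h }
  map_id V := ConcreteCategory.hom_ext _ _ fun x =>
    congrArg (fun φ => φ.hom x) (Y.presheaf.map_id V)
  map_comp i j := ConcreteCategory.hom_ext _ _ fun x =>
    congrArg (fun φ => φ.hom x) (Y.presheaf.map_comp i j)

/-- The structure sheaf of the `K`-scheme `Y`, as a sheaf of commutative `K`-algebras. -/
def structureSheafAlg : TopCat.Sheaf (CommAlgCat.{u} K) Y :=
  ⟨structurePresheafAlg f,
    (TopCat.Presheaf.isSheaf_iff_isSheaf_comp (forget (CommAlgCat.{u} K)) _).mpr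
      ((TopCat.Presheaf.isSheaf_iff_isSheaf_comp (forget CommRingCat.{u}) _).mp
        Y.sheaf.property)⟩

/-- The structure sheaf `O_U` of an open subset `U` of the `K`-scheme `X`, as a sheaf of
commutative `K`-algebras on the topological space `U`. -/
def openStructureSheaf {X : Scheme.{u}} (f : X ⟶ Spec (CommRingCat.of K)) (U : X.Opens) :
    TopCat.Sheaf (CommAlgCat.{u} K) (U : Scheme.{u}) :=
  structureSheafAlg (U.ι ≫ f)

end

end

/-! A deformation is controlled by its graded module. If `M` is flat over `R`, a combination of
minimal generators of `𝔪 ^ j` lies in `𝔪 ^ (j + 1) M` only if all its coefficients lie in `𝔪 M`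
(`GrFlat`). Over a noetherian `R` the converse holds for complete `M` (`flat_of_grFlat`). So a
deformation of `C` is a complete algebra `A` with `GrFlat` and `A / 𝔪 A = C`
(`AugAlgebra.isDeformation_iff`), and most constructions are successive approximations whose error
in degree `j` is a tuple of elements of `C` or of sections of the structure sheaf `O`.

Global sections. Over an affine open set, the obstruction to lifting a section from `A / 𝔪 ^ (i +
1)` to `A / 𝔪 ^ (i + 2)` is a Čech 1-cocycle with values in a finite power of `O`, hence a
coboundary (`exists_transition_eq`). Completeness then makes the augmentation surjective on
sections, and sections that are locally in `𝔪 ^ j A` form exactly `𝔪 ^ j Γ(V, A)`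
(`locallyAdic_eq`).

Localization. As `C` is commutative, commutators in `A` lie in `𝔪 A`; hence the powers of any `s`
satisfy the Ore condition in `A / 𝔪 ^ j A`. The inverse limit of the resulting localizations is a
deformation of the localization of `C` at the image of `s`. Any such deformation receiving a
compatible map from `A` is universal among complete algebras in which `s` becomes invertible, and
maps out of it are determined on `A`, which is dense up to powers of `s`. Sections over a basic open
set are of this kind, so gauge transformations of global sections extend uniquely.

Existence. The completed localizations form a presheaf on the basic open sets. It satisfies gluing
because `O` does, by induction on powers of `𝔪` (`existsUnique_glue`); compatible families give the
sheaf.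

Poisson brackets are biderivations. A derivation is a homomorphism to dual numbers, so the universal
property extends brackets to localizations, and all identities persist by density. -/

/-! ### Adic filtrations, minimal generators and the graded form of flatness -/

section AdicModules

open IsLocalRing

/-- Successive approximation. -/
theorem exists_eq_of_filtration {R E Z : Type*} [CommRing R] [AddCommGroup E] [Module R E]
    [AddCommGroup Z] [Module R Z] (G : E →ₗ[R] Z) (EE : ℕ → Submodule R E)
    (ZZ WW : ℕ → Submodule R Z)
    (hE : ∀ e : ℕ → E, (∀ n, e n ∈ EE n) → ∃ x, ∀ n, x - ∑ k ∈ Finset.range n, e k ∈ EE n)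
    (hsep : ∀ z, (∀ n, z ∈ WW n) → z = 0) (hG : ∀ n, ∀ e ∈ EE n, G e ∈ WW n)
    (hZW : ∀ n, ZZ n ≤ WW n) (hstep : ∀ n, ∀ z ∈ ZZ n, ∃ e ∈ EE n, z - G e ∈ ZZ (n + 1))
    {z : Z} (hz : z ∈ ZZ 0) : ∃ x, G x = z := by
  -- The remainders stay in `ZZ`, where a further correction is available, while convergence is
  -- measured in the possibly larger `WW`: `G` may be known to respect the filtrations only up to a
  -- shift.
  choose! f hf hf' using hstep
  let s : ℕ → Z := fun n => Nat.rec z (fun n y => y - G (f n y)) n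
  have hs : ∀ n, s n ∈ ZZ n := fun n => by
    induction n with
    | zero => exact hz
    | succ n ih => exact hf' n _ ih
  have hsum : ∀ n, z - G (∑ k ∈ Finset.range n, f k (s k)) = s n := fun n => by
    induction n with
    | zero => simp [s]
    | succ n ih =>
      rw [Finset.sum_range_succ, map_add, ← sub_sub, ih]
  obtain ⟨x, hx⟩ := hE (fun n => f n (s n)) fun n => hf n _ (hs n)
  refine ⟨x, (sub_eq_zero.1 (hsep _ fun n => ?_)).symm⟩
  have : z - G x = s n - G (x - ∑ k ∈ Finset.range n, f k (s k)) := by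
    rw [← hsum n, map_sub]; abel
  rw [this]
  exact Submodule.sub_mem _ (hZW n (hs n)) (hG n _ (hx n))

/-- The submodule `𝔪 ^ j M` of a module `M` over a local ring. -/
def adic (R : Type*) [CommRing R] [IsLocalRing R] (M : Type*) [AddCommGroup M] [Module R M]
    (j : ℕ) : Submodule R M :=
  maximalIdeal R ^ j • (⊤ : Submodule R M)

variable {R : Type*} [CommRing R] [IsLocalRing R]
variable {M : Type*} [AddCommGroup M] [Module R M] {N : Type*} [AddCommGroup N] [Module R N]

theorem adic_one : adic R M 1 = maximalIdeal R • (⊤ : Submodule R M) := by rw [adic, pow_one]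

theorem mem_adic_zero (x : M) : x ∈ adic R M 0 := by simp [adic]

theorem smul_mem_adic {i j : ℕ} {r : R} (hr : r ∈ maximalIdeal R ^ i) {x : M}
    (hx : x ∈ adic R M j) : r • x ∈ adic R M (i + j) := by
  rw [adic, pow_add, mul_smul]
  exact Submodule.smul_mem_smul hr hx

theorem smul_mem_adic_one {r : R} (hr : r ∈ maximalIdeal R) (x : M) : r • x ∈ adic R M 1 := by
  rw [adic, pow_one]
  exact Submodule.smul_mem_smul hr trivial

theorem adic_antitone : Antitone (adic R M) := fun _ _ h =>
  Submodule.smul_mono (Ideal.pow_le_pow_right h) le_rfl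

theorem map_mem_adic (f : M →ₗ[R] N) {j : ℕ} {x : M} (hx : x ∈ adic R M j) :
    f x ∈ adic R N j := by
  have : f x ∈ (adic R M j).map f := ⟨x, hx, rfl⟩
  rw [adic, Submodule.map_smul''] at this
  exact Submodule.smul_mono le_rfl le_top this

theorem eq_zero_of_forall_mem_adic [IsHausdorff (maximalIdeal R) M] {x : M}
    (hx : ∀ n, x ∈ adic R M n) : x = 0 :=
  IsHausdorff.haus (I := maximalIdeal R) inferInstance x fun n => by
    rw [SModEq.zero]; exact hx n

theorem exists_limit [IsPrecomplete (maximalIdeal R) M] {x : ℕ → M}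
    (hx : ∀ n, x (n + 1) - x n ∈ adic R M n) : ∃ y, ∀ n, y - x n ∈ adic R M n := by
  have h : ∀ {m n}, m ≤ n → x m ≡ x n [SMOD (maximalIdeal R ^ m • ⊤ : Submodule R M)] := by
    intro m n hmn
    induction n, hmn using Nat.le_induction with
    | base => rfl
    | succ n hmn ih =>
      refine ih.trans (SModEq.symm ?_)
      rw [SModEq.sub_mem]
      exact adic_antitone hmn (hx n)
  obtain ⟨y, hy⟩ := IsPrecomplete.prec (I := maximalIdeal R) inferInstance h
  exact ⟨y, fun n => by rw [← SModEq.sub_mem]; exact (hy n).symm⟩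

theorem isAdicComplete_of_limits (h0 : ∀ x : M, (∀ n, x ∈ adic R M n) → x = 0)
    (h : ∀ x : ℕ → M, (∀ n, x (n + 1) - x n ∈ adic R M n) → ∃ y, ∀ n, y - x n ∈ adic R M n) :
    IsAdicComplete (maximalIdeal R) M where
  haus' x hx := h0 x fun n => SModEq.zero.1 (hx n)
  prec' x hx := by
    obtain ⟨y, hy⟩ := h x fun n => by rw [← SModEq.sub_mem]; exact (hx (Nat.le_succ n)).symm
    exact ⟨y, fun n => by rw [SModEq.comm, SModEq.sub_mem]; exact hy n⟩

/-- Lift a basis of `(R / 𝔪) ⊗ I`. Nakayama's lemma makes the lifts generate `I`, and linear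
independence over the residue field is the minimality. -/
theorem exists_minimal_generators [IsNoetherianRing R] (I : Ideal R) :
    ∃ (n : ℕ) (r : Fin n → R), Ideal.span (Set.range r) = I ∧
      ∀ c : Fin n → R, ∑ l, c l * r l ∈ maximalIdeal R * I → ∀ l, c l ∈ maximalIdeal R := by
  let b := Module.finBasis (ResidueField R) (ResidueField R ⊗[R] I)
  obtain ⟨v, hv⟩ := (TensorProduct.mk_surjective R I (ResidueField R)
    Ideal.Quotient.mk_surjective).comp_left b
  have hv' : ∀ i, (1 : ResidueField R) ⊗ₜ[R] v i = b i := fun i => congrFun hv i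
  have hs := span_eq_top_of_tmul_eq_basis v b hv'
  refine ⟨_, fun l => v l, ?_, fun c hc => ?_⟩
  · have := congrArg (Submodule.map I.subtype) hs
    rw [Submodule.map_span, ← Set.range_comp, Submodule.map_top, Submodule.range_subtype] at this
    exact this
  · have h1 : ∑ l, c l • v l ∈ maximalIdeal R • (⊤ : Submodule R I) := by
      have : I.subtype (∑ l, c l • v l) ∈ (maximalIdeal R • (⊤ : Submodule R I)).map I.subtype := by
        rw [Submodule.map_smul'', Submodule.map_top, Submodule.range_subtype]
        simpa using hc
      obtain ⟨y, hy, hyx⟩ := this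
      rwa [← Subtype.ext hyx]
    have h2 : (1 : ResidueField R) ⊗ₜ[R] (∑ l, c l • v l) = 0 := by
      refine Submodule.smul_induction_on h1 (fun r hr n _ => ?_) (fun x y hx hy => ?_)
      · rw [← TensorProduct.smul_tmul]
        have : r • (1 : ResidueField R) = 0 := by
          rw [Algebra.smul_def, mul_one]
          exact (residue_eq_zero_iff r).2 hr
        rw [this, TensorProduct.zero_tmul]
      · rw [TensorProduct.tmul_add, hx, hy, add_zero]
    have h3 : ∑ l, residue R (c l) • b l = 0 := by
      rw [← h2, TensorProduct.tmul_sum]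
      refine Finset.sum_congr rfl fun l _ => ?_
      rw [← hv', TensorProduct.tmul_smul]
      rfl
    intro l
    have := Fintype.linearIndependent_iff.1 b.linearIndependent _ h3 l
    exact (residue_eq_zero_iff _).1 this

variable [IsNoetherianRing R]

variable (R) in
/-- The minimal number of generators of `𝔪 ^ j`. -/
noncomputable def numGen (j : ℕ) : ℕ :=
  (exists_minimal_generators (maximalIdeal R ^ j)).choose

variable (R) in
/-- A minimal family of generators of `𝔪 ^ j`. -/
noncomputable def gen (j : ℕ) : Fin (numGen R j) → R :=
  (exists_minimal_generators (maximalIdeal R ^ j)).choose_spec.choose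

variable (R) in
theorem span_gen (j : ℕ) : Ideal.span (Set.range (gen R j)) = maximalIdeal R ^ j :=
  (exists_minimal_generators (maximalIdeal R ^ j)).choose_spec.choose_spec.1

theorem gen_mem (j : ℕ) (l) : gen R j l ∈ maximalIdeal R ^ j := by
  rw [← span_gen]; exact Ideal.subset_span ⟨l, rfl⟩

theorem gen_minimal {j : ℕ} {c : Fin (numGen R j) → R}
    (hc : ∑ l, c l * gen R j l ∈ maximalIdeal R ^ (j + 1)) (l) : c l ∈ maximalIdeal R :=
  (exists_minimal_generators (maximalIdeal R ^ j)).choose_spec.choose_spec.2 c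
    (by rwa [pow_succ'] at hc) l

theorem sum_gen_mem {i j : ℕ} {a : Fin (numGen R j) → M} (ha : ∀ l, a l ∈ adic R M i) :
    ∑ l, gen R j l • a l ∈ adic R M (j + i) :=
  Submodule.sum_mem _ fun l _ => smul_mem_adic (gen_mem j l) (ha l)

theorem exists_sum_gen_add {i j : ℕ} {x : M} (hx : x ∈ adic R M (j + i)) :
    ∃ a : Fin (numGen R j) → M, (∀ l, a l ∈ adic R M i) ∧ x = ∑ l, gen R j l • a l := by
  rw [adic, pow_add, mul_smul] at hx
  refine Submodule.smul_induction_on hx (fun r hr n hn => ?_) ?_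
  · rw [← span_gen, Ideal.span, Submodule.mem_span_range_iff_exists_fun] at hr
    obtain ⟨c, rfl⟩ := hr
    exact ⟨fun l => c l • n, fun l => Submodule.smul_mem _ _ hn, by
      rw [Finset.sum_smul]
      exact Finset.sum_congr rfl fun l _ => by rw [smul_smul, smul_eq_mul, mul_comm]⟩
  · rintro _ _ ⟨a, ha, rfl⟩ ⟨b, hb, rfl⟩
    exact ⟨a + b, fun l => Submodule.add_mem _ (ha l) (hb l), by
      simp [smul_add, Finset.sum_add_distrib]⟩

theorem exists_sum_gen {j : ℕ} {x : M} (hx : x ∈ adic R M j) :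
    ∃ a : Fin (numGen R j) → M, x = ∑ l, gen R j l • a l := by
  obtain ⟨a, _, h⟩ := exists_sum_gen_add (i := 0) hx
  exact ⟨a, h⟩

variable (R M) in
/-- The graded module of `M` is obtained from that of `R` by tensoring with `M / 𝔪 M`. -/
def GrFlat : Prop :=
  ∀ (j : ℕ) (a : Fin (numGen R j) → M), ∑ l, gen R j l • a l ∈ adic R M (j + 1) →
    ∀ l, a l ∈ adic R M 1

/-- Subtracting a combination with coefficients in `𝔪 M` turns the hypothesis into an exact
relation. By flatness it comes from relations among the generators over `R`, whose coefficients lie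
in `𝔪` by minimality. -/
theorem grFlat_of_flat [Module.Flat R M] : GrFlat R M := by
  intro j a ha
  obtain ⟨a', ha', h⟩ := exists_sum_gen_add ha
  have h0 : ∑ l, gen R j l • (a l - a' l) = 0 := by
    simp only [smul_sub, Finset.sum_sub_distrib, h, sub_self]
  obtain ⟨n, c, y, hy, hc⟩ := Module.Flat.isTrivialRelation_of_sum_smul_eq_zero h0
  intro l
  rw [← sub_add_cancel (a l) (a' l)]
  refine Submodule.add_mem _ ?_ (ha' l)
  have hy' : a l - a' l = _ := hy l
  rw [hy']
  refine Submodule.sum_mem _ fun p _ => smul_mem_adic_one ?_ _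
  refine gen_minimal (j := j) (c := fun l => c l p) ?_ l
  simp only [mul_comm (c _ p), hc]
  exact Ideal.zero_mem _

end AdicModules

/-! ### Flatness of complete modules, and recognition of the adic filtration -/

section FlatnessCriterion

open IsLocalRing

theorem one_tmul_eq_zero_iff {R M : Type*} [CommRing R] [AddCommGroup M] [Module R M]
    (I : Ideal R) (x : M) : (1 : R ⧸ I) ⊗ₜ[R] x = 0 ↔ x ∈ I • (⊤ : Submodule R M) := by
  have := TensorProduct.quotTensorEquivQuotSMul_mk_tmul I (1 : R) x
  rw [one_smul] at this
  rw [← Submodule.Quotient.mk_eq_zero, ← (TensorProduct.quotTensorEquivQuotSMul M I).map_eq_zero_iff]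
  exact Eq.congr_left this

variable {R : Type*} [CommRing R] [IsLocalRing R]
variable {M : Type*} [AddCommGroup M] [Module R M]

theorem mem_adic_one_iff (x : M) : x ∈ adic R M 1 ↔ (1 : ResidueField R) ⊗ₜ[R] x = 0 := by
  rw [adic_one]
  exact (one_tmul_eq_zero_iff (maximalIdeal R) x).symm

theorem mem_adic_self {j : ℕ} {r : R} : r ∈ adic R R j ↔ r ∈ maximalIdeal R ^ j := by
  simp [adic]

theorem finsupp_mem_adic {ι : Type*} {j : ℕ} {c : ι →₀ R} (h : ∀ i, c i ∈ maximalIdeal R ^ j) :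
    c ∈ adic R (ι →₀ R) j := by
  rw [← c.sum_single]
  refine Submodule.sum_mem _ fun i _ => ?_
  rw [show Finsupp.single i (c i) = c i • Finsupp.single i (1 : R) by simp]
  exact Submodule.smul_mem_smul (h i) trivial

theorem pi_mem_adic {n : ℕ} {j : ℕ} {c : Fin n → M} : 
    c ∈ adic R (Fin n → M) j ↔ ∀ i, c i ∈ adic R M j := by
  classical
  refine ⟨fun h i => map_mem_adic (LinearMap.proj i) h, fun h => ?_⟩
  rw [← Finset.univ_sum_single c]
  exact Submodule.sum_mem _ fun i _ => map_mem_adic (LinearMap.single R (fun _ => M) i) (h i)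

/-- A form of the Artin–Rees lemma. -/
theorem exists_lift_mem_adic [IsNoetherianRing R] {E F : Type*} [AddCommGroup E] [Module R E]
    [AddCommGroup F] [Module R F] [Module.Finite R F] (G : E →ₗ[R] F) :
    ∃ q : ℕ, ∀ n, ∀ x, G x ∈ adic R F n → ∃ y ∈ adic R E (n - q), G y = G x := by
  obtain ⟨q, hq⟩ := (maximalIdeal R).exists_pow_inf_eq_pow_smul (LinearMap.range G)
  refine ⟨q, fun n x hx => ?_⟩
  rcases le_total n q with h | h
  · exact ⟨x, by rw [Nat.sub_eq_zero_of_le h]; exact mem_adic_zero x, rfl⟩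
  · have h1 : G x ∈ maximalIdeal R ^ n • (⊤ : Submodule R F) ⊓ LinearMap.range G := ⟨hx, x, rfl⟩
    rw [hq n h] at h1
    have h2 : G x ∈ maximalIdeal R ^ (n - q) • LinearMap.range G :=
      Submodule.smul_mono le_rfl inf_le_right h1
    rw [LinearMap.range_eq_map, ← Submodule.map_smul''] at h2
    exact h2

/-- The shift `q` is the loss in the Artin–Rees lemma. Reindexing the partial sums by `n + q` gives
an honest Cauchy sequence; for `n ≤ q` the truncated subtraction makes the claim empty. -/
theorem exists_series_limit [IsPrecomplete (maximalIdeal R) M] (q : ℕ) (e : ℕ → M)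
    (he : ∀ n, e n ∈ adic R M (n - q)) :
    ∃ x, ∀ n, x - ∑ k ∈ Finset.range n, e k ∈ adic R M (n - q) := by
  obtain ⟨y, hy⟩ := exists_limit (R := R) (x := fun n => ∑ k ∈ Finset.range (n + q), e k)
    fun n => by
      rw [Nat.add_right_comm, Finset.sum_range_succ, add_sub_cancel_left]
      simpa using he (n + q)
  refine ⟨y, fun n => ?_⟩
  rcases le_total n q with h | h
  · rw [Nat.sub_eq_zero_of_le h]; exact mem_adic_zero _
  · obtain ⟨n, rfl⟩ := Nat.exists_eq_add_of_le' h
    simpa using hy n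

-- Lifts of a basis of `M / 𝔪 M`: linear independence gives the first property and spanning the
-- second. For a complete module with `GrFlat` they serve as a topological basis.
variable (R M) in
theorem exists_lifted_basis : ∃ v : Module.Basis.ofVectorSpaceIndex (ResidueField R) (ResidueField R ⊗[R] M) → M,
    (∀ c : _ →₀ R, Finsupp.linearCombination R v c ∈ adic R M 1 → c ∈ adic R (_ →₀ R) 1) ∧
    ∀ x, ∃ c, x - Finsupp.linearCombination R v c ∈ adic R M 1 := by
  let b := Module.Basis.ofVectorSpace (ResidueField R) (ResidueField R ⊗[R] M)
  obtain ⟨v, hv⟩ := (TensorProduct.mk_surjective R M (ResidueField R)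
    Ideal.Quotient.mk_surjective).comp_left b
  have hv' : ∀ i, (1 : ResidueField R) ⊗ₜ[R] v i = b i := fun i => congrFun hv i
  have key : ∀ c : _ →₀ R, (1 : ResidueField R) ⊗ₜ[R] Finsupp.linearCombination R v c =
      Finsupp.linearCombination (ResidueField R) b
        (c.mapRange (residue R) (map_zero _)) := by
    intro c
    rw [Finsupp.linearCombination_apply, Finsupp.linearCombination_apply,
      Finsupp.sum_mapRange_index (by simp), Finsupp.sum, Finsupp.sum, TensorProduct.tmul_sum]
    refine Finset.sum_congr rfl fun i _ => ?_
    rw [← hv', TensorProduct.tmul_smul]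
    rfl
  refine ⟨v, fun c hc => finsupp_mem_adic fun i => ?_, fun x => ?_⟩
  · rw [mem_adic_one_iff, key] at hc
    have := DFunLike.congr_fun (linearIndependent_iff.1 b.linearIndependent _ hc) i
    rw [pow_one]
    exact (residue_eq_zero_iff _).1 this
  · obtain ⟨c, hc⟩ := Finsupp.mapRange_surjective (α := Module.Basis.ofVectorSpaceIndex _ _)
      (residue R) (map_zero _) residue_surjective (b.repr ((1 : ResidueField R) ⊗ₜ[R] x))
    refine ⟨c, ?_⟩
    rw [mem_adic_one_iff, TensorProduct.tmul_sub, key, hc, b.linearCombination_repr, sub_self]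

variable [IsNoetherianRing R]

/-- Independence modulo `𝔪` propagates to all powers: write `c` through the generators of `𝔪 ^ j`,
and `GrFlat` reduces the next degree to the coefficients modulo `𝔪`. -/
theorem mem_adic_of_linearCombination_mem (hM : GrFlat R M) {ι : Type*} {v : ι → M}
    (hv : ∀ c : ι →₀ R, Finsupp.linearCombination R v c ∈ adic R M 1 →
      c ∈ adic R (ι →₀ R) 1) (j : ℕ) (c : ι →₀ R)
    (hc : Finsupp.linearCombination R v c ∈ adic R M j) : c ∈ adic R (ι →₀ R) j := by
  induction j with
  | zero => exact mem_adic_zero c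
  | succ j ih =>
    obtain ⟨d, rfl⟩ := exists_sum_gen (ih (adic_antitone j.le_succ hc))
    rw [map_sum] at hc
    simp only [map_smul] at hc
    exact sum_gen_mem fun l => hv _ (hM j _ hc l)

theorem exists_linearCombination_sub_mem {ι : Type*} {v : ι → M}
    (hv : ∀ x, ∃ c, x - Finsupp.linearCombination R v c ∈ adic R M 1) (j p : ℕ) (x : M)
    (hx : x ∈ adic R M p) :
    ∃ c ∈ adic R (ι →₀ R) p, x - Finsupp.linearCombination R v c ∈ adic R M j := by
  choose f hf using hv
  have key : ∀ p, ∀ x ∈ adic R M p,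
      ∃ c ∈ adic R (ι →₀ R) p, x - Finsupp.linearCombination R v c ∈ adic R M (p + 1) := by
    intro p x hx
    obtain ⟨a, rfl⟩ := exists_sum_gen hx
    refine ⟨∑ l, gen R p l • f (a l), ?_, ?_⟩
    · exact sum_gen_mem (i := 0) fun l => mem_adic_zero _
    · rw [map_sum]
      simp only [map_smul, ← Finset.sum_sub_distrib, ← smul_sub]
      exact sum_gen_mem fun l => hf _
  induction j with
  | zero => exact ⟨0, Submodule.zero_mem _, mem_adic_zero _⟩
  | succ j ih =>
    rcases le_or_gt p j with h | h
    · obtain ⟨c, hc, hc'⟩ := ih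
      obtain ⟨d, hd, hd'⟩ := key _ _ hc'
      refine ⟨c + d, Submodule.add_mem _ hc (adic_antitone h hd), ?_⟩
      rw [map_add, ← sub_sub]
      exact hd'
    · exact ⟨0, Submodule.zero_mem _, by simpa using adic_antitone h hx⟩

/-- The equational criterion: a solution `x` of `∑ f k • x k = 0` in `M` must be a combination of
the finitely many generators `g` of the syzygies of `f` over `R`. Modulo a high power of `𝔪`, `x`
has finite coordinates in `v`; these are approximate syzygies over `R`, which Artin–Rees corrects to
true ones. Successive approximation removes the remaining error. -/
theorem flat_of_topological_basis [IsAdicComplete (maximalIdeal R) M] (hM : GrFlat R M)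
    {ι : Type*} {v : ι → M} (hv1 : ∀ c : ι →₀ R,
      Finsupp.linearCombination R v c ∈ adic R M 1 → c ∈ adic R (ι →₀ R) 1)
    (hv2 : ∀ x, ∃ c, x - Finsupp.linearCombination R v c ∈ adic R M 1) :
    Module.Flat R M := by
  classical
  refine Module.Flat.of_forall_isTrivialRelation fun {l f x} hfx => ?_
  let φ : (Fin l → R) →ₗ[R] R := Fintype.linearCombination R f
  have hφ : ∀ w, φ w = ∑ k, w k * f k := fun w => by simp [φ, Fintype.linearCombination_apply]
  obtain ⟨t, g, hg⟩ := Submodule.fg_iff_exists_fin_generating_family.1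
    (IsNoetherian.noetherian (LinearMap.ker φ))
  let γ : (Fin t → R) →ₗ[R] (Fin l → R) := Fintype.linearCombination R g
  have hγ : ∀ w k, γ w k = ∑ i, w i * g i k := fun w k => by
    simp [γ, Fintype.linearCombination_apply]
  have hgφ : ∀ i, φ (g i) = 0 := fun i => by
    have : g i ∈ LinearMap.ker φ := hg ▸ Submodule.subset_span ⟨i, rfl⟩
    exact this
  -- The loss `q₁` occurs when approximate syzygies are corrected, the loss `q` when small syzygies
  -- are written with small coefficients in the generators `g`.
  obtain ⟨q₁, hq₁⟩ := exists_lift_mem_adic φ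
  obtain ⟨q, hq⟩ := exists_lift_mem_adic γ
  let Φ : (Fin l → M) →ₗ[R] M := ∑ k, f k • LinearMap.proj k
  have hΦ : ∀ z, Φ z = ∑ k, f k • z k := fun z => by simp [Φ]
  let Γ : (Fin t → M) →ₗ[R] (Fin l → M) := LinearMap.pi fun k => ∑ i, g i k • LinearMap.proj i
  have hΓ : ∀ y k, Γ y k = ∑ i, g i k • y i := fun y k => by simp [Γ]
  have hΦΓ : ∀ y, Φ (Γ y) = 0 := fun y => by
    simp only [hΦ, hΓ, Finset.smul_sum, smul_smul]
    rw [Finset.sum_comm]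
    refine Finset.sum_eq_zero fun i _ => ?_
    rw [← Finset.sum_smul]
    have := hgφ i
    rw [hφ] at this
    simp only [mul_comm (f _), this, zero_smul]
  suffices h : ∃ y, Γ y = x by
    obtain ⟨y, hy⟩ := h
    refine ⟨t, fun k i => g i k, y, fun k => ?_, fun i => ?_⟩
    · rw [← hy, hΓ]
    · rw [← hgφ i, hφ]
      simp only [mul_comm]
  refine exists_eq_of_filtration Γ (fun n => adic R (Fin t → M) (n - q))
    (fun n => adic R (Fin l → M) n ⊓ LinearMap.ker Φ)
    (fun n => adic R (Fin l → M) (n - q)) (z := x) ?_ ?_ ?_ ?_ ?_ ?_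
  · intro e he
    choose z hz using fun i => exists_series_limit (R := R) q (fun n => e n i)
      fun n => pi_mem_adic.1 (he n) i
    exact ⟨z, fun n => pi_mem_adic.2 fun i => by simpa using hz i n⟩
  · intro z hz
    ext k
    refine eq_zero_of_forall_mem_adic (R := R) fun n => ?_
    simpa using pi_mem_adic.1 (hz (n + q)) k
  · exact fun n e he => map_mem_adic Γ he
  · exact fun n => inf_le_left.trans (adic_antitone (Nat.sub_le n q))
  · rintro p z ⟨hz, hz0⟩
    -- The precision `p + 1 + q₁` leaves `p + 1` after the Artin–Rees loss for `φ`.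
    choose c hc hc' using fun k =>
      exists_linearCombination_sub_mem hv2 (p + 1 + q₁) p (z k) (pi_mem_adic.1 hz k)
    let J : Finset ι := Finset.univ.biUnion fun k => (c k).support
    have hJ : ∀ k, Finsupp.linearCombination R v (c k) = ∑ j ∈ J, c k j • v j := fun k => by
      rw [Finsupp.linearCombination_apply, Finsupp.sum_of_support_subset]
      · exact Finset.subset_biUnion_of_mem (fun k => (c k).support) (Finset.mem_univ k)
      · simp
    have h1 : ∑ k, f k • c k ∈ adic R (ι →₀ R) (p + 1 + q₁) := by
      refine mem_adic_of_linearCombination_mem hM hv1 _ _ ?_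
      have : Finsupp.linearCombination R v (∑ k, f k • c k) =
          Φ z - ∑ k, f k • (z k - Finsupp.linearCombination R v (c k)) := by
        simp [hΦ, smul_sub]
      rw [this, show Φ z = 0 from hz0, zero_sub]
      exact Submodule.neg_mem _ (Submodule.sum_mem _ fun k _ => Submodule.smul_mem _ _ (hc' k))
    have h2 : ∀ j, φ (fun k => c k j) ∈ adic R R (p + 1 + q₁) := fun j => by
      have := map_mem_adic (Finsupp.lapply j) h1
      rw [hφ]
      simpa [mul_comm] using this
    -- For each basis index `j`, the tuple of `j`-th coordinates is a syzygy up to the correction `u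
    -- j` in `𝔪 ^ (p + 1)`.
    choose u hu hu' using fun j => hq₁ _ _ (h2 j)
    simp only [Nat.add_sub_cancel] at hu
    have h3 : ∀ j, ∃ d, γ d = (fun k => c k j) - u j := fun j => by
      have : (fun k => c k j) - u j ∈ LinearMap.ker φ := by
        rw [LinearMap.mem_ker, map_sub, hu', sub_self]
      rw [← hg, ← Fintype.range_linearCombination] at this
      exact this
    choose d hd using h3
    have h4 : ∀ j, γ (d j) ∈ adic R (Fin l → R) p := fun j => by
      rw [hd]
      exact Submodule.sub_mem _ (pi_mem_adic.2 fun k => map_mem_adic (Finsupp.lapply j) (hc k))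
        (adic_antitone p.le_succ (hu j))
    choose e he he' using fun j => hq _ _ (h4 j)
    have hsum : ∀ n (w : ι → R), (∀ j, w j ∈ adic R R n) → ∑ j ∈ J, w j • v j ∈ adic R M n :=
      fun n w hw => Submodule.sum_mem _ fun j _ =>
        Submodule.smul_mem_smul (mem_adic_self.1 (hw j)) trivial
    refine ⟨fun i => ∑ j ∈ J, e j i • v j, pi_mem_adic.2 fun i =>
      hsum _ _ fun j => pi_mem_adic.1 (he j) i, ?_, ?_⟩
    · refine pi_mem_adic.2 fun k => ?_
      have h5 : Γ (fun i => ∑ j ∈ J, e j i • v j) k =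
          Finsupp.linearCombination R v (c k) - ∑ j ∈ J, u j k • v j := by
        rw [hΓ, hJ]
        simp only [Finset.smul_sum, smul_smul]
        rw [Finset.sum_comm, ← Finset.sum_sub_distrib]
        refine Finset.sum_congr rfl fun j _ => ?_
        rw [← Finset.sum_smul, ← sub_smul]
        have := congrFun ((he' j).trans (hd j)) k
        rw [hγ, Pi.sub_apply] at this
        rw [← this]
        simp only [mul_comm]
      rw [Pi.sub_apply, h5, ← sub_add]
      exact Submodule.add_mem _ (adic_antitone (Nat.le_add_right _ _) (hc' k))
        (hsum _ _ fun j => pi_mem_adic.1 (hu j) k)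
    · exact (map_sub Φ _ _).trans (by rw [hΦΓ, sub_zero]; exact hz0)
  · exact ⟨mem_adic_zero x, by exact (hΦ x).trans hfx⟩

/-- A complete module is flat if its graded module is that of a flat module. -/
theorem flat_of_grFlat [IsAdicComplete (maximalIdeal R) M] (hM : GrFlat R M) :
    Module.Flat R M := by
  obtain ⟨v, hv1, hv2⟩ := exists_lifted_basis R M
  exact flat_of_topological_basis hM hv1 hv2

/-- Completeness with respect to a filtration that is generated by the powers of `𝔪`. -/
theorem adic_eq_of_filtration (NN : ℕ → Submodule R M)
    (hanti : Antitone NN) (hle : ∀ j, adic R M j ≤ NN j) (hsep : ∀ x, (∀ j, x ∈ NN j) → x = 0)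
    (hlim : ∀ x : ℕ → M, (∀ n, x (n + 1) - x n ∈ NN n) → ∃ y, ∀ n, y - x n ∈ NN n)
    (hstep : ∀ j, NN j ≤ adic R M j ⊔ NN (j + 1)) (j : ℕ) : NN j = adic R M j := by
  refine le_antisymm (fun x hx => ?_) (hle j)
  -- The filtration is not assumed compatible with multiplication by `𝔪 ^ p`. Iterating `hstep`
  -- splits `y` into a part in `𝔪 ^ n M` and a part already in `NN (n + p)`.
  have hgen : ∀ {p : ℕ} {r : R}, r ∈ maximalIdeal R ^ p → ∀ (n : ℕ), ∀ y ∈ NN n,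
      r • y ∈ NN (p + n) := by
    have key : ∀ n p : ℕ, ∀ r ∈ maximalIdeal R ^ p, ∀ y, r • y ∈ NN p := fun n p r hr y =>
      hle p (Submodule.smul_mem_smul hr trivial)
    have key2 : ∀ d n : ℕ, NN n ≤ adic R M n ⊔ NN (n + d) := by
      intro d n
      induction d with
      | zero => exact le_sup_right
      | succ d ih =>
        refine ih.trans (sup_le le_sup_left ((hstep _).trans (sup_le ?_ le_sup_right)))
        exact (adic_antitone (Nat.le_add_right n d)).trans le_sup_left
    intro p r hr n y hy
    obtain ⟨a, ha, b, hb, rfl⟩ := Submodule.mem_sup.1 (key2 p n hy)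
    rw [smul_add]
    refine Submodule.add_mem _ (hle _ (smul_mem_adic hr ha)) ?_
    rw [add_comm p n]
    exact Submodule.smul_mem _ _ hb
  -- The image of `G` lies in `𝔪 ^ j M`, so it suffices to solve `G y = x` by successive
  -- approximation; each correction comes from `hstep`.
  let G : (Fin (numGen R j) → M) →ₗ[R] M := ∑ l, gen R j l • LinearMap.proj l
  have hG : ∀ a, G a = ∑ l, gen R j l • a l := fun a => by simp [G]
  suffices h : ∃ y, G y = x by
    obtain ⟨y, rfl⟩ := h
    rw [hG]
    exact sum_gen_mem (i := 0) fun l => mem_adic_zero _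
  refine exists_eq_of_filtration G (fun n => Submodule.pi Set.univ fun _ => NN n)
    (fun n => NN (j + n)) (fun n => NN (j + n)) (z := x) ?_ ?_ ?_ ?_ ?_ hx
  · intro e he
    choose z hz using fun l => hlim (fun n => ∑ k ∈ Finset.range n, e k l) fun n => by
      rw [Finset.sum_range_succ, add_sub_cancel_left]
      exact he n l trivial
    exact ⟨z, fun n l _ => by simpa using hz l n⟩
  · exact fun z hz => hsep z fun n => hanti (Nat.le_add_left n j) (hz n)
  · intro n e he
    rw [hG]
    exact Submodule.sum_mem _ fun l _ => hgen (gen_mem j l) n _ (he l trivial)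
  · exact fun n => le_rfl
  · intro n z hz
    obtain ⟨a, ha, b, hb, rfl⟩ := Submodule.mem_sup.1 (hstep _ hz)
    obtain ⟨c, hc, rfl⟩ := exists_sum_gen_add ha
    refine ⟨c, fun l _ => hle n (hc l), ?_⟩
    rw [hG, add_sub_cancel_left]
    exact hb

end FlatnessCriterion

/-! ### Maps that are dense up to powers of an element -/

section FormalLocalization

open IsLocalRing

variable {R : Type*} [CommRing R] [IsLocalRing R]
variable {A : Type*} [Ring A] [Algebra R A] {B : Type*} [Ring B] [Algebra R B]
variable {B' : Type*} [Ring B'] [Algebra R B']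

theorem mul_mem_adic_left (y : A) {j : ℕ} {x : A} (hx : x ∈ adic R A j) : y * x ∈ adic R A j :=
  map_mem_adic (LinearMap.mulLeft R y) hx

theorem mul_mem_adic_right (y : A) {j : ℕ} {x : A} (hx : x ∈ adic R A j) : x * y ∈ adic R A j :=
  map_mem_adic (LinearMap.mulRight R y) hx

theorem AlgHom.map_mem_adic (f : A →ₐ[R] B) {j : ℕ} {x : A} (hx : x ∈ adic R A j) :
    f x ∈ adic R B j :=
  _root_.map_mem_adic f.toLinearMap hx

theorem mem_adic_of_isUnit_mul {u : A} (hu : IsUnit u) {j : ℕ} {x : A}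
    (hx : u * x ∈ adic R A j) : x ∈ adic R A j := by
  obtain ⟨u, rfl⟩ := hu
  simpa using mul_mem_adic_left (↑u⁻¹ : A) hx

theorem one_sub_isUnit_of_mem_adic [IsAdicComplete (maximalIdeal R) A] {x : A}
    (hx : x ∈ adic R A 1) : IsUnit (1 - x) := by
  have hpow : ∀ n, x ^ n ∈ adic R A n := by
    intro n
    induction n with
    | zero => exact mem_adic_zero _
    | succ n ih =>
      rw [adic_one] at hx
      rw [pow_succ]
      generalize x ^ n = y at ih
      refine Submodule.smul_induction_on hx (fun r hr a _ => ?_) fun a b ha hb => ?_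
      · rw [mul_smul_comm, add_comm n 1]
        exact smul_mem_adic (by rwa [pow_one]) (mul_mem_adic_right a ih)
      · rw [mul_add]
        exact Submodule.add_mem _ ha hb
  obtain ⟨y, hy⟩ := exists_limit (R := R) (x := fun n => ∑ k ∈ Finset.range n, x ^ k)
    fun n => by rw [Finset.sum_range_succ, add_sub_cancel_left]; exact hpow n
  have h1 : (1 - x) * y = 1 := by
    rw [← sub_eq_zero]
    refine eq_zero_of_forall_mem_adic (R := R) fun n => ?_
    have : (1 - x) * y - 1 = (1 - x) * (y - ∑ k ∈ Finset.range n, x ^ k) - x ^ n := by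
      rw [mul_sub, mul_neg_geom_sum]; abel
    rw [this]
    exact Submodule.sub_mem _ (mul_mem_adic_left _ (hy n)) (hpow n)
  have h2 : y * (1 - x) = 1 := by
    rw [← sub_eq_zero]
    refine eq_zero_of_forall_mem_adic (R := R) fun n => ?_
    have : y * (1 - x) - 1 = (y - ∑ k ∈ Finset.range n, x ^ k) * (1 - x) - x ^ n := by
      rw [sub_mul, geom_sum_mul_neg]; abel
    rw [this]
    exact Submodule.sub_mem _ (mul_mem_adic_right _ (hy n)) (hpow n)
  exact ⟨⟨1 - x, y, h1, h2⟩, rfl⟩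

/-- The `R`-algebra homomorphism `ρ` is dense up to powers of `s`, which becomes invertible. -/
structure IsDenseAt (ρ : A →ₐ[R] B) (s : A) : Prop where
  isUnit : IsUnit (ρ s)
  exists_sub_mem : ∀ (b : B) (j : ℕ), ∃ (n : ℕ) (a : A), ρ s ^ n * b - ρ a ∈ adic R B j

namespace IsDenseAt

variable {ρ : A →ₐ[R] B} {s : A} (hρ : IsDenseAt ρ s)

include hρ

/-- Expanding `δ (ρ s ^ n * b)` by the Leibniz rule expresses a unit times `δ b` through values of
`δ` on the image of `ρ`, up to an element of `𝔪 ^ j B'`. -/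
theorem derivation_mem {g : B →ₐ[R] B'} {δ : B →ₗ[R] B'}
    (hδ : ∀ x y, δ (x * y) = δ x * g y + g x * δ y) {j : ℕ}
    (h : ∀ a, δ (ρ a) ∈ adic R B' j) (b : B) : δ b ∈ adic R B' j := by
  obtain ⟨n, a, ha⟩ := hρ.exists_sub_mem b j
  refine mem_adic_of_isUnit_mul ((hρ.isUnit.map g).pow n) ?_
  have h1 : g (ρ s) ^ n * δ b = δ (ρ s ^ n * b - ρ a) + δ (ρ a) - δ (ρ (s ^ n)) * g b := by
    rw [map_sub, hδ, map_pow g, map_pow ρ]; abel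
  rw [h1]
  exact Submodule.sub_mem _ (Submodule.add_mem _ (map_mem_adic δ ha) (h a))
    (mul_mem_adic_right _ (h _))

theorem derivation_eq_zero [IsHausdorff (maximalIdeal R) B'] {g : B →ₐ[R] B'} {δ : B →ₗ[R] B'}
    (hδ : ∀ x y, δ (x * y) = δ x * g y + g x * δ y)
    (h : ∀ a, δ (ρ a) = 0) (b : B) : δ b = 0 :=
  eq_zero_of_forall_mem_adic (R := R) fun j =>
    hρ.derivation_mem hδ (fun a => by rw [h]; exact Submodule.zero_mem _) b

theorem algHom_ext [IsHausdorff (maximalIdeal R) B'] {g₁ g₂ : B →ₐ[R] B'}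
    (h : ∀ a, g₁ (ρ a) = g₂ (ρ a)) : g₁ = g₂ := by
  ext b
  rw [← sub_eq_zero]
  refine eq_zero_of_forall_mem_adic (R := R) fun j => ?_
  obtain ⟨n, a, ha⟩ := hρ.exists_sub_mem b j
  refine mem_adic_of_isUnit_mul ((hρ.isUnit.map g₁).pow n) ?_
  have h1 : g₁ (ρ s) ^ n * (g₁ b - g₂ b) = g₁ (ρ s ^ n * b - ρ a) - g₂ (ρ s ^ n * b - ρ a) := by
    rw [map_sub, map_sub, map_mul, map_mul, map_pow, map_pow, h, h, mul_sub]; abel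
  rw [h1]
  exact Submodule.sub_mem _ (g₁.map_mem_adic ha) (g₂.map_mem_adic ha)

/-- The graph of the extension of `h` along `ρ`. -/
def extensionGraph (h : A →ₐ[R] B')
    (hker : ∀ a j, ρ a ∈ adic R B j → h a ∈ adic R B' j) : Subalgebra R (B × B') where
  carrier := {b | ∀ j, ∃ (n : ℕ) (a : A),
    ρ s ^ n * b.1 - ρ a ∈ adic R B j ∧ h s ^ n * b.2 - h a ∈ adic R B' j}
  algebraMap_mem' r j := ⟨0, algebraMap R A r, by simp, by simp⟩
  add_mem' {x y} hx hy j := by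
    obtain ⟨n, a, h1, h2⟩ := hx j
    obtain ⟨m, b, h3, h4⟩ := hy j
    refine ⟨n + m, s ^ m * a + s ^ n * b, ?_, ?_⟩
    · have : ρ s ^ (n + m) * (x + y).1 - ρ (s ^ m * a + s ^ n * b) =
          ρ s ^ m * (ρ s ^ n * x.1 - ρ a) + ρ s ^ n * (ρ s ^ m * y.1 - ρ b) := by
        simp only [map_add, map_mul, map_pow, mul_sub, ← mul_assoc, ← pow_add, Prod.fst_add,
          mul_add, add_comm m n]
        abel
      rw [this]
      exact Submodule.add_mem _ (mul_mem_adic_left _ h1) (mul_mem_adic_left _ h3)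
    · have : h s ^ (n + m) * (x + y).2 - h (s ^ m * a + s ^ n * b) =
          h s ^ m * (h s ^ n * x.2 - h a) + h s ^ n * (h s ^ m * y.2 - h b) := by
        simp only [map_add, map_mul, map_pow, mul_sub, ← mul_assoc, ← pow_add, Prod.snd_add,
          mul_add, add_comm m n]
        abel
      rw [this]
      exact Submodule.add_mem _ (mul_mem_adic_left _ h2) (mul_mem_adic_left _ h4)
  mul_mem' {x y} hx hy j := by
    obtain ⟨n, a, h1, h2⟩ := hx j
    obtain ⟨m, b, h3, h4⟩ := hy j
    -- In a product of left fractions `s⁻ⁿ a · s⁻ᵐ b` the denominator `sᵐ` must move past `a`.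
    -- Density applied to `a s⁻ᵐ` gives an Ore relation `sᵖ a ≡ c sᵐ` modulo `𝔪 ^ j`, which `hker`
    -- transports along `h`.
    obtain ⟨p, c, hc⟩ := hρ.exists_sub_mem (ρ a * ↑((hρ.isUnit.pow m).unit⁻¹)) j
    have h5 : ρ (s ^ p * a - c * s ^ m) ∈ adic R B j := by
      have := mul_mem_adic_right (ρ s ^ m) hc
      rwa [sub_mul, ← mul_assoc, mul_assoc, IsUnit.val_inv_mul, mul_one, ← map_pow, ← map_pow,
        ← map_mul, ← map_mul, ← map_sub] at this
    have h6 := hker _ _ h5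
    refine ⟨p + n, c * b, ?_, ?_⟩
    · have : ρ s ^ (p + n) * (x * y).1 - ρ (c * b) = ρ s ^ p * (ρ s ^ n * x.1 - ρ a) * y.1 +
          ρ (s ^ p * a - c * s ^ m) * y.1 + ρ c * (ρ s ^ m * y.1 - ρ b) := by
        simp only [map_sub, map_mul, map_pow, Prod.fst_mul, pow_add]
        noncomm_ring
      rw [this]
      exact Submodule.add_mem _ (Submodule.add_mem _ (mul_mem_adic_right _ (mul_mem_adic_left _ h1))
        (mul_mem_adic_right _ h5)) (mul_mem_adic_left _ h3)
    · have : h s ^ (p + n) * (x * y).2 - h (c * b) = h s ^ p * (h s ^ n * x.2 - h a) * y.2 +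
          h (s ^ p * a - c * s ^ m) * y.2 + h c * (h s ^ m * y.2 - h b) := by
        simp only [map_sub, map_mul, map_pow, Prod.snd_mul, pow_add]
        noncomm_ring
      rw [this]
      exact Submodule.add_mem _ (Submodule.add_mem _ (mul_mem_adic_right _ (mul_mem_adic_left _ h2))
        (mul_mem_adic_right _ h6)) (mul_mem_adic_left _ h4)

/-- The graph projects bijectively to `B`: injectively because `B'` is separated, surjectively
because fractions `h(s)⁻ⁿ h(a)` attached to better and better approximations of `b` converge in
`B'`. -/
theorem exists_extension [IsAdicComplete (maximalIdeal R) B']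
    [IsHausdorff (maximalIdeal R) B] (h : A →ₐ[R] B')
    (hs : IsUnit (h s)) (hker : ∀ a j, ρ a ∈ adic R B j → h a ∈ adic R B' j) :
    ∃ g : B →ₐ[R] B', ∀ a, g (ρ a) = h a := by
  let Γ := hρ.extensionGraph h hker
  let π : Γ →ₐ[R] B := (AlgHom.fst R B B').comp Γ.val
  have hinj : Function.Injective π := by
    refine (injective_iff_map_eq_zero π).2 ?_
    rintro ⟨⟨b, b'⟩, hb⟩ (rfl : b = 0)
    have : b' = 0 := by
      refine eq_zero_of_forall_mem_adic (R := R) fun j => ?_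
      obtain ⟨n, a, h1, h2⟩ := hb j
      simp only [mul_zero, zero_sub, Submodule.neg_mem_iff] at h1 h2
      refine mem_adic_of_isUnit_mul (hs.pow n) ?_
      simpa using Submodule.add_mem _ h2 (hker _ _ h1)
    subst this
    rfl
  have hsurj : Function.Surjective π := by
    intro b
    choose n a ha using fun j => hρ.exists_sub_mem b j
    let v : ∀ j, B'ˣ := fun j => (hs.pow (n j)).unit
    have hv : ∀ j, (v j : B') = h s ^ n j := fun j => rfl
    obtain ⟨b', hb'⟩ := exists_limit (R := R) (x := fun j => (↑(v j)⁻¹ : B') * h (a j)) fun j => by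
      have h1 : ρ (s ^ n (j + 1) * a j - s ^ n j * a (j + 1)) ∈ adic R B j := by
        have : ρ (s ^ n (j + 1) * a j - s ^ n j * a (j + 1)) =
            ρ s ^ n j * (ρ s ^ n (j + 1) * b - ρ (a (j + 1))) -
              ρ s ^ n (j + 1) * (ρ s ^ n j * b - ρ (a j)) := by
          simp only [map_sub, map_mul, map_pow, mul_sub, ← mul_assoc, ← pow_add,
            add_comm (n j)]
          abel
        rw [this]
        exact Submodule.sub_mem _ (mul_mem_adic_left _ (adic_antitone j.le_succ (ha (j + 1))))
          (mul_mem_adic_left _ (ha j))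
      refine mem_adic_of_isUnit_mul (v j).isUnit (mem_adic_of_isUnit_mul (v (j + 1)).isUnit ?_)
      have h2 : (v (j + 1) : B') * (v j * ((↑(v (j + 1))⁻¹ : B') * h (a (j + 1)) -
          (↑(v j)⁻¹ : B') * h (a j))) = -h (s ^ n (j + 1) * a j - s ^ n j * a (j + 1)) := by
        have h3 : (v (j + 1) : B') * v j = v j * v (j + 1) := by
          rw [hv, hv, ← pow_add, ← pow_add, add_comm]
        rw [mul_sub, mul_sub, ← mul_assoc (v (j + 1) : B'), h3, ← mul_assoc, mul_assoc (v j : B'),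
          Units.mul_inv, mul_one, ← mul_assoc (v j : B'), Units.mul_inv, one_mul, hv, hv]
        simp
      rw [h2]
      exact Submodule.neg_mem _ (hker _ _ h1)
    refine ⟨⟨(b, b'), fun j => ⟨n j, a j, ha j, ?_⟩⟩, rfl⟩
    have : h s ^ n j * b' - h (a j) = v j * (b' - (↑(v j)⁻¹ : B') * h (a j)) := by
      rw [mul_sub, ← mul_assoc, Units.mul_inv, one_mul]; rfl
    change h s ^ n j * b' - h (a j) ∈ _
    rw [this]
    exact mul_mem_adic_left _ (hb' j)
  let e := AlgEquiv.ofBijective π ⟨hinj, hsurj⟩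
  refine ⟨((AlgHom.snd R B B').comp Γ.val).comp e.symm, fun a => ?_⟩
  have h1 : e.symm (ρ a) = ⟨(ρ a, h a), fun j => ⟨0, a, by simp, by simp⟩⟩ := by
    rw [AlgEquiv.symm_apply_eq]; rfl
  change (e.symm (ρ a)).1.2 = h a
  rw [h1]

end IsDenseAt

end FormalLocalization

/-! ### Formal deformations over a localization of the reduced algebra -/

section FormalDeformation

open IsLocalRing

variable {R : Type*} [CommRing R] [IsLocalRing R] [IsNoetherianRing R]
variable {A : Type*} [Ring A] [Algebra R A] {B : Type*} [Ring B] [Algebra R B]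
variable {C : Type*} [CommRing C] [Algebra R C] {C' : Type*} [CommRing C'] [Algebra R C']

/-- The algebra `A` is complete and flat over `R`, and `ε` identifies `A / 𝔪 A` with `C`. -/
structure IsFormalDeformation (ε : A →ₐ[R] C) : Prop where
  complete : IsAdicComplete (maximalIdeal R) A
  grFlat : GrFlat R A
  surjective : Function.Surjective ε
  eq_zero_iff : ∀ a, ε a = 0 ↔ a ∈ adic R A 1

/-- The homomorphism `θ` exhibits `C'` as the localization of `C` at the powers of `c`. -/
structure IsAwayMap (θ : C →ₐ[R] C') (c : C) : Prop where
  isUnit : IsUnit (θ c)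
  surjective : ∀ x, ∃ (n : ℕ) (d : C), θ c ^ n * x = θ d
  exists_pow_mul_eq_zero : ∀ d, θ d = 0 → ∃ n : ℕ, c ^ n * d = 0

theorem exists_uniform_pow {ι M : Type*} [Finite ι] [Ring M] (s : M) {P : ι → M → Prop}
    (hP : ∀ i x, P i x → P i (s * x)) (h : ∀ i, ∃ n : ℕ, P i (s ^ n)) :
    ∃ n : ℕ, ∀ i, P i (s ^ n) := by
  have hP' : ∀ i (k n : ℕ), P i (s ^ n) → P i (s ^ (k + n)) := fun i k n hn => by
    induction k with
    | zero => rwa [zero_add]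
    | succ k ih => rw [Nat.add_right_comm, pow_succ']; exact hP _ _ ih
  choose n hn using h
  obtain ⟨N, hN⟩ := Finite.bddAbove_range n
  refine ⟨N, fun i => ?_⟩
  obtain ⟨k, hk⟩ := Nat.exists_eq_add_of_le' (hN ⟨i, rfl⟩)
  rw [hk]
  exact hP' _ _ _ (hn i)

namespace IsFormalDeformation

/-- By completeness every element of `1 + 𝔪 A` is a unit, so lifting an inverse modulo `𝔪` gives
inverses on both sides. -/
theorem isUnit_of_isUnit {ε : A →ₐ[R] C} (hε : IsFormalDeformation ε) {a : A}
    (ha : IsUnit (ε a)) : IsUnit a := by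
  have := hε.complete
  obtain ⟨c, hc⟩ := ha.exists_right_inv
  obtain ⟨b, rfl⟩ := hε.surjective c
  have h1 : IsUnit (a * b) := by
    rw [← sub_sub_cancel 1 (a * b)]
    refine one_sub_isUnit_of_mem_adic (R := R) ?_
    rw [← hε.eq_zero_iff, map_sub, map_mul, hc, map_one, sub_self]
  have h2 : IsUnit (b * a) := by
    rw [← sub_sub_cancel 1 (b * a)]
    refine one_sub_isUnit_of_mem_adic (R := R) ?_
    rw [← hε.eq_zero_iff, map_sub, map_mul, mul_comm, hc, map_one, sub_self]
  obtain ⟨x, hx⟩ := h1.exists_right_inv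
  obtain ⟨y, hy⟩ := h2.exists_left_inv
  -- Here `b * x` is a right inverse of `a` and `y * b` a left inverse, so they coincide.
  have h3 : y * b = b * x := by
    calc y * b = y * b * (a * b * x) := by rw [hx, mul_one]
      _ = y * (b * a) * (b * x) := by noncomm_ring
      _ = b * x := by rw [hy, one_mul]
  exact ⟨⟨a, b * x, by rw [← mul_assoc, hx], by rw [← h3, mul_assoc, hy]⟩, rfl⟩

theorem commutator_mem {ε : A →ₐ[R] C} (hε : IsFormalDeformation ε) (a b : A) :
    a * b - b * a ∈ adic R A 1 := by
  rw [← hε.eq_zero_iff, map_sub, map_mul, map_mul, mul_comm, sub_self]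

section

variable {εA : A →ₐ[R] C} {εB : B →ₐ[R] C'} (hA : IsFormalDeformation εA)
  (hB : IsFormalDeformation εB) {ρ : A →ₐ[R] B} {θ : C →ₐ[R] C'}
  (hρ : ∀ a, εB (ρ a) = θ (εA a)) {s : A} (hθ : IsAwayMap θ (εA s))

include hA hB hρ hθ

/-- The error in degree `j` is a combination of generators of `𝔪 ^ j`. The augmentations of its
coefficients are fractions over `C`; a common power of `s` clears the denominators, and the
numerators lift to `A`. -/
theorem isDenseAt : IsDenseAt ρ s where
  isUnit := hB.isUnit_of_isUnit (by rw [hρ]; exact hθ.isUnit)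
  exists_sub_mem b j := by
    induction j with
    | zero => exact ⟨0, 0, mem_adic_zero _⟩
    | succ j ih =>
      obtain ⟨n, a, ha⟩ := ih
      obtain ⟨d, hd⟩ := exists_sum_gen ha
      obtain ⟨m, hm⟩ := exists_uniform_pow (ι := Fin (numGen R j)) (εA s)
        (P := fun l x => ∃ c, θ x * εB (d l) = θ c)
        (fun l x ⟨c, hc⟩ => ⟨εA s * c, by rw [map_mul, map_mul, mul_assoc, hc]⟩)
        (fun l => by simpa using hθ.surjective (εB (d l)))
      choose c hc using hm
      choose e he using fun l => hA.surjective (c l)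
      refine ⟨m + n, s ^ m * a + ∑ l, gen R j l • e l, ?_⟩
      have h1 : ρ s ^ (m + n) * b - ρ (s ^ m * a + ∑ l, gen R j l • e l) =
          ∑ l, gen R j l • (ρ s ^ m * d l - ρ (e l)) := by
        have h2 : ρ s ^ (m + n) * b - ρ (s ^ m * a) = ρ s ^ m * ∑ l, gen R j l • d l := by
          rw [← hd, mul_sub, map_mul, map_pow, pow_add, mul_assoc]
        rw [map_add, ← sub_sub, h2, map_sum, Finset.mul_sum, ← Finset.sum_sub_distrib]
        exact Finset.sum_congr rfl fun l _ => by rw [map_smul, mul_smul_comm, smul_sub]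
      rw [h1]
      refine sum_gen_mem fun l => ?_
      rw [← hB.eq_zero_iff, map_sub, map_mul, map_pow, hρ, hρ, he, ← map_pow, hc, sub_self]

/-- `GrFlat` for `B` shows that the leading coefficients of `a` vanish in `C'`; a common power of
`s` then kills them in `C`, which raises the degree by one. -/
theorem exists_pow_mul_mem {a : A} {j : ℕ} (ha : ρ a ∈ adic R B j) :
    ∃ n : ℕ, s ^ n * a ∈ adic R A j := by
  induction j with
  | zero => exact ⟨0, mem_adic_zero _⟩
  | succ j ih =>
    obtain ⟨n, hn⟩ := ih (adic_antitone j.le_succ ha)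
    obtain ⟨d, hd⟩ := exists_sum_gen hn
    have h1 : ∑ l, gen R j l • ρ (d l) ∈ adic R B (j + 1) := by
      have : ∑ l, gen R j l • ρ (d l) = ρ s ^ n * ρ a := by
        rw [← map_pow, ← map_mul, hd, map_sum]
        simp only [map_smul]
      rw [this]
      exact mul_mem_adic_left _ ha
    obtain ⟨m, hm⟩ := exists_uniform_pow (ι := Fin (numGen R j)) (εA s)
      (P := fun l x => x * εA (d l) = 0) (fun l x hx => by rw [mul_assoc, hx, mul_zero])
      (fun l => hθ.exists_pow_mul_eq_zero _ (by
        rw [← hρ, hB.eq_zero_iff]; exact hB.grFlat j _ h1 l))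
    refine ⟨m + n, ?_⟩
    rw [pow_add, mul_assoc, hd, Finset.mul_sum]
    simp only [mul_smul_comm]
    refine sum_gen_mem fun l => ?_
    rw [← hA.eq_zero_iff, map_mul, map_pow, hm]

/-- The universal property of `B` as a completed localization of `A`, valid for any compatible pair
of formal deformations. The adic condition on `h` follows since an element small in `B` is small in
`A` after multiplication by a power of `s`. -/
theorem exists_extension {B' : Type*} [Ring B'] [Algebra R B']
    [IsAdicComplete (maximalIdeal R) B'] (h : A →ₐ[R] B') (hs : IsUnit (h s)) :
    ∃ g : B →ₐ[R] B', ∀ a, g (ρ a) = h a := by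
  have := hB.complete
  refine (hA.isDenseAt hB hρ hθ).exists_extension h hs fun a j ha => ?_
  obtain ⟨n, hn⟩ := hA.exists_pow_mul_mem hB hρ hθ ha
  refine mem_adic_of_isUnit_mul (hs.pow n) ?_
  rw [← map_pow, ← map_mul]
  exact h.map_mem_adic hn

end

end IsFormalDeformation

end FormalDeformation

/-! ### Construction of completed localizations by Ore localization -/

section OreLocalization

open IsLocalRing

/-- Commutation with `t` raises the filtration, which is zero in degree `n`, so it is nilpotent.
Descending induction on the degree shows that `t ^ n` works as the multiplier in both Ore
conditions. -/
theorem nonempty_oreSet_powers {Q : Type*} [Ring Q] (I : ℕ → Set Q) (h0 : ∀ x, x ∈ I 0)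
    (hI : ∀ j, ∀ x ∈ I j, ∀ y : Q, y * x - x * y ∈ I (j + 1)) {n : ℕ} (hn : ∀ x ∈ I n, x = 0)
    (s : Q) : Nonempty (OreLocalization.OreSet (Submonoid.powers s)) := by
  have key1 : ∀ t : Q, ∀ d j, j + d = n → ∀ x ∈ I j, ∃ y, t ^ d * x = y * t := by
    intro t d
    induction d with
    | zero =>
      intro j hj x hx
      obtain rfl : j = n := hj
      exact ⟨0, by rw [hn x hx, mul_zero, zero_mul]⟩
    | succ d ih =>
      intro j hj x hx
      obtain ⟨y, hy⟩ := ih (j + 1) (by omega) _ (hI j x hx t)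
      -- From `t ^ (d + 1) x = t ^ d (t x - x t) + t ^ d x t`, where the commutator lies one degree
      -- deeper.
      refine ⟨y + t ^ d * x, ?_⟩
      rw [add_mul, ← hy, pow_succ, mul_sub]
      noncomm_ring
  have key2 : ∀ t : Q, ∀ d j, j + d = n → ∀ x ∈ I j, x * t = 0 → t ^ d * x = 0 := by
    intro t d
    induction d with
    | zero =>
      intro j hj x hx _
      obtain rfl : j = n := hj
      rw [hn x hx, mul_zero]
    | succ d ih =>
      intro j hj x hx hxt
      have := ih (j + 1) (by omega) _ (hI j x hx t) (by
        rw [sub_mul, mul_assoc, hxt, mul_zero, zero_mul, sub_zero])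
      rwa [hxt, sub_zero, ← mul_assoc, ← pow_succ] at this
  rw [OreLocalization.nonempty_oreSet_iff]
  refine ⟨fun x y t h => ⟨t ^ n, ?_⟩, fun x t => ?_⟩
  · have := key2 t n 0 (zero_add n) (x - y) (h0 _) (by rw [sub_mul, h, sub_self])
    rw [mul_sub, sub_eq_zero] at this
    exact_mod_cast this
  · obtain ⟨y, hy⟩ := key1 t n 0 (zero_add n) x (h0 _)
    exact ⟨y, t ^ n, by exact_mod_cast hy⟩

variable {R : Type u} [CommRing R] [IsLocalRing R]
variable {A : Type u} [Ring A] [Algebra R A]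

theorem isAdicComplete_of_adic_eq_bot {M : Type*} [AddCommGroup M] [Module R M] {n : ℕ}
    (h : adic R M n = ⊥) : IsAdicComplete (maximalIdeal R) M := by
  refine isAdicComplete_of_limits (fun x hx => by simpa [h] using hx n) fun x hx =>
    ⟨x n, fun k => ?_⟩
  have h0 : ∀ d, x (n + d) = x n := by
    intro d
    induction d with
    | zero => rfl
    | succ d ih =>
      rw [← ih, ← sub_eq_zero, ← Submodule.mem_bot R, ← h]
      exact adic_antitone (Nat.le_add_right n d) (hx (n + d))
  have h1 : ∀ d, x (k + d) - x k ∈ adic R M k := by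
    intro d
    induction d with
    | zero => simp
    | succ d ih =>
      rw [← sub_add_sub_cancel]
      exact Submodule.add_mem _ (adic_antitone (Nat.le_add_right k d) (hx (k + d))) ih
  rw [← h0 k, add_comm]
  exact h1 n

theorem commutator_mem_adic_succ (h : ∀ a b : A, a * b - b * a ∈ adic R A 1) {j : ℕ} {x : A}
    (hx : x ∈ adic R A j) (y : A) : y * x - x * y ∈ adic R A (j + 1) := by
  refine Submodule.smul_induction_on hx (fun r hr a _ => ?_) fun a b ha hb => ?_
  · rw [mul_smul_comm, smul_mul_assoc, ← smul_sub]
    exact smul_mem_adic hr (h y a)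
  · rw [mul_add, add_mul, add_sub_add_comm]
    exact Submodule.add_mem _ ha hb

/-- The localization of `A / 𝔪 ^ j A` at the powers of an element. -/
theorem exists_localization (h : ∀ a b : A, a * b - b * a ∈ adic R A 1) (s : A) (j : ℕ) :
    ∃ (L : AlgCat.{u} R) (φ : A →ₐ[R] L), IsUnit (φ s) ∧
      (∀ x, ∃ (n : ℕ) (a : A), φ s ^ n * x = φ a) ∧
      ∀ a, φ a = 0 ↔ ∃ n : ℕ, s ^ n * a ∈ adic R A j := by
  let I : Ideal A :=
    { carrier := adic R A j
      add_mem' := Submodule.add_mem _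
      zero_mem' := Submodule.zero_mem _
      smul_mem' := fun y x hx => mul_mem_adic_left y hx }
  have : I.IsTwoSided := ⟨fun y hx => mul_mem_adic_right y hx⟩
  let q : A →ₐ[R] A ⧸ I := Ideal.Quotient.mkₐ R I
  have hq : Function.Surjective q := Ideal.Quotient.mk_surjective
  have hq0 : ∀ a, q a = 0 ↔ a ∈ adic R A j := fun a => Ideal.Quotient.eq_zero_iff_mem
  obtain ⟨_⟩ := nonempty_oreSet_powers (fun i => q '' adic R A i)
    (fun x => by obtain ⟨a, rfl⟩ := hq x; exact ⟨a, mem_adic_zero a, rfl⟩)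
    (by
      rintro i _ ⟨a, ha, rfl⟩ y
      obtain ⟨b, rfl⟩ := hq y
      exact ⟨b * a - a * b, commutator_mem_adic_succ h ha b, by simp⟩)
    (n := j) (by rintro _ ⟨a, ha, rfl⟩; exact (hq0 a).2 ha) (q s)
  let S := Submonoid.powers (q s)
  let ν : A ⧸ I →ₐ[R] OreLocalization S (A ⧸ I) :=
    { OreLocalization.numeratorRingHom with commutes' := fun r => rfl }
  have hν : ∀ x, ν x = x /ₒ (1 : S) := fun x => rfl
  refine ⟨AlgCat.of R (OreLocalization S (A ⧸ I)), ν.comp q,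
    OreLocalization.numerator_isUnit (⟨q s, Submonoid.mem_powers _⟩ : S), fun x => ?_, fun a => ?_⟩
  · induction x using OreLocalization.ind with | _ r t
    obtain ⟨_, n, rfl⟩ := t
    obtain ⟨a, rfl⟩ := hq r
    refine ⟨n, a, ?_⟩
    change ν (q s) ^ n * _ = ν (q a)
    rw [← map_pow, hν, hν]
    exact OreLocalization.mul_cancel (s := (⟨q s ^ n, n, rfl⟩ : S)) (t := 1)
  · change ν (q a) = 0 ↔ _
    rw [hν, OreLocalization.zero_def, OreLocalization.oreDiv_eq_iff]
    constructor
    · rintro ⟨⟨_, n, rfl⟩, v, h1, h2⟩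
      refine ⟨n, ?_⟩
      have h3 : v = q s ^ n := by simpa using h2.symm
      rw [← hq0, map_mul, map_pow, ← h3]
      simpa using h1.symm
    · rintro ⟨n, hn⟩
      refine ⟨⟨_, n, rfl⟩, q s ^ n, ?_, ?_⟩
      · rw [← hq0, map_mul, map_pow] at hn
        simpa using hn.symm
      · simp

/-- The properties of the localization of `A / 𝔪 ^ j A` at the powers of `s`. -/
structure IsTruncatedLocalization {L : Type*} [Ring L] [Algebra R L] (φ : A →ₐ[R] L) (s : A)
    (j : ℕ) : Prop where
  isUnit : IsUnit (φ s)
  exists_pow_mul : ∀ x, ∃ (n : ℕ) (a : A), φ s ^ n * x = φ a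
  eq_zero_iff : ∀ a, φ a = 0 ↔ ∃ n : ℕ, s ^ n * a ∈ adic R A j

namespace IsTruncatedLocalization

variable {L : Type*} [Ring L] [Algebra R L] {φ : A →ₐ[R] L} {s : A} {i : ℕ}
  (hφ : IsTruncatedLocalization φ s i)

include hφ

theorem isDenseAt : IsDenseAt φ s where
  isUnit := hφ.isUnit
  exists_sub_mem x j := by
    obtain ⟨n, a, h⟩ := hφ.exists_pow_mul x
    exact ⟨n, a, by rw [h, sub_self]; exact Submodule.zero_mem _⟩

theorem eq_zero_of_mul {n : ℕ} {x : L} (h : φ s ^ n * x = 0) : x = 0 :=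
  ((hφ.isUnit.pow n).mul_right_eq_zero).1 h

theorem exists_pow_mul_fin {n : ℕ} (x : Fin n → L) :
    ∃ (k : ℕ) (a : Fin n → A), ∀ l, φ s ^ k * x l = φ (a l) := by
  obtain ⟨k, hk⟩ := exists_uniform_pow s (P := fun l y => ∃ a, φ y * x l = φ a)
    (fun l y ⟨a, ha⟩ => ⟨s * a, by rw [map_mul, map_mul, mul_assoc, ha]⟩)
    (fun l => by simpa using hφ.exists_pow_mul (x l))
  choose a ha using hk
  exact ⟨k, a, fun l => by rw [← map_pow, ha]⟩

variable [IsNoetherianRing R]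

theorem exists_pow_mul_of_mem {j : ℕ} {x : L} (hx : x ∈ adic R L j) :
    ∃ (n : ℕ) (a : A), a ∈ adic R A j ∧ φ s ^ n * x = φ a := by
  obtain ⟨y, rfl⟩ := exists_sum_gen hx
  obtain ⟨n, a, ha⟩ := hφ.exists_pow_mul_fin y
  refine ⟨n, ∑ l, gen R j l • a l, sum_gen_mem (i := 0) fun l => mem_adic_zero _, ?_⟩
  rw [Finset.mul_sum, map_sum]
  exact Finset.sum_congr rfl fun l _ => by rw [mul_smul_comm, ha, map_smul]

/-- Numerators of elements of `𝔪 ^ j L` can be taken in `𝔪 ^ j A`. The minimum appears because `𝔪 ^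
i A` already dies in `L`. -/
theorem map_mem_adic_iff {a : A} {j : ℕ} :
    φ a ∈ adic R L j ↔ ∃ n : ℕ, s ^ n * a ∈ adic R A (min i j) := by
  constructor
  · intro h
    obtain ⟨n, b, hb, hn⟩ := hφ.exists_pow_mul_of_mem h
    obtain ⟨m, hm⟩ := (hφ.eq_zero_iff (s ^ n * a - b)).1 (by
      rw [map_sub, map_mul, map_pow, hn, sub_self])
    refine ⟨m + n, ?_⟩
    have : s ^ (m + n) * a = s ^ m * (s ^ n * a - b) + s ^ m * b := by
      rw [mul_sub, sub_add_cancel, pow_add, mul_assoc]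
    rw [this]
    exact Submodule.add_mem _ (adic_antitone (min_le_left _ _) hm)
      (adic_antitone (min_le_right _ _) (mul_mem_adic_left _ hb))
  · rintro ⟨n, hn⟩
    refine mem_adic_of_isUnit_mul (hφ.isUnit.pow n) ?_
    rcases le_total i j with h | h
    · rw [min_eq_left h] at hn
      rw [(hφ.eq_zero_iff a).2 ⟨n, hn⟩, mul_zero]
      exact Submodule.zero_mem _
    · rw [min_eq_right h] at hn
      rw [← map_pow, ← map_mul]
      exact φ.map_mem_adic hn

theorem adic_eq_bot : adic R L i = ⊥ := by
  rw [eq_bot_iff]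
  intro x hx
  obtain ⟨n, a, ha, h⟩ := hφ.exists_pow_mul_of_mem hx
  refine hφ.eq_zero_of_mul (n := n) ?_
  rw [h, hφ.eq_zero_iff]
  exact ⟨0, by simpa using ha⟩

theorem isAdicComplete : IsAdicComplete (maximalIdeal R) L :=
  isAdicComplete_of_adic_eq_bot hφ.adic_eq_bot

end IsTruncatedLocalization

section Limit

variable {s : A} {L : ℕ → Type u} [∀ i, Ring (L i)] [∀ i, Algebra R (L i)]
  {φ : ∀ i, A →ₐ[R] L i} (hφ : ∀ i, IsTruncatedLocalization (φ i) s i)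
  {τ : ∀ i, L (i + 1) →ₐ[R] L i} (hτ : ∀ i a, τ i (φ (i + 1) a) = φ i a)

/-- The inverse limit of the algebras `L i`. -/
def limitSubalgebra (τ : ∀ i, L (i + 1) →ₐ[R] L i) : Subalgebra R (∀ i, L i) where
  carrier := {x | ∀ i, τ i (x (i + 1)) = x i}
  algebraMap_mem' r i := (τ i).commutes r
  add_mem' hx hy i := by rw [Pi.add_apply, map_add, hx i, hy i]; rfl
  mul_mem' hx hy i := by rw [Pi.mul_apply, map_mul, hx i, hy i]; rfl

/-- The projection from the inverse limit to `L i`. -/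
def limitProj (τ : ∀ i, L (i + 1) →ₐ[R] L i) (i : ℕ) : limitSubalgebra τ →ₐ[R] L i :=
  (Pi.evalAlgHom R L i).comp (limitSubalgebra τ).val

/-- The homomorphism to the inverse limit given by a compatible family of homomorphisms. -/
def toLimit (hτ : ∀ i a, τ i (φ (i + 1) a) = φ i a) : A →ₐ[R] limitSubalgebra τ :=
  (AlgHom.pi φ).codRestrict _ fun a i => hτ i a

include hφ hτ

/-- The inverses of `s` at all levels form a compatible family `w`, so every fraction at level `i`
lifts to the limit as `w ^ n` times an element of `A`. -/
theorem limitProj_surjective (i : ℕ) : Function.Surjective (limitProj τ i) := by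
  let w : limitSubalgebra τ := ⟨fun i => ↑((hφ i).isUnit.unit⁻¹), fun i => by
    refine (hφ i).isUnit.mul_left_cancel ?_
    rw [IsUnit.mul_val_inv, ← hτ, ← map_mul, IsUnit.mul_val_inv, map_one]⟩
  have hw : φ i s * limitProj τ i w = 1 := (hφ i).isUnit.mul_val_inv
  intro x
  obtain ⟨n, a, h⟩ := (hφ i).exists_pow_mul x
  refine ⟨w ^ n * toLimit hτ a, ((hφ i).isUnit.pow n).mul_left_cancel ?_⟩
  have hc : Commute (φ i s) (limitProj τ i w) := by
    have : limitProj τ i w * φ i s = 1 := (hφ i).isUnit.val_inv_mul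
    rw [Commute, SemiconjBy, hw, this]
  have h1 : limitProj τ i (toLimit hτ a) = φ i a := rfl
  rw [map_mul, map_pow, ← mul_assoc, ← hc.mul_pow, hw, one_pow, one_mul, h, h1]

variable [IsNoetherianRing R]

/-- The kernels of the projections are separated and complete by construction. An element vanishing
at level `j` has its component at level `j + 1` in `𝔪 ^ j`; lifting the coefficients of that
component shows that the kernels are generated by powers of `𝔪`. -/
theorem ker_limitProj (i : ℕ) :
    LinearMap.ker (limitProj τ i).toLinearMap = adic R (limitSubalgebra τ) i := by
  refine adic_eq_of_filtration (fun i => LinearMap.ker (limitProj τ i).toLinearMap) ?_ ?_ ?_ ?_ ?_ i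
  · refine antitone_nat_of_succ_le fun i x hx => ?_
    have h1 : x.1 (i + 1) = 0 := hx
    have h2 : x.1 i = 0 := by rw [← x.2 i, h1, map_zero]
    exact h2
  · intro j x hx
    have := (limitProj τ j).map_mem_adic hx
    rwa [(hφ j).adic_eq_bot] at this
  · intro x hx
    exact Subtype.ext (funext hx)
  · intro x hx
    have hx' : ∀ n, limitProj τ n (x (n + 1)) = limitProj τ n (x n) := fun n =>
      sub_eq_zero.1 (by rw [← map_sub]; exact hx n)
    refine ⟨⟨fun n => limitProj τ n (x n), fun n => ?_⟩, fun n => ?_⟩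
    · exact ((x (n + 1)).2 n).trans (hx' n)
    · exact sub_self (limitProj τ n (x n))
  · intro j x hx
    have hx0 : limitProj τ j x = 0 := hx
    have h1 : limitProj τ (j + 1) x ∈ adic R (L (j + 1)) j := by
      obtain ⟨n, a, ha⟩ := (hφ (j + 1)).exists_pow_mul (limitProj τ (j + 1) x)
      refine mem_adic_of_isUnit_mul ((hφ (j + 1)).isUnit.pow n) ?_
      rw [ha, (hφ (j + 1)).map_mem_adic_iff, min_eq_right j.le_succ, ← (hφ j).eq_zero_iff, ← hτ,
        ← ha, map_mul, show τ j (limitProj τ (j + 1) x) = limitProj τ j x from x.2 j, hx0, mul_zero]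
    obtain ⟨y, hy⟩ := exists_sum_gen h1
    choose z hz using fun l => limitProj_surjective hφ hτ (j + 1) (y l)
    refine Submodule.mem_sup.2 ⟨∑ l, gen R j l • z l, sum_gen_mem (i := 0) fun l =>
      mem_adic_zero _, x - ∑ l, gen R j l • z l, ?_, add_sub_cancel _ _⟩
    change limitProj τ (j + 1) (x - ∑ l, gen R j l • z l) = 0
    rw [map_sub, hy, map_sum, sub_eq_zero]
    simp only [map_smul, hz]

theorem limit_isAdicComplete : IsAdicComplete (maximalIdeal R) (limitSubalgebra τ) := by
  have hk : ∀ (i : ℕ) x, x ∈ adic R (limitSubalgebra τ) i ↔ limitProj τ i x = 0 := fun i x => by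
    rw [← ker_limitProj hφ hτ]; rfl
  refine isAdicComplete_of_limits (fun x hx => Subtype.ext (funext fun i => (hk i x).1 (hx i)))
    fun x hx => ?_
  have hx' : ∀ n, limitProj τ n (x (n + 1)) = limitProj τ n (x n) := fun n =>
    sub_eq_zero.1 (by rw [← map_sub]; exact (hk _ _).1 (hx n))
  refine ⟨⟨fun n => limitProj τ n (x n), fun n => ?_⟩, fun n => (hk _ _).2 ?_⟩
  · exact ((x (n + 1)).2 n).trans (hx' n)
  · exact sub_self (limitProj τ n (x n))

/-- At level `j + 1`, clear denominators and apply `GrFlat` of `A`; the conclusion about that level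
lifts because the kernel of the projection is `𝔪 ^ (j + 1)`. -/
theorem limit_grFlat (hA : GrFlat R A) : GrFlat R (limitSubalgebra τ) := by
  have hk : ∀ (i : ℕ) x, x ∈ adic R (limitSubalgebra τ) i ↔ limitProj τ i x = 0 := fun i x => by
    rw [← ker_limitProj hφ hτ]; rfl
  intro j x hx l
  rw [hk, map_sum] at hx
  simp only [map_smul] at hx
  obtain ⟨n, a, ha⟩ := (hφ (j + 1)).exists_pow_mul_fin fun l => limitProj τ (j + 1) (x l)
  obtain ⟨m, hm⟩ := ((hφ (j + 1)).eq_zero_iff (∑ l, gen R j l • a l)).1 (by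
    rw [map_sum]
    simp only [map_smul, ← ha, ← mul_smul_comm, ← Finset.mul_sum, hx, mul_zero])
  rw [Finset.mul_sum] at hm
  simp only [mul_smul_comm] at hm
  have h1 : φ (j + 1) (a l) ∈ adic R (L (j + 1)) 1 :=
    (hφ (j + 1)).map_mem_adic_iff.2 ⟨m, adic_antitone (min_le_right _ _) (hA j _ hm l)⟩
  rw [← ha] at h1
  replace h1 := mem_adic_of_isUnit_mul ((hφ (j + 1)).isUnit.pow n) h1
  obtain ⟨y, hy⟩ := exists_sum_gen h1
  choose z hz using fun l => limitProj_surjective hφ hτ (j + 1) (y l)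
  rw [← sub_add_cancel (x l) (∑ l, gen R 1 l • z l)]
  refine Submodule.add_mem _ (adic_antitone (Nat.le_add_left 1 j) ?_)
    (sum_gen_mem (i := 0) fun l => mem_adic_zero _)
  rw [hk, map_sub, hy, map_sum, sub_eq_zero]
  simp only [map_smul, hz]

theorem exists_formalDeformation_of_limit {C' : Type*} [CommRing C'] [Algebra R C']
    (hA : GrFlat R A) {η : L 1 →ₐ[R] C'} (hinj : ∀ x, η x = 0 → x = 0)
    (hsurj : Function.Surjective η) {h : A → C'} (hη : ∀ a, η (φ 1 a) = h a) :
    ∃ (B : AlgCat.{u} R) (ρ : A →ₐ[R] B) (εB : B →ₐ[R] C'), IsFormalDeformation εB ∧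
      ∀ a, εB (ρ a) = h a := by
  let εB : limitSubalgebra τ →ₐ[R] C' := η.comp (limitProj τ 1)
  refine ⟨AlgCat.of R (limitSubalgebra τ), toLimit hτ, εB,
    ⟨limit_isAdicComplete hφ hτ, limit_grFlat hφ hτ hA,
      hsurj.comp (limitProj_surjective hφ hτ 1), fun x => ?_⟩, fun a => hη a⟩
  refine Iff.trans ?_ (by rw [← ker_limitProj hφ hτ]; rfl : limitProj τ 1 x = 0 ↔ _)
  exact ⟨fun h => hinj _ h, fun h => (congrArg η h).trans (map_zero η)⟩

end Limit

/-- A formal deformation of `C` induces formal deformations of the localizations of `C`. -/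
theorem IsFormalDeformation.exists_localization [IsNoetherianRing R] {C C' : Type u} [CommRing C]
    [Algebra R C] [CommRing C'] [Algebra R C'] (hC' : adic R C' 1 = ⊥) {εA : A →ₐ[R] C}
    (hA : IsFormalDeformation εA) {θ : C →ₐ[R] C'} {s : A} (hθ : IsAwayMap θ (εA s)) :
    ∃ (B : AlgCat.{u} R) (ρ : A →ₐ[R] B) (εB : B →ₐ[R] C'), IsFormalDeformation εB ∧
      ∀ a, εB (ρ a) = θ (εA a) := by
  choose L φ h1 h2 h3 using fun i => _root_.exists_localization hA.commutator_mem s i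
  have hφ : ∀ i, IsTruncatedLocalization (φ i) s i := fun i => ⟨h1 i, h2 i, h3 i⟩
  have hL := fun i => (hφ i).isAdicComplete
  -- The transition maps come from the extension property: an element small at level `i + 1` is
  -- small at level `i` by `map_mem_adic_iff`.
  choose τ hτ using fun i => (hφ (i + 1)).isDenseAt.exists_extension (φ i) (hφ i).isUnit
    fun a j ha => by
      rw [(hφ _).map_mem_adic_iff] at ha ⊢
      obtain ⟨n, hn⟩ := ha
      exact ⟨n, adic_antitone (min_le_min_right _ i.le_succ) hn⟩
  -- Since `𝔪` kills `C'`, it is trivially complete, and `θ ∘ εA` extends to `L 1`; the extension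
  -- `η` is then seen to be bijective.
  have := isAdicComplete_of_adic_eq_bot hC'
  obtain ⟨η, hη⟩ := (hφ 1).isDenseAt.exists_extension (θ.comp εA) hθ.isUnit fun a j ha => by
    rw [(hφ _).map_mem_adic_iff] at ha
    obtain ⟨n, hn⟩ := ha
    rcases j with _ | j
    · exact mem_adic_zero _
    · rw [min_eq_left (Nat.le_add_left 1 j), ← hA.eq_zero_iff, map_mul, map_pow] at hn
      have : θ (εA a) = 0 := by
        have := congrArg θ hn
        rw [map_mul, map_pow, map_zero] at this
        exact ((hθ.isUnit.pow n).mul_right_eq_zero).1 this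
      rw [AlgHom.comp_apply, this]
      exact Submodule.zero_mem _
  have hη' : ∀ a, η (φ 1 a) = θ (εA a) := hη
  have hinj : ∀ x, η x = 0 → x = 0 := by
    intro x hx
    obtain ⟨n, a, ha⟩ := (hφ 1).exists_pow_mul x
    have : θ (εA a) = 0 := by rw [← hη', ← ha, map_mul, hx, mul_zero]
    obtain ⟨m, hm⟩ := hθ.exists_pow_mul_eq_zero _ this
    rw [← map_pow, ← map_mul, hA.eq_zero_iff] at hm
    refine (hφ 1).eq_zero_of_mul (n := n) ?_
    rw [ha]
    exact ((hφ 1).eq_zero_iff a).2 ⟨m, hm⟩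
  have hsurj : Function.Surjective η := by
    intro x
    obtain ⟨n, d, hd⟩ := hθ.surjective x
    obtain ⟨a, rfl⟩ := hA.surjective d
    obtain ⟨y, hy⟩ := ((hφ 1).isUnit.pow n).exists_right_inv
    refine ⟨y * φ 1 a, (hθ.isUnit.pow n).mul_left_cancel ?_⟩
    rw [hd, ← hη', ← map_pow, ← map_mul, ← mul_assoc, hy, one_mul, hη']
  exact exists_formalDeformation_of_limit (L := fun i => L i) hφ hτ hA.grFlat hinj hsurj hη'

end OreLocalization

theorem exists_one_tmul {R M : Type*} [CommRing R] [AddCommGroup M] [Module R M] (I : Ideal R)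
    (x : (R ⧸ I) ⊗[R] M) : ∃ a, x = (1 : R ⧸ I) ⊗ₜ[R] a := by
  obtain ⟨a, rfl⟩ := TensorProduct.mk_surjective R M (R ⧸ I) Ideal.Quotient.mk_surjective x
  exact ⟨a, rfl⟩

/-! ### Augmentations as homomorphisms of `R`-algebras -/

noncomputable section Augmentation

open IsLocalRing

/-- The algebra `C` over `K = R / 𝔪`, viewed as an `R`-algebra. -/
def OverResidue (K R C : Type u) : Type u :=
  let _ := K
  let _ := R
  C

variable {K R : Type u} [Field K] [CommRing R] [IsLocalRing R] [Algebra K R]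
variable {C : Type u} [CommRing C] [Algebra K C]

instance : CommRing (OverResidue K R C) := inferInstanceAs (CommRing C)

instance : Algebra K (OverResidue K R C) := inferInstanceAs (Algebra K C)

variable [hR : Fact (IsParameterAlgebra K R)]

variable (K R) in
/-- The homomorphism from a parameter algebra to its residue field `K`. -/
def toResidue : R →+* K :=
  (RingEquiv.ofBijective (algebraMap K (ResidueField R)) hR.out.residue).symm.toRingHom.comp
    (residue R)

theorem algebraMap_toResidue (r : R) :
    algebraMap K (ResidueField R) (toResidue K R r) = residue R r :=
  (RingEquiv.ofBijective (algebraMap K (ResidueField R)) hR.out.residue).apply_symm_apply _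

instance : Algebra R (OverResidue K R C) := ((algebraMap K C).comp (toResidue K R)).toAlgebra

theorem algebraMap_overResidue (r : R) :
    algebraMap R (OverResidue K R C) r =
      algebraMap K (OverResidue K R C) (toResidue K R r) := rfl

theorem toResidue_eq_zero {r : R} (hr : r ∈ maximalIdeal R) : toResidue K R r = 0 := by
  apply hR.out.residue.1
  rw [algebraMap_toResidue, map_zero]
  exact (residue_eq_zero_iff r).2 hr

theorem adic_overResidue : adic R (OverResidue K R C) 1 = ⊥ := by
  rw [eq_bot_iff, adic_one]
  intro x hx
  refine Submodule.smul_induction_on hx (fun r hr c _ => ?_) fun x y hx hy => ?_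
  · rw [Algebra.smul_def, algebraMap_overResidue, toResidue_eq_zero hr, map_zero, zero_mul]
    exact Submodule.zero_mem _
  · exact Submodule.add_mem _ hx hy

theorem residue_tmul {A : Type u} [Ring A] [Algebra R A] (r : R) (a : A) :
    (residue R r) ⊗ₜ[R] a = (1 : ResidueField R) ⊗ₜ[R] (r • a) := by
  rw [← TensorProduct.smul_tmul, Algebra.smul_def, mul_one]
  rfl

/-- The augmentation of an augmented algebra `A` as a homomorphism of `R`-algebras `A → C`. -/
def AugAlgebra.augHom (A : AugAlgebra K R C) : A.alg →ₐ[R] OverResidue K R C where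
  toFun a := A.aug ((1 : ResidueField R) ⊗ₜ[R] a : ResidueField R ⊗[R] A.alg)
  map_one' := map_one A.aug.hom
  map_mul' a b := by
    refine Eq.trans ?_ (map_mul A.aug.hom ((1 : ResidueField R) ⊗ₜ[R] a : ResidueField R ⊗[R] A.alg)
      ((1 : ResidueField R) ⊗ₜ[R] b : ResidueField R ⊗[R] A.alg))
    refine congrArg A.aug.hom ?_
    have h := Algebra.TensorProduct.tmul_mul_tmul (R := R) (1 : ResidueField R)
      (1 : ResidueField R) a b
    rw [one_mul] at h
    exact h.symm
  map_zero' := by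
    rw [TensorProduct.tmul_zero]
    exact map_zero A.aug.hom
  map_add' a b := by
    rw [TensorProduct.tmul_add]
    exact map_add A.aug.hom _ _
  commutes' r := by
    rw [algebraMap_overResidue]
    refine Eq.trans (congrArg A.aug.hom ?_) (A.aug.hom.commutes (toResidue K R r))
    rw [Algebra.algebraMap_eq_smul_one, ← residue_tmul, ← algebraMap_toResidue (K := K)]
    rfl

theorem AugAlgebra.aug_tmul (A : AugAlgebra K R C) (r : R) (a : A.alg) :
    A.aug ((residue R r) ⊗ₜ[R] a : ResidueField R ⊗[R] A.alg) = A.augHom (r • a) := by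
  rw [residue_tmul]
  rfl

/-- Every element of `(R / 𝔪) ⊗ A` is of the form `1 ⊗ a`, and `1 ⊗ a` vanishes exactly for `a` in
`𝔪 A`. -/
theorem AugAlgebra.isIso_aug_iff (A : AugAlgebra K R C) :
    IsIso A.aug ↔ Function.Surjective A.augHom ∧ ∀ a, A.augHom a = 0 ↔ a ∈ adic R A.alg 1 := by
  rw [ConcreteCategory.isIso_iff_bijective]
  constructor
  · rintro ⟨h1, h2⟩
    refine ⟨fun c => ?_, fun a => ?_⟩
    · obtain ⟨x, hx⟩ := h2 c
      obtain ⟨a, rfl⟩ := exists_one_tmul (maximalIdeal R) x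
      exact ⟨a, hx⟩
    · rw [mem_adic_one_iff]
      exact ⟨fun h => h1 (h.trans (map_zero A.aug.hom).symm),
        fun h => (congrArg A.aug.hom h).trans (map_zero A.aug.hom)⟩
  · rintro ⟨h1, h2⟩
    refine ⟨(injective_iff_map_eq_zero A.aug.hom).2 fun x hx => ?_, fun c => ?_⟩
    · obtain ⟨a, rfl⟩ := exists_one_tmul (maximalIdeal R) x
      exact (mem_adic_one_iff a).1 ((h2 a).1 hx)
    · obtain ⟨a, ha⟩ := h1 c
      exact ⟨_, ha⟩

/-- For complete modules flatness and `GrFlat` are equivalent. From here on only the graded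
condition is handled for algebras. -/
theorem AugAlgebra.isDeformation_iff [IsNoetherianRing R] (A : AugAlgebra K R C) :
    A.IsDeformation ↔ IsFormalDeformation A.augHom := by
  constructor
  · rintro ⟨h1, h2, h3⟩
    exact ⟨h2, grFlat_of_flat, (A.isIso_aug_iff.1 h3).1, (A.isIso_aug_iff.1 h3).2⟩
  · rintro ⟨h1, h2, h3, h4⟩
    exact ⟨flat_of_grFlat h2, h1, A.isIso_aug_iff.2 ⟨h3, h4⟩⟩

theorem AugAlgebra.map_comp_aug_iff {A A' : AugAlgebra K R C} (g : A.alg ⟶ A'.alg) :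
    (residueTensor K R).map g ≫ A'.aug = A.aug ↔ ∀ a, A'.augHom (g a) = A.augHom a := by
  constructor
  · intro h a
    exact congrArg (fun φ => φ.hom ((1 : ResidueField R) ⊗ₜ[R] a : ResidueField R ⊗[R] A.alg)) h
  · intro h
    refine ConcreteCategory.hom_ext _ _ fun x => ?_
    obtain ⟨a, rfl⟩ := exists_one_tmul (maximalIdeal R) x
    exact h a

/-- The homomorphism `K ⊗_R A → C` induced by a homomorphism of `R`-algebras `A → C`. -/
theorem exists_aug (A : AlgCat.{u} R) (ε : A →ₐ[R] OverResidue K R C) :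
    ∃ φ : (residueTensor K R).obj A ⟶ AlgCat.of K C,
      ∀ a : A, φ ((1 : ResidueField R) ⊗ₜ[R] a : ResidueField R ⊗[R] A) = ε a := by
  let e := RingEquiv.ofBijective (algebraMap K (ResidueField R)) hR.out.residue
  let _ : Algebra (ResidueField R) (OverResidue K R C) :=
    ((algebraMap K C).comp e.symm.toRingHom).toAlgebra
  have : IsScalarTower R (ResidueField R) (OverResidue K R C) := .of_algebraMap_eq fun r => rfl
  have : IsScalarTower K (ResidueField R) (OverResidue K R C) := .of_algebraMap_eq fun k => by
    change algebraMap K C k = algebraMap K C (e.symm (e k))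
    rw [e.symm_apply_apply]
  let ψ : ResidueField R ⊗[R] A →ₐ[ResidueField R] OverResidue K R C :=
    Algebra.TensorProduct.lift (Algebra.ofId _ _) ε fun _ _ => Commute.all _ _
  let ψ' : ResidueField R ⊗[R] A →ₐ[K] OverResidue K R C := ψ.restrictScalars K
  refine ⟨AlgCat.ofHom (R := K) (A := ResidueField R ⊗[R] A) (B := C) ψ', fun a => ?_⟩
  change ψ _ = _
  rw [Algebra.TensorProduct.lift_tmul, map_one, one_mul]

end Augmentation

/-! ### Gluing and local bijectivity over open sets -/

section Gluing

universe v w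

variable {C : Type w} [Category.{u} C] {FC : C → C → Type*} {CC : C → Type u}
  [∀ X Y, FunLike (FC X Y) (CC X) (CC Y)] [ConcreteCategory.{u} C FC]
  {X : TopCat.{u}}

/-- The restriction of a section to a smaller open set. -/
abbrev restr {F : TopCat.Presheaf C X} {V W : Opens X} (h : W ≤ V)
    (s : ToType (F.obj (op V))) : ToType (F.obj (op W)) :=
  F.map (homOfLE h).op s

theorem restr_restr {F : TopCat.Presheaf C X} {V W W' : Opens X} (h : W ≤ V) (h' : W' ≤ W)
    (s : ToType (F.obj (op V))) : restr h' (restr h s) = restr (h'.trans h) s := by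
  rw [restr, restr, ← ConcreteCategory.comp_apply, ← F.map_comp]
  rfl

theorem restr_self {F : TopCat.Presheaf C X} {V : Opens X} (s : ToType (F.obj (op V))) :
    restr le_rfl s = s := by
  rw [restr, show (homOfLE (le_refl V)).op = 𝟙 (op V) from rfl, F.map_id,
    ConcreteCategory.id_apply]

variable [HasLimitsOfSize.{u, u} C] [(forget C).ReflectsIsomorphisms]
  [PreservesLimitsOfSize.{u, u} (forget C)] (F : TopCat.Sheaf C X)

theorem eq_of_locally_restr_eq {V : Opens X} {s t : ToType (F.presheaf.obj (op V))}
    (h : ∀ x ∈ V, ∃ (W : Opens X) (hW : W ≤ V), x ∈ W ∧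
      restr (F := F.presheaf) hW s = restr hW t) : s = t := by
  choose W hW hx hst using h
  refine F.eq_of_locally_eq' (fun p : V => W p.1 p.2) V (fun p => homOfLE (hW p.1 p.2)) ?_ s t
    fun p => hst p.1 p.2
  intro x hxV
  exact Opens.mem_iSup.2 ⟨⟨x, hxV⟩, hx x hxV⟩

/-- Local solutions are described by a relation `Q` instead of a chosen family, and need only agree
near each point. This suits sections that are characterized by auxiliary, non-unique data. -/
theorem exists_glue {V : Opens X}
    (Q : ∀ W : Opens X, W ≤ V → ToType (F.presheaf.obj (op W)) → Prop)
    (hex : ∀ x ∈ V, ∃ (W : Opens X) (hW : W ≤ V), x ∈ W ∧ ∃ t, Q W hW t)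
    (huniq : ∀ W hW t W' hW' t', Q W hW t → Q W' hW' t' → ∀ x ∈ W, x ∈ W' →
      ∃ (W'' : Opens X) (h : W'' ≤ W) (h' : W'' ≤ W'), x ∈ W'' ∧
        restr (F := F.presheaf) h t = restr h' t') :
    ∃ s, ∀ W hW t, Q W hW t → restr (F := F.presheaf) hW s = t := by
  let ι := {p : Σ W : Opens X, ToType (F.presheaf.obj (op W)) // ∃ h : p.1 ≤ V, Q p.1 h p.2}
  obtain ⟨s, hs, -⟩ := F.existsUnique_gluing' (fun p : ι => p.1.1) V
    (fun p => homOfLE p.2.choose) (fun x hx => by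
      obtain ⟨W, hW, hxW, t, ht⟩ := hex x hx
      exact Opens.mem_iSup.2 ⟨⟨⟨W, t⟩, hW, ht⟩, hxW⟩) (fun p => p.1.2) (fun p q => by
      refine eq_of_locally_restr_eq F fun x hx => ?_
      obtain ⟨W'', h, h', hx'', he⟩ := huniq _ _ _ _ _ _ p.2.choose_spec q.2.choose_spec x hx.1 hx.2
      refine ⟨W'', le_inf h h', hx'', ?_⟩
      exact (restr_restr (F := F.presheaf) _ _ _).trans
        (he.trans (restr_restr (F := F.presheaf) _ _ _).symm))
  exact ⟨s, fun W hW t ht => hs ⟨⟨W, t⟩, hW, ht⟩⟩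

end Gluing

section LocallyBijective

variable {C : Type*} [Category* C] {FC : C → C → Type*} {CC : C → Type*}
  [∀ X Y, FunLike (FC X Y) (CC X) (CC Y)] [ConcreteCategory C FC] {X : TopCat.{u}}

theorem isLocallySurjective_opens_iff {F G : TopCat.Presheaf C X} (f : F ⟶ G) :
    Presheaf.IsLocallySurjective (Opens.grothendieckTopology X) f ↔
      ∀ (V : Opens X) (s : ToType (G.obj (op V))), ∀ x ∈ V, ∃ (W : Opens X) (h : W ≤ V),
        x ∈ W ∧ ∃ t, f.app (op W) t = G.map (homOfLE h).op s := by
  constructor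
  · intro hf V s x hx
    obtain ⟨W, i, ⟨t, ht⟩, hxW⟩ := hf.imageSieve_mem s x hx
    exact ⟨W, i.le, hxW, t, ht⟩
  · intro hf
    refine ⟨fun {V} s x hx => ?_⟩
    obtain ⟨W, h, hxW, t, ht⟩ := hf V s x hx
    exact ⟨W, homOfLE h, ⟨t, ht⟩, hxW⟩

theorem isLocallyInjective_opens_iff {F G : TopCat.Presheaf C X} (f : F ⟶ G) :
    Presheaf.IsLocallyInjective (Opens.grothendieckTopology X) f ↔
      ∀ (V : Opens X) (s t : ToType (F.obj (op V))), f.app (op V) s = f.app (op V) t →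
        ∀ x ∈ V, ∃ (W : Opens X) (h : W ≤ V), x ∈ W ∧
          F.map (homOfLE h).op s = F.map (homOfLE h).op t := by
  constructor
  · intro hf V s t hst x hx
    obtain ⟨W, i, hi, hxW⟩ := hf.equalizerSieve_mem s t hst x hx
    exact ⟨W, i.le, hxW, hi⟩
  · intro hf
    refine ⟨fun {V} s t hst x hx => ?_⟩
    obtain ⟨W, h, hxW, ht⟩ := hf V.unop s t hst x hx
    exact ⟨W, homOfLE h, ht, hxW⟩

end LocallyBijective

/-! ### Sections of sheaves of algebras and their truncations -/

noncomputable section SheafInterface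

open IsLocalRing

variable {R : Type u} [CommRing R] {X : TopCat.{u}}

/-- The algebra of sections of a sheaf of algebras. -/
abbrev Sec (A : TopCat.Sheaf (AlgCat.{u} R) X) (V : Opens X) : Type u :=
  A.presheaf.obj (op V)

/-- The restriction homomorphisms of a sheaf of algebras. -/
def res (A : TopCat.Sheaf (AlgCat.{u} R) X) {V W : Opens X} (h : W ≤ V) : Sec A V →ₐ[R] Sec A W :=
  (A.presheaf.map (homOfLE h).op).hom

section

variable (A : TopCat.Sheaf (AlgCat.{u} R) X) {V W : Opens X}

theorem res_res {W' : Opens X} (h : W ≤ V) (h' : W' ≤ W) (a : Sec A V) :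
    res A h' (res A h a) = res A (h'.trans h) a :=
  restr_restr (F := A.presheaf) h h' a

theorem res_self (a : Sec A V) : res A le_rfl a = a := restr_self (F := A.presheaf) a

theorem eq_of_locally_res_eq {a b : Sec A V} (h : ∀ x ∈ V, ∃ (W : Opens X) (hW : W ≤ V), x ∈ W ∧
    res A hW a = res A hW b) : a = b :=
  eq_of_locally_restr_eq A h

end

variable [IsLocalRing R]

/-- A section belongs locally to `𝔪 ^ j A`. -/
def LocallyMem (A : TopCat.Sheaf (AlgCat.{u} R) X) (j : ℕ) {V : Opens X} (a : Sec A V) : Prop :=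
  ∀ x ∈ V, ∃ (W : Opens X) (h : W ≤ V), x ∈ W ∧ res A h a ∈ adic R (Sec A W) j

section

variable {A : TopCat.Sheaf (AlgCat.{u} R) X} {V W : Opens X} {j : ℕ}

theorem locallyMem_of_mem {a : Sec A V} (ha : a ∈ adic R (Sec A V) j) : LocallyMem A j a :=
  fun _ hx => ⟨V, le_rfl, hx, (res A le_rfl).map_mem_adic ha⟩

theorem LocallyMem.res {a : Sec A V} (ha : LocallyMem A j a) (h : W ≤ V) :
    LocallyMem A j (res A h a) := by
  intro x hx
  obtain ⟨W', h', hx', ha'⟩ := ha x (h hx)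
  refine ⟨W ⊓ W', inf_le_left, ⟨hx, hx'⟩, ?_⟩
  rw [res_res, ← res_res A h' inf_le_right]
  exact AlgHom.map_mem_adic _ ha'

theorem LocallyMem.of_locally {a : Sec A V} (h : ∀ x ∈ V, ∃ (W : Opens X) (hW : W ≤ V), x ∈ W ∧
    LocallyMem A j (_root_.res A hW a)) : LocallyMem A j a := by
  intro x hx
  obtain ⟨W, hW, hxW, ha⟩ := h x hx
  obtain ⟨W', h', hx', ha'⟩ := ha x hxW
  exact ⟨W', h'.trans hW, hx', by rwa [res_res] at ha'⟩

variable (A j V) in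
/-- The submodule of the sections that belong locally to `𝔪 ^ j A`. -/
def locallyAdic : Submodule R (Sec A V) where
  carrier := {a | LocallyMem A j a}
  zero_mem' := locallyMem_of_mem (Submodule.zero_mem _)
  add_mem' {a b} ha hb x hx := by
    obtain ⟨W, h, hx, ha⟩ := ha x hx
    obtain ⟨W', h', hx', hb⟩ := hb x (h hx)
    refine ⟨W ⊓ W', inf_le_left.trans h, ⟨hx, hx'⟩, ?_⟩
    rw [map_add]
    refine Submodule.add_mem _ ?_ ?_
    · rw [← res_res A h inf_le_left]
      exact AlgHom.map_mem_adic _ ha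
    · rw [← res_res A h' inf_le_right]
      exact AlgHom.map_mem_adic _ hb
  smul_mem' r a ha x hx := by
    obtain ⟨W, h, hx, ha⟩ := ha x hx
    exact ⟨W, h, hx, by rw [map_smul]; exact Submodule.smul_mem _ _ ha⟩

end

/-- The canonical homomorphism `Γ(V, A) → Γ(V, (R / 𝔪 ^ (i + 1)) ⊗_R A)`. -/
def truncation (A : TopCat.Sheaf (AlgCat.{u} R) X) (i : ℕ) (V : Opens X) :
    Sec A V →ₗ[R] (quotTensor (algToModuleSheaf A) (maximalIdeal R ^ (i + 1))).presheaf.obj (op V) :=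
  ((toQuotTensor (algToModuleSheaf A) (maximalIdeal R ^ (i + 1))).app (op V)).hom

section

variable (A : TopCat.Sheaf (AlgCat.{u} R) X) (i : ℕ) {V W : Opens X}

theorem truncation_res (h : W ≤ V) (a : Sec A V) :
    truncation A i W (res A h a) =
      restr (F := (quotTensor (algToModuleSheaf A) (maximalIdeal R ^ (i + 1))).presheaf) h
        (truncation A i V a) :=
  congrArg (fun f => f.hom a)
    ((toQuotTensor (algToModuleSheaf A) (maximalIdeal R ^ (i + 1))).naturality (homOfLE h).op)

theorem truncation_transition (a : Sec A V) :
    (quotTensorTransition (algToModuleSheaf A)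
      (Ideal.pow_le_pow_right (Nat.le_succ (i + 1)))).app (op V) (truncation A (i + 1) V a) =
      truncation A i V a := by
  have h := toSheafify_naturality (Opens.grothendieckTopology X)
    (Functor.whiskerLeft (algToModuleSheaf A).presheaf (tensorFunctorTransition (R := R)
      (Ideal.pow_le_pow_right (I := maximalIdeal R) (Nat.le_succ (i + 1)))))
  exact (congrArg (fun φ => (φ.app (op V)).hom
    ((1 : R ⧸ maximalIdeal R ^ (i + 1 + 1)) ⊗ₜ[R] a)) h).symm

/-- Sheafification is locally injective, and `1 ⊗ a = 0` means that `a` lies in `𝔪 ^ (i + 1)`.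
Equality of truncations can thus be tested without the sheafified tensor product. -/
theorem truncation_eq_zero_iff (a : Sec A V) :
    truncation A i V a = 0 ↔ LocallyMem A (i + 1) a := by
  let P := (algToModuleSheaf A).presheaf ⋙ tensorFunctor (R := R) (R ⧸ maximalIdeal R ^ (i + 1))
  have key : ∀ (W : Opens X) (b : Sec A W),
      ((1 : R ⧸ maximalIdeal R ^ (i + 1)) ⊗ₜ[R] b : (R ⧸ maximalIdeal R ^ (i + 1)) ⊗[R] Sec A W) = 0
        ↔ b ∈ adic R (Sec A W) (i + 1) := fun W b => one_tmul_eq_zero_iff _ b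
  have hinj := (isLocallyInjective_opens_iff (toSheafify (Opens.grothendieckTopology X) P)).1
    inferInstance
  constructor
  · intro h x hx
    obtain ⟨W, hW, hxW, h'⟩ := hinj V
      ((1 : R ⧸ maximalIdeal R ^ (i + 1)) ⊗ₜ[R] a : (R ⧸ maximalIdeal R ^ (i + 1)) ⊗[R] Sec A V)
      (0 : (R ⧸ maximalIdeal R ^ (i + 1)) ⊗[R] Sec A V)
      (h.trans (map_zero ((toSheafify (Opens.grothendieckTopology X) P).app (op V)).hom).symm) x hx
    exact ⟨W, hW, hxW, (key W _).1 (h'.trans (map_zero (P.map (homOfLE hW).op).hom))⟩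
  · intro h
    refine eq_of_locally_restr_eq (quotTensor (algToModuleSheaf A) (maximalIdeal R ^ (i + 1)))
      fun x hx => ?_
    obtain ⟨W, hW, hxW, h'⟩ := h x hx
    refine ⟨W, hW, hxW, ?_⟩
    rw [← truncation_res]
    refine Eq.trans ?_ (map_zero ((quotTensor (algToModuleSheaf A)
      (maximalIdeal R ^ (i + 1))).presheaf.map (homOfLE hW).op).hom).symm
    exact (congrArg ((toSheafify (Opens.grothendieckTopology X) P).app (op W)).hom
      ((key W _).2 h')).trans (map_zero _)

theorem truncation_locally_surjective
    (s : (quotTensor (algToModuleSheaf A) (maximalIdeal R ^ (i + 1))).presheaf.obj (op V)) :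
    ∀ x ∈ V, ∃ (W : Opens X) (h : W ≤ V), x ∈ W ∧ ∃ a, truncation A i W a =
      restr (F := (quotTensor (algToModuleSheaf A) (maximalIdeal R ^ (i + 1))).presheaf) h s := by
  let P := (algToModuleSheaf A).presheaf ⋙ tensorFunctor (R := R) (R ⧸ maximalIdeal R ^ (i + 1))
  intro x hx
  obtain ⟨W, h, hxW, t, ht⟩ := (isLocallySurjective_opens_iff
    (toSheafify (Opens.grothendieckTopology X) P)).1 inferInstance V s x hx
  obtain ⟨a, rfl⟩ := exists_one_tmul (maximalIdeal R ^ (i + 1)) t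
  exact ⟨W, h, hxW, a, ht⟩

end

end SheafInterface

/-! ### Augmentations of sheaves on sections -/

noncomputable section SheafAugmentation

open IsLocalRing

variable {K R : Type u} [Field K] [CommRing R] [IsLocalRing R] [Algebra K R]
variable [hR : Fact (IsParameterAlgebra K R)] {X : TopCat.{u}}

variable (R) in
/-- The sections of a sheaf of commutative `K`-algebras, as an `R`-algebra. -/
abbrev OSec (O : TopCat.Sheaf (CommAlgCat.{u} K) X) (V : Opens X) : Type u :=
  OverResidue K R (O.presheaf.obj (op V))

section

variable (O : TopCat.Sheaf (CommAlgCat.{u} K) X) {V W : Opens X}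

variable (R) in
/-- The restriction homomorphisms of a sheaf of commutative `K`-algebras. -/
def oRes (h : W ≤ V) : OSec R O V →ₐ[R] OSec R O W where
  toRingHom := (O.presheaf.map (homOfLE h).op).hom.toRingHom
  commutes' r := (O.presheaf.map (homOfLE h).op).hom.commutes (toResidue K R r)

theorem oRes_oRes {W' : Opens X} (h : W ≤ V) (h' : W' ≤ W) (a : OSec R O V) :
    oRes R O h' (oRes R O h a) = oRes R O (h'.trans h) a :=
  restr_restr (F := O.presheaf) h h' (show ToType (O.presheaf.obj (op V)) from a)

theorem oRes_self (a : OSec R O V) : oRes R O le_rfl a = a :=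
  restr_self (F := O.presheaf) (show ToType (O.presheaf.obj (op V)) from a)

theorem eq_of_locally_oRes_eq {a b : OSec R O V} (h : ∀ x ∈ V, ∃ (W : Opens X) (hW : W ≤ V),
    x ∈ W ∧ oRes R O hW a = oRes R O hW b) : a = b :=
  eq_of_locally_restr_eq O (s := (show ToType (O.presheaf.obj (op V)) from a)) (t := b) h

end

variable {O : TopCat.Sheaf (CommAlgCat.{u} K) X}

namespace AugSheaf

/-- The augmentation of an augmented sheaf on sections, as a homomorphism of `R`-algebras. -/
def ε (A : AugSheaf K R O) (V : Opens X) : Sec A.sheaf V →ₐ[R] OSec R O V :=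
  (A.sections V).augHom

theorem ε_res (A : AugSheaf K R O) {V W : Opens X} (h : W ≤ V) (a : Sec A.sheaf V) :
    A.ε W (res A.sheaf h a) = oRes R O h (A.ε V a) :=
  congrArg (fun f => f.hom ((1 : ResidueField R) ⊗ₜ[R] a : ResidueField R ⊗[R] Sec A.sheaf V))
    ((toSheafify (Opens.grothendieckTopology X)
      (A.sheaf.presheaf ⋙ residueTensor K R) ≫ A.aug.hom).naturality (homOfLE h).op)

/-- A morphism of sheaves is an isomorphism when it is locally bijective. The map to the
sheafification is locally bijective, so the test takes place on the presheaf of tensor products,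
whose elements are `1 ⊗ a`. -/
theorem isIso_aug_iff (A : AugSheaf K R O) : IsIso A.aug ↔
    (∀ (V : Opens X) (o : OSec R O V), ∀ x ∈ V, ∃ (W : Opens X) (h : W ≤ V), x ∈ W ∧
      ∃ a, A.ε W a = oRes R O h o) ∧
    ∀ (V : Opens X) (a : Sec A.sheaf V), A.ε V a = 0 ↔ LocallyMem A.sheaf 1 a := by
  let P := A.sheaf.presheaf ⋙ residueTensor K R
  let ψ : P ⟶ (commToAlgSheaf K O).presheaf :=
    toSheafify (Opens.grothendieckTopology X) P ≫ A.aug.hom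
  have key : ∀ (W : Opens X) (b : Sec A.sheaf W),
      ((1 : ResidueField R) ⊗ₜ[R] b : ResidueField R ⊗[R] Sec A.sheaf W) = 0
        ↔ b ∈ adic R (Sec A.sheaf W) 1 := fun W b => (mem_adic_one_iff b).symm
  have h1 : Presheaf.IsLocallySurjective (Opens.grothendieckTopology X) ψ ↔
      ∀ (V : Opens X) (o : OSec R O V), ∀ x ∈ V, ∃ (W : Opens X) (h : W ≤ V), x ∈ W ∧
        ∃ a, A.ε W a = oRes R O h o := by
    rw [isLocallySurjective_opens_iff]
    constructor
    · intro h V o x hx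
      obtain ⟨W, hW, hxW, t, ht⟩ := h V o x hx
      obtain ⟨a, rfl⟩ := exists_one_tmul (maximalIdeal R) t
      exact ⟨W, hW, hxW, a, ht⟩
    · intro h V o x hx
      obtain ⟨W, hW, hxW, a, ha⟩ := h V o x hx
      exact ⟨W, hW, hxW, ((1 : ResidueField R) ⊗ₜ[R] a : ResidueField R ⊗[R] Sec A.sheaf W), ha⟩
  have h2 : Presheaf.IsLocallyInjective (Opens.grothendieckTopology X) ψ ↔
      ∀ (V : Opens X) (a : Sec A.sheaf V), A.ε V a = 0 ↔ LocallyMem A.sheaf 1 a := by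
    rw [isLocallyInjective_opens_iff]
    constructor
    · intro h V a
      constructor
      · intro ha x hx
        obtain ⟨W, hW, hxW, h'⟩ := h V
          ((1 : ResidueField R) ⊗ₜ[R] a : ResidueField R ⊗[R] Sec A.sheaf V)
          (0 : ResidueField R ⊗[R] Sec A.sheaf V)
          (ha.trans (map_zero (ψ.app (op V)).hom).symm) x hx
        exact ⟨W, hW, hxW, (key W _).1 (h'.trans (map_zero (P.map (homOfLE hW).op).hom))⟩
      · intro ha
        refine eq_of_locally_oRes_eq O fun x hx => ?_
        obtain ⟨W, hW, hxW, h'⟩ := ha x hx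
        refine ⟨W, hW, hxW, ?_⟩
        rw [← ε_res, map_zero]
        exact (congrArg (ψ.app (op W)).hom ((key W _).2 h')).trans (map_zero _)
    · intro h V s t hst x hx
      obtain ⟨a, ha⟩ := exists_one_tmul (maximalIdeal R)
        ((s : ResidueField R ⊗[R] Sec A.sheaf V) - t)
      have h3 : A.ε V a = 0 := by
        refine (congrArg (ψ.app (op V)).hom ha.symm).trans ?_
        exact (map_sub (ψ.app (op V)).hom s t).trans (sub_eq_zero.2 hst)
      obtain ⟨W, hW, hxW, h'⟩ := (h V a).1 h3 x hx
      refine ⟨W, hW, hxW, sub_eq_zero.1 ?_⟩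
      refine (map_sub (P.map (homOfLE hW).op).hom s t).symm.trans ?_
      exact (congrArg (P.map (homOfLE hW).op).hom ha).trans ((key W _).2 h')
  rw [← h1, ← h2]
  refine (Sheaf.isLocallyBijective_iff_isIso (A := AlgCat K)
    (J := Opens.grothendieckTopology X) A.aug).symm.trans ?_
  let J := Opens.grothendieckTopology X
  let φ : sheafify J P ⟶ (commToAlgSheaf K O).presheaf := A.aug.hom
  have h5 : Presheaf.IsLocallyInjective J (toSheafify J P) := inferInstance
  have h6 : Presheaf.IsLocallySurjective J (toSheafify J P) := inferInstance
  change Presheaf.IsLocallyInjective J φ ∧ Presheaf.IsLocallySurjective J φ ↔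
    Presheaf.IsLocallySurjective J (toSheafify J P ≫ φ) ∧
      Presheaf.IsLocallyInjective J (toSheafify J P ≫ φ)
  constructor
  · rintro ⟨h3, h4⟩
    exact ⟨Presheaf.isLocallySurjective_comp _ _ _, Presheaf.isLocallyInjective_comp _ _ _⟩
  · rintro ⟨h3, h4⟩
    exact ⟨Presheaf.isLocallyInjective_of_isLocallyInjective_of_isLocallySurjective_fac J
      (f₁ := toSheafify J P) (f₂ := φ) (toSheafify J P ≫ φ) rfl,
      Presheaf.isLocallySurjective_of_isLocallySurjective_fac J
        (f₁ := toSheafify J P) (f₂ := φ) rfl⟩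

theorem exists_of_augmentation (S : TopCat.Sheaf (AlgCat.{u} R) X)
    (η : ∀ V : Opens X, Sec S V →ₐ[R] OSec R O V)
    (hη : ∀ {V W : Opens X} (h : W ≤ V) a, η W (res S h a) = oRes R O h (η V a)) :
    ∃ φ : (sheafResidueTensor K R).obj S ⟶ commToAlgSheaf K O,
      ∀ V a, (AugSheaf.mk S φ).ε V a = η V a := by
  let P := S.presheaf ⋙ residueTensor K R
  choose f hf using fun V : Opens X => exists_aug (C := O.presheaf.obj (op V))
    (S.presheaf.obj (op V)) (η V)
  let ψ : P ⟶ (commToAlgSheaf K O).presheaf :=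
    { app := fun V => f V.unop
      naturality := fun V W i => by
        refine ConcreteCategory.hom_ext _ _ fun x => ?_
        obtain ⟨a, rfl⟩ := exists_one_tmul (maximalIdeal R) x
        exact (hf W.unop _).trans ((hη i.unop.le a).trans
          (congrArg (oRes R O i.unop.le) (hf V.unop a).symm)) }
  refine ⟨⟨sheafifyLift (Opens.grothendieckTopology X) ψ (commToAlgSheaf K O).property⟩,
    fun V a => ?_⟩
  have h := toSheafify_sheafifyLift (Opens.grothendieckTopology X) ψ (commToAlgSheaf K O).property
  exact (congrArg (fun φ => (φ.app (op V)).hom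
    ((1 : ResidueField R) ⊗ₜ[R] a : ResidueField R ⊗[R] Sec S V)) h).trans (hf V a)

theorem map_comp_aug_iff {A A' : AugSheaf K R O} (g : A.sheaf ⟶ A'.sheaf) :
    (sheafResidueTensor K R).map g ≫ A'.aug = A.aug ↔
      ∀ (V : Opens X) (a : Sec A.sheaf V), A'.ε V (g.hom.app (op V) a) = A.ε V a := by
  let J := Opens.grothendieckTopology X
  have h0 : toSheafify J (A.sheaf.presheaf ⋙ residueTensor K R) ≫
      ((sheafResidueTensor K R).map g ≫ A'.aug).hom =
      Functor.whiskerRight g.hom (residueTensor K R) ≫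
        toSheafify J (A'.sheaf.presheaf ⋙ residueTensor K R) ≫ A'.aug.hom := by
    have h := toSheafify_naturality J (Functor.whiskerRight g.hom (residueTensor K R))
    exact (congrArg (fun φ => φ ≫ A'.aug.hom) h).symm
  constructor
  · intro h V a
    rw [h] at h0
    exact (congrArg (fun φ => (φ.app (op V)).hom
      ((1 : ResidueField R) ⊗ₜ[R] a : ResidueField R ⊗[R] Sec A.sheaf V)) h0).symm
  · intro h
    refine Sheaf.hom_ext (sheafify_hom_ext J _ _ (commToAlgSheaf K O).property (h0.trans ?_))
    refine NatTrans.ext (funext fun V => ConcreteCategory.hom_ext _ _ fun x => ?_)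
    obtain ⟨a, rfl⟩ := exists_one_tmul (maximalIdeal R) x
    exact h V.unop a

end AugSheaf

end SheafAugmentation

/-! ### Vanishing of the first Čech cohomology of an affine open set -/

section Cech

variable {Y : Scheme.{u}}

/-- The restriction homomorphisms of the structure sheaf of a scheme. -/
abbrev sRes {V W : Y.Opens} (h : W ≤ V) : Γ(Y, V) →+* Γ(Y, W) :=
  (Y.presheaf.map (homOfLE h).op).hom

theorem sRes_sRes {V W W' : Y.Opens} (h : W ≤ V) (h' : W' ≤ W) (a : Γ(Y, V)) :
    sRes h' (sRes h a) = sRes (h'.trans h) a :=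
  restr_restr (F := Y.presheaf) h h' a

theorem AlgebraicGeometry.IsAffineOpen.exists_res_eq_pow_mul {V W W' : Y.Opens}
    (hW : IsAffineOpen W) (hWV : W ≤ V) (h : Γ(Y, V)) (hW' : W' = W ⊓ Y.basicOpen h)
    (x : Γ(Y, W')) : ∃ n : ℕ, ∃ y : Γ(Y, W),
      sRes (hW'.trans_le inf_le_left) y =
        sRes ((hW'.trans_le inf_le_left).trans hWV) h ^ n * x := by
  rw [← Y.basicOpen_res h (homOfLE hWV).op] at hW'
  subst hW'
  obtain ⟨n, y, hy⟩ := exists_eq_pow_mul_of_isAffineOpen Y W hW _ x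
  refine ⟨n, y, hy.trans ?_⟩
  rw [← sRes_sRes hWV (Y.basicOpen_le _)]
  rfl

theorem AlgebraicGeometry.IsAffineOpen.exists_pow_mul_eq_zero {V W W' : Y.Opens}
    (hW : IsAffineOpen W) (hWV : W ≤ V) (h : Γ(Y, V)) (hW' : W' = W ⊓ Y.basicOpen h)
    (y : Γ(Y, W)) (hy : sRes (hW'.trans_le inf_le_left) y = 0) :
    ∃ n : ℕ, sRes hWV h ^ n * y = 0 := by
  rw [← Y.basicOpen_res h (homOfLE hWV).op] at hW'
  subst hW'
  exact exists_of_res_zero_of_qcqs hW.isCompact hW.isQuasiSeparated hy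

theorem exists_nat_forall_of_finite {ι : Type*} [Finite ι] {P : ι → ℕ → Prop}
    (hmono : ∀ i m n, m ≤ n → P i m → P i n) (h : ∀ i, ∃ n, P i n) : ∃ n, ∀ i, P i n := by
  cases nonempty_fintype ι
  choose n hn using h
  exact ⟨Finset.univ.sup n, fun i => hmono i _ _ (Finset.le_sup (Finset.mem_univ i)) (hn i)⟩

/-- A Čech 1-cocycle of the structure sheaf on an affine open set is a coboundary. -/
theorem AlgebraicGeometry.IsAffineOpen.exists_eq_sub_of_cocycle {V : Y.Opens}
    (hV : IsAffineOpen V) {ι : Type*} [Finite ι] (h : ι → Γ(Y, V))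
    (hcov : V ≤ ⨆ k, Y.basicOpen (h k))
    (c : ∀ j k, Γ(Y, Y.basicOpen (h j) ⊓ Y.basicOpen (h k)))
    (hc : ∀ i j k (W : Y.Opens) (hij : W ≤ Y.basicOpen (h i) ⊓ Y.basicOpen (h j))
      (hjk : W ≤ Y.basicOpen (h j) ⊓ Y.basicOpen (h k))
      (hik : W ≤ Y.basicOpen (h i) ⊓ Y.basicOpen (h k)),
      sRes hij (c i j) + sRes hjk (c j k) = sRes hik (c i k)) :
    ∃ g : ∀ j, Γ(Y, Y.basicOpen (h j)), ∀ j k,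
      c j k = sRes inf_le_left (g j) - sRes inf_le_right (g k) := by
  classical
  cases nonempty_fintype ι
  let D : ι → Y.Opens := fun k => Y.basicOpen (h k)
  have hD : ∀ k, IsAffineOpen (D k) := fun k => hV.basicOpen (h k)
  have hDV : ∀ k, D k ≤ V := fun k => Y.basicOpen_le _
  have hDDV : ∀ j k, D j ⊓ D k ≤ V := fun j k => inf_le_left.trans (hDV j)
  obtain ⟨N, hN⟩ := exists_nat_forall_of_finite (ι := ι × ι)
    (P := fun p n => ∃ u : Γ(Y, D p.1), sRes inf_le_left u =
      sRes (hDDV p.1 p.2) (h p.2) ^ n * c p.1 p.2)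
    (by
      rintro ⟨j, k⟩ m n hmn ⟨u, hu⟩
      refine ⟨sRes (hDV j) (h k) ^ (n - m) * u, ?_⟩
      rw [map_mul, map_pow, sRes_sRes, hu, ← mul_assoc, ← pow_add, Nat.sub_add_cancel hmn])
    (fun p => (hD p.1).exists_res_eq_pow_mul (hDV p.1) (h p.2) rfl (c p.1 p.2))
  -- `u (j, k)` extends `h k ^ N * c j k` from `D j ⊓ D k` to `D j`, with one exponent `N` for all
  -- pairs.
  choose u hu using hN
  have hcomp : ∀ i j k, ∃ n : ℕ, sRes (hDDV i j) (h k) ^ n *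
      (sRes inf_le_left (u (i, k)) - sRes inf_le_right (u (j, k)) -
        sRes (hDDV i j) (h k) ^ N * c i j) = 0 := by
    intro i j k
    have haff : IsAffineOpen (D i ⊓ D j) := by
      have := (hD i).basicOpen (sRes (hDV i) (h j))
      rwa [Y.basicOpen_res] at this
    refine haff.exists_pow_mul_eq_zero (hDDV i j) (h k) rfl _ ?_
    have h1 : D i ⊓ D j ⊓ D k ≤ D i ⊓ D k := inf_le_inf inf_le_left le_rfl
    have h2 : D i ⊓ D j ⊓ D k ≤ D j ⊓ D k := inf_le_inf inf_le_right le_rfl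
    have e1 := congrArg (sRes h1) (hu (i, k))
    have e2 := congrArg (sRes h2) (hu (j, k))
    have e3 := hc i j k (D i ⊓ D j ⊓ D k) inf_le_left h2 h1
    simp only [map_mul, map_pow, sRes_sRes] at e1 e2
    simp only [map_sub, map_mul, map_pow, sRes_sRes]
    rw [e1, e2, ← e3]
    ring
  obtain ⟨M, hM⟩ := exists_nat_forall_of_finite (ι := ι × ι × ι)
    (P := fun p n => sRes (hDDV p.1 p.2.1) (h p.2.2) ^ n *
      (sRes inf_le_left (u (p.1, p.2.2)) - sRes inf_le_right (u (p.2.1, p.2.2)) -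
        sRes (hDDV p.1 p.2.1) (h p.2.2) ^ N * c p.1 p.2.1) = 0)
    (by
      rintro ⟨i, j, k⟩ m n hmn hm
      dsimp only at hm ⊢
      rw [← Nat.sub_add_cancel hmn, pow_add, mul_assoc, hm, mul_zero])
    (fun p => hcomp p.1 p.2.1 p.2.2)
  have hspan : Ideal.span (Set.range h) = ⊤ := by
    rw [← hV.self_le_iSup_basicOpen_iff]
    refine hcov.trans (iSup_le fun k => le_iSup (fun s : Set.range h => Y.basicOpen s.1) ⟨h k, k, rfl⟩)
  -- A partition of unity `∑ e k * h k ^ (M + N) = 1`: the factor `h k ^ N` extends the cocycle and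
  -- `h k ^ M` makes the cocycle relation between the extensions hold. Formally, `g j` is `∑ e k * h
  -- k ^ (M + N) * c j k`.
  have hspan' := Ideal.span_pow_eq_top _ hspan (M + N)
  rw [← Set.range_comp, Ideal.eq_top_iff_one, Ideal.mem_span_range_iff_exists_fun] at hspan'
  obtain ⟨e, he⟩ := hspan'
  refine ⟨fun j => ∑ k, sRes (hDV j) (e k) * (sRes (hDV j) (h k) ^ M * u (j, k)), fun i j => ?_⟩
  have h1 := congrArg (fun x => sRes (hDDV i j) x * c i j) he
  simp only [map_sum, map_mul, map_one, one_mul, Function.comp_apply, map_pow] at h1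
  rw [← h1, map_sum, map_sum, ← Finset.sum_sub_distrib, Finset.sum_mul]
  refine Finset.sum_congr rfl fun k _ => ?_
  have h2 := hM (i, j, k)
  dsimp only at h2
  simp only [map_mul, map_pow, sRes_sRes]
  rw [mul_sub, sub_eq_zero] at h2
  linear_combination (-sRes (hDDV i j) (e k)) * h2

end Cech

/-! ### Symbols: the graded pieces of a deformation as powers of `O` -/

noncomputable section Symbols

open IsLocalRing

section

variable {R : Type u} [CommRing R] [IsLocalRing R] {X : TopCat.{u}}
  {A : TopCat.Sheaf (AlgCat.{u} R) X} {V : Opens X}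

theorem LocallyMem.antitone {i j : ℕ} (hij : i ≤ j) {a : Sec A V} (ha : LocallyMem A j a) :
    LocallyMem A i a := fun x hx =>
  let ⟨W, h, hxW, h'⟩ := ha x hx
  ⟨W, h, hxW, adic_antitone hij h'⟩

theorem LocallyMem.sub {j : ℕ} {a b : Sec A V} (ha : LocallyMem A j a) (hb : LocallyMem A j b) :
    LocallyMem A j (a - b) := Submodule.sub_mem (locallyAdic A V j) ha hb

theorem LocallyMem.add {j : ℕ} {a b : Sec A V} (ha : LocallyMem A j a) (hb : LocallyMem A j b) :
    LocallyMem A j (a + b) := Submodule.add_mem (locallyAdic A V j) ha hb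

variable [IsNoetherianRing R]

theorem LocallyMem.sum_gen {i j : ℕ} {a : Fin (numGen R j) → Sec A V}
    (ha : ∀ l, LocallyMem A i (a l)) : LocallyMem A (j + i) (∑ l, gen R j l • a l) := by
  refine Submodule.sum_mem (locallyAdic A V (j + i)) fun l _ x hx => ?_
  obtain ⟨W, h, hxW, h'⟩ := ha l x hx
  exact ⟨W, h, hxW, by rw [map_smul]; exact smul_mem_adic (gen_mem j l) h'⟩

/-- In a flat sheaf, a combination of the minimal generators of `𝔪 ^ j` is locally in
`𝔪 ^ (j + 1)` only if the coefficients are locally in `𝔪`. -/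
theorem LocallyMem.of_sum_gen (hA : SheafFlat (algToModuleSheaf A)) {j : ℕ}
    {a : Fin (numGen R j) → Sec A V} (ha : LocallyMem A (j + 1) (∑ l, gen R j l • a l)) (l) :
    LocallyMem A 1 (a l) := by
  intro x hx
  let M := (algToModuleSheaf A).presheaf
  have hflat : Module.Flat R (M.stalk x) := hA x
  let γ : ∀ (W : Opens X), x ∈ W → Sec A W →ₗ[R] M.stalk x := fun W hW => (M.germ W x hW).hom
  have hγ : ∀ (W W' : Opens X) (h : W' ≤ W) (hx' : x ∈ W') (b : Sec A W),
      γ W' hx' (_root_.res A h b) = γ W (h hx') b := fun W W' h hx' b =>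
    TopCat.Presheaf.germ_res_apply M (homOfLE h) x hx' b
  have h1 : ∑ l, gen R j l • γ V hx (a l) ∈ adic R (M.stalk x) (j + 1) := by
    obtain ⟨W, h, hxW, h'⟩ := ha x hx
    have := map_mem_adic (γ W hxW) h'
    rwa [hγ, map_sum, Finset.sum_congr rfl fun l _ => map_smul (γ V hx) _ _] at this
  have h2 := grFlat_of_flat j _ h1 l
  -- The graded condition holds in the flat stalk. An element of `𝔪` times the stalk is the germ of
  -- a section in `𝔪` times the sections over a neighbourhood, so the conclusion spreads out.
  have h3 : ∀ t ∈ adic R (M.stalk x) 1, ∃ (W : Opens X) (hW : x ∈ W) (b : Sec A W),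
      b ∈ adic R (Sec A W) 1 ∧ γ W hW b = t := by
    intro t ht
    refine Submodule.smul_induction_on ht ?_ ?_
    · intro r hr t _
      obtain ⟨W, hW, b, hb⟩ := M.exists_germ_eq t
      rw [pow_one] at hr
      exact ⟨W, hW, r • (b : Sec A W), smul_mem_adic_one hr _,
        (map_smul (γ W hW) r b).trans (congrArg (r • ·) hb)⟩
    · rintro t t' ⟨W, hW, b, hb, rfl⟩ ⟨W', hW', b', hb', rfl⟩
      have hxW : x ∈ W ⊓ W' := ⟨hW, hW'⟩
      refine ⟨W ⊓ W', hxW, _root_.res A inf_le_left b + _root_.res A inf_le_right b',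
        Submodule.add_mem _ (AlgHom.map_mem_adic _ hb) (AlgHom.map_mem_adic _ hb'), ?_⟩
      rw [map_add, hγ, hγ]
  obtain ⟨W, hW, b, hb, hbt⟩ := h3 _ h2
  obtain ⟨W', hx', i, i', he⟩ := M.germ_eq x hx hW (a l) b hbt.symm
  refine ⟨W', i.le, hx', ?_⟩
  have he' : _root_.res A i.le (a l) = _root_.res A i'.le b := he
  rw [he']
  exact AlgHom.map_mem_adic _ hb

end

variable {K R : Type u} [Field K] [CommRing R] [IsLocalRing R] [Algebra K R]
variable [hR : Fact (IsParameterAlgebra K R)] {X : TopCat.{u}}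
  {O : TopCat.Sheaf (CommAlgCat.{u} K) X} {A : AugSheaf K R O}

namespace AugSheaf

theorem exists_ε_eq_locally (hA : A.IsDeformation) {V : Opens X} {n : ℕ} (c : Fin n → OSec R O V) :
    ∀ x ∈ V, ∃ (W : Opens X) (h : W ≤ V), x ∈ W ∧
      ∃ a : Fin n → Sec A.sheaf W, ∀ l, A.ε W (a l) = oRes R O h (c l) := by
  intro x hx
  choose W h hxW a ha using fun l => (A.isIso_aug_iff.1 hA.isIso_aug).1 V (c l) x hx
  -- Only a case distinction: for `n = 0` the empty intersection below would be all of the space and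
  -- need not lie in `V`.
  induction n with
  | zero => exact ⟨V, le_rfl, hx, Fin.elim0, fun l => l.elim0⟩
  | succ n _ =>
    let W' : Opens X := ⟨⋂ l, (W l : Set X), isOpen_iInter_of_finite fun l => (W l).isOpen⟩
    have hW' : ∀ l, W' ≤ W l := fun l => Set.iInter_subset (fun l => (W l : Set X)) l
    refine ⟨W', (hW' 0).trans (h 0), Set.mem_iInter.2 hxW, fun l => res A.sheaf (hW' l) (a l), ?_⟩
    intro l
    rw [ε_res, ha, oRes_oRes]

theorem ε_eq_zero_iff (hA : A.IsDeformation) {V : Opens X} {a : Sec A.sheaf V} :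
    A.ε V a = 0 ↔ LocallyMem A.sheaf 1 a :=
  (A.isIso_aug_iff.1 hA.isIso_aug).2 V a

variable [IsNoetherianRing R]

/-- The family `c` of sections of `O` is the symbol of the section `z` of `𝔪 ^ j A`: locally `z` is
congruent modulo `𝔪 ^ (j + 1)` to the combination of the generators of `𝔪 ^ j` whose coefficients
lift `c`. -/
def IsSymbol (A : AugSheaf K R O) (j : ℕ) {V : Opens X} (z : Sec A.sheaf V)
    (c : Fin (numGen R j) → OSec R O V) : Prop :=
  ∀ x ∈ V, ∃ (W : Opens X) (h : W ≤ V), x ∈ W ∧ ∃ a : Fin (numGen R j) → Sec A.sheaf W,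
    (∀ l, A.ε W (a l) = oRes R O h (c l)) ∧
      LocallyMem A.sheaf (j + 1) (res A.sheaf h z - ∑ l, gen R j l • a l)

section

variable {V W : Opens X} {j : ℕ} {z z' : Sec A.sheaf V} {c c' : Fin (numGen R j) → OSec R O V}

theorem IsSymbol.res (h : A.IsSymbol j z c) (hW : W ≤ V) :
    A.IsSymbol j (res A.sheaf hW z) fun l => oRes R O hW (c l) := by
  intro x hx
  obtain ⟨W', h', hx', a, ha, hz⟩ := h x (hW hx)
  refine ⟨W ⊓ W', inf_le_left, ⟨hx, hx'⟩, fun l => _root_.res A.sheaf inf_le_right (a l),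
    fun l => ?_, ?_⟩
  · rw [ε_res, ha, oRes_oRes, oRes_oRes]
  · have := hz.res (inf_le_right : W ⊓ W' ≤ W')
    simpa only [map_sub, map_sum, map_smul, res_res] using this

theorem IsSymbol.sub (h : A.IsSymbol j z c) (h' : A.IsSymbol j z' c') :
    A.IsSymbol j (z - z') (c - c') := by
  intro x hx
  obtain ⟨W, hW, hx, a, ha, hz⟩ := h x hx
  obtain ⟨W', hW', hx', a', ha', hz'⟩ := h' x (hW hx)
  refine ⟨W ⊓ W', inf_le_left.trans hW, ⟨hx, hx'⟩,
    fun l => _root_.res A.sheaf inf_le_left (a l) - _root_.res A.sheaf inf_le_right (a' l),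
    fun l => ?_, ?_⟩
  · rw [map_sub, ε_res, ha, ε_res, ha', oRes_oRes, oRes_oRes, Pi.sub_apply, map_sub]
  · have := (hz.res (inf_le_left : W ⊓ W' ≤ W)).sub (hz'.res (inf_le_right : W ⊓ W' ≤ W'))
    simp only [map_sub, map_sum, map_smul, res_res] at this
    simp only [smul_sub, Finset.sum_sub_distrib, map_sub]
    convert this using 1
    abel

theorem isSymbol_sum (a : Fin (numGen R j) → Sec A.sheaf V) :
    A.IsSymbol j (∑ l, gen R j l • a l) fun l => A.ε V (a l) := fun x hx =>
  ⟨V, le_rfl, hx, a, fun l => (oRes_self _ _).symm, by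
    rw [res_self, sub_self]; exact locallyMem_of_mem (Submodule.zero_mem _)⟩

theorem IsSymbol.locallyMem (hA : A.IsDeformation) (h : A.IsSymbol j z 0) :
    LocallyMem A.sheaf (j + 1) z := by
  refine LocallyMem.of_locally fun x hx => ?_
  obtain ⟨W, hW, hx, a, ha, hz⟩ := h x hx
  refine ⟨W, hW, hx, ?_⟩
  have := LocallyMem.sum_gen (j := j) (a := a) (i := 1) fun l =>
    (ε_eq_zero_iff hA).1 ((ha l).trans (map_zero _))
  simpa using hz.add this

theorem IsSymbol.eq_zero (hA : A.IsDeformation)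
    (h : A.IsSymbol j z c) (hz : LocallyMem A.sheaf (j + 1) z) : c = 0 := by
  funext l
  refine eq_of_locally_oRes_eq O fun x hx => ?_
  obtain ⟨W, hW, hx, a, ha, hz'⟩ := h x hx
  refine ⟨W, hW, hx, ?_⟩
  rw [← ha, Pi.zero_apply, map_zero, ε_eq_zero_iff hA]
  refine LocallyMem.of_sum_gen hA.flat (j := j) ?_ l
  simpa using (hz.res hW).sub hz'

theorem IsSymbol.unique (hA : A.IsDeformation) (h : A.IsSymbol j z c) (h' : A.IsSymbol j z c') :
    c = c' :=
  sub_eq_zero.1 ((h.sub h').eq_zero hA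
    (by rw [sub_self]; exact locallyMem_of_mem (Submodule.zero_mem _)))

/-- The coefficients of local expressions of `z` in the generators are not unique, but by flatness
their augmentations are, so the latter glue. -/
theorem exists_isSymbol (hA : A.IsDeformation)
    (hz : LocallyMem A.sheaf j z) : ∃ c, A.IsSymbol j z c := by
  let Q : Fin (numGen R j) → ∀ W : Opens X, W ≤ V → OSec R O W → Prop := fun l W hW t =>
    ∃ a : Fin (numGen R j) → Sec A.sheaf W, A.ε W (a l) = t ∧
      LocallyMem A.sheaf (j + 1) (_root_.res A.sheaf hW z - ∑ l, gen R j l • a l)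
  have hQ : ∀ x ∈ V, ∃ (W : Opens X) (hW : W ≤ V), x ∈ W ∧
      ∃ a : Fin (numGen R j) → Sec A.sheaf W,
        LocallyMem A.sheaf (j + 1) (_root_.res A.sheaf hW z - ∑ l, gen R j l • a l) := by
    intro x hx
    obtain ⟨W, hW, hxW, h⟩ := hz x hx
    obtain ⟨a, ha⟩ := exists_sum_gen h
    exact ⟨W, hW, hxW, a, by rw [ha, sub_self]; exact locallyMem_of_mem (Submodule.zero_mem _)⟩
  have key : ∀ l, ∃ s : OSec R O V, ∀ W hW t, Q l W hW t → oRes R O hW s = t := fun l => by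
    refine exists_glue O (Q l) ?_ ?_
    · intro x hx
      obtain ⟨W, hW, hxW, a, ha⟩ := hQ x hx
      exact ⟨W, hW, hxW, A.ε W (a l), a, rfl, ha⟩
    · rintro W hW _ W' hW' _ ⟨a, rfl, ha⟩ ⟨a', rfl, ha'⟩ x hx hx'
      refine ⟨W ⊓ W', inf_le_left, inf_le_right, ⟨hx, hx'⟩, ?_⟩
      change oRes R O inf_le_left (A.ε W (a l)) = oRes R O inf_le_right (A.ε W' (a' l))
      rw [← ε_res, ← ε_res, ← sub_eq_zero, ← map_sub, ε_eq_zero_iff hA]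
      refine LocallyMem.of_sum_gen hA.flat (j := j) (a := fun l =>
        _root_.res A.sheaf inf_le_left (a l) - _root_.res A.sheaf inf_le_right (a' l)) ?_ l
      have := (ha'.res (inf_le_right : W ⊓ W' ≤ W')).sub (ha.res (inf_le_left : W ⊓ W' ≤ W))
      simpa only [smul_sub, Finset.sum_sub_distrib, map_sub, map_sum, map_smul, res_res,
        sub_sub_sub_cancel_left] using this
  choose c hc using key
  refine ⟨c, fun x hx => ?_⟩
  obtain ⟨W, hW, hxW, a, ha⟩ := hQ x hx
  exact ⟨W, hW, hxW, a, fun l => (hc l W hW _ ⟨a, rfl, ha⟩).symm, ha⟩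

end

end AugSheaf

end Symbols

/-! ### Sections of a deformation over an affine open set -/

noncomputable section AffineSections

open IsLocalRing

variable {K R : Type u} [Field K] [CommRing R] [IsLocalRing R] [Algebra K R]
variable [hR : Fact (IsParameterAlgebra K R)]

section

variable {Y : Scheme.{u}} {g : Y ⟶ Spec (CommRingCat.of K)}

theorem AlgebraicGeometry.IsAffineOpen.exists_eq_oRes_sub {V : Y.Opens}
    (hV : IsAffineOpen V) {ι : Type*} [Finite ι] (h : ι → Γ(Y, V))
    (hcov : V ≤ ⨆ k, Y.basicOpen (h k)) {n : ℕ}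
    (c : ∀ j k, Fin n → OSec R (structureSheafAlg g) (Y.basicOpen (h j) ⊓ Y.basicOpen (h k)))
    (hc : ∀ i j k (W : Y.Opens) (hij : W ≤ Y.basicOpen (h i) ⊓ Y.basicOpen (h j))
      (hjk : W ≤ Y.basicOpen (h j) ⊓ Y.basicOpen (h k))
      (hik : W ≤ Y.basicOpen (h i) ⊓ Y.basicOpen (h k)) (l : Fin n),
      oRes R (structureSheafAlg g) hij (c i j l) + oRes R (structureSheafAlg g) hjk (c j k l) =
        oRes R (structureSheafAlg g) hik (c i k l)) :
    ∃ e : ∀ j, Fin n → OSec R (structureSheafAlg g) (Y.basicOpen (h j)), ∀ j k l,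
      c j k l = oRes R (structureSheafAlg g) inf_le_left (e j l) -
        oRes R (structureSheafAlg g) inf_le_right (e k l) := by
  choose e he using fun l => hV.exists_eq_sub_of_cocycle h hcov (fun j k => c j k l)
    fun i j k W hij hjk hik => hc i j k W hij hjk hik l
  exact ⟨fun j l => e l j, fun j k l => he l j k⟩

end

theorem truncation_eq_iff {X : TopCat.{u}} (A : TopCat.Sheaf (AlgCat.{u} R) X) (i : ℕ)
    {V : Opens X} (a b : Sec A V) :
    truncation A i V a = truncation A i V b ↔ LocallyMem A (i + 1) (a - b) := by
  rw [← truncation_eq_zero_iff, map_sub, sub_eq_zero]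

/-- The sections of the sheaf `(R / 𝔪 ^ (i + 1)) ⊗_R A`. -/
abbrev QSec {X : TopCat.{u}} (A : TopCat.Sheaf (AlgCat.{u} R) X) (i : ℕ) (V : Opens X) : Type u :=
  (quotTensor (algToModuleSheaf A) (maximalIdeal R ^ (i + 1))).presheaf.obj (op V)

/-- The canonical homomorphism
`Γ(V, (R / 𝔪 ^ (i + 2)) ⊗_R A) → Γ(V, (R / 𝔪 ^ (i + 1)) ⊗_R A)`. -/
def transition {X : TopCat.{u}} (A : TopCat.Sheaf (AlgCat.{u} R) X) (i : ℕ) (V : Opens X) :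
    QSec A (i + 1) V →ₗ[R] QSec A i V :=
  ((quotTensorTransition (algToModuleSheaf A)
    (Ideal.pow_le_pow_right (Nat.le_succ (i + 1)))).app (op V)).hom

theorem transition_truncation {X : TopCat.{u}} (A : TopCat.Sheaf (AlgCat.{u} R) X) (i : ℕ)
    {V : Opens X} (a : Sec A V) : transition A i V (truncation A (i + 1) V a) = truncation A i V a :=
  truncation_transition A i a

theorem transition_restr {X : TopCat.{u}} (A : TopCat.Sheaf (AlgCat.{u} R) X) (i : ℕ)
    {V W : Opens X} (h : W ≤ V) (t : QSec A (i + 1) V) :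
    transition A i W (restr
      (F := (quotTensor (algToModuleSheaf A) (maximalIdeal R ^ (i + 1 + 1))).presheaf) h t) =
    restr (F := (quotTensor (algToModuleSheaf A) (maximalIdeal R ^ (i + 1))).presheaf) h
      (transition A i V t) :=
  congrArg (fun f => f.hom t) ((quotTensorTransition (algToModuleSheaf A)
    (Ideal.pow_le_pow_right (I := maximalIdeal R) (Nat.le_succ (i + 1)))).naturality
      (homOfLE h).op)

theorem sheafComplete_iff {X : TopCat.{u}} (A : TopCat.Sheaf (AlgCat.{u} R) X) :
    SheafComplete (maximalIdeal R) (algToModuleSheaf A) ↔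
      ∀ (V : Opens X) (s : ∀ i, QSec A i V), (∀ i, transition A i V (s (i + 1)) = s i) →
        ∃! a : Sec A V, ∀ i, truncation A i V a = s i := by
  constructor
  · intro h V
    exact h (op V)
  · intro h V
    exact h V.unop

variable [IsNoetherianRing R] {Y : Scheme.{u}} {g : Y ⟶ Spec (CommRingCat.of K)}
  {A : AugSheaf K R (structureSheafAlg g)}

namespace AugSheaf

/-- The kernel of the transition is the graded piece of degree `i + 1`, a finite power of `O` by
means of symbols, and its first Čech cohomology vanishes on an affine open set. -/
theorem exists_transition_eq (hA : A.IsDeformation) {V : Y.Opens} (hV : IsAffineOpen V) (i : ℕ)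
    (s : QSec A.sheaf i V) : ∃ t, transition A.sheaf i V t = s := by
  let F := fun i => (quotTensor (algToModuleSheaf A.sheaf) (maximalIdeal R ^ (i + 1)))
  have hloc : ∀ x : V, ∃ h : Γ(Y, V), x.1 ∈ Y.basicOpen h ∧ ∃ m : Sec A.sheaf (Y.basicOpen h),
      truncation A.sheaf i _ m = restr (F := (F i).presheaf) (Y.basicOpen_le h) s := by
    intro x
    obtain ⟨W, hW, hxW, a, ha⟩ := truncation_locally_surjective A.sheaf i s x.1 x.2
    obtain ⟨h, hh, hx⟩ := hV.exists_basicOpen_le ⟨x.1, hxW⟩ x.2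
    refine ⟨h, hx, res A.sheaf hh a, ?_⟩
    rw [truncation_res, ha]
    exact restr_restr (F := (F i).presheaf) _ _ _
  choose h' hx' m' hm' using hloc
  obtain ⟨T, hT⟩ := hV.isCompact.elim_finite_subcover (fun x : V => (Y.basicOpen (h' x) : Set Y))
    (fun x => (Y.basicOpen (h' x)).isOpen) fun x hx => Set.mem_iUnion.2 ⟨⟨x, hx⟩, hx' ⟨x, hx⟩⟩
  let h : T → Γ(Y, V) := fun k => h' k.1
  let D : T → Y.Opens := fun k => Y.basicOpen (h k)
  let m : ∀ k : T, Sec A.sheaf (D k) := fun k => m' k.1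
  have hDV : ∀ k, D k ≤ V := fun k => Y.basicOpen_le _
  have hm : ∀ k, truncation A.sheaf i (D k) (m k) = restr (F := (F i).presheaf) (hDV k) s :=
    fun k => hm' k.1
  have hcov' : ∀ x ∈ V, ∃ k, x ∈ D k := fun x hx => by
    obtain ⟨k, hk, hxk⟩ := Set.mem_iUnion₂.1 (hT hx)
    exact ⟨⟨k, hk⟩, hxk⟩
  have hcov : V ≤ ⨆ k, Y.basicOpen (h k) := fun x hx => Opens.mem_iSup.2 (hcov' x hx)
  have hz : ∀ j k, LocallyMem A.sheaf (i + 1)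
      (res A.sheaf (inf_le_left : D j ⊓ D k ≤ D j) (m j) -
        res A.sheaf (inf_le_right : D j ⊓ D k ≤ D k) (m k)) := fun j k => by
    rw [← truncation_eq_iff, truncation_res, truncation_res, hm, hm]
    exact (restr_restr (F := (F i).presheaf) _ _ _).trans
      (restr_restr (F := (F i).presheaf) _ _ _).symm
  -- Differences of local lifts of `s` lie locally in `𝔪 ^ (i + 1)`. By uniqueness their symbols
  -- form a cocycle, which is the coboundary of some `e`.
  choose c hc using fun j k => exists_isSymbol hA (hz j k)
  obtain ⟨e, he⟩ := hV.exists_eq_oRes_sub h hcov c (by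
    intro i' j k W hij hjk hik l
    have h1 := ((hc i' k).res hik).sub ((hc j k).res hjk)
    have h2 := (hc i' j).res hij
    simp only [map_sub, res_res, sub_sub_sub_cancel_right] at h1 h2
    have h3 := congrFun (h2.unique hA h1) l
    exact eq_sub_iff_add_eq.1 h3)
  -- The lifts `m k` are corrected by the generators with coefficients lifting `e k`. These
  -- coefficients exist only locally and are not unique, but modulo `𝔪 ^ (i + 2)` the corrected
  -- lifts agree.
  let Q : ∀ W : Y.Opens, W ≤ V → (F (i + 1)).presheaf.obj (op W) → Prop := fun W hW t =>
    ∃ (k : T) (hk : W ≤ D k) (a : Fin (numGen R (i + 1)) → Sec A.sheaf W),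
      (∀ l, A.ε W (a l) = oRes R _ hk (e k l)) ∧
      t = truncation A.sheaf (i + 1) W (res A.sheaf hk (m k) - ∑ l, gen R (i + 1) l • a l)
  have hQ : ∀ x ∈ V, ∃ (W : Y.Opens) (hW : W ≤ V), x ∈ W ∧ ∃ t, Q W hW t := by
    intro x hx
    obtain ⟨k, hk⟩ := hcov' x hx
    obtain ⟨W, hW, hxW, a, ha⟩ := exists_ε_eq_locally hA (e k) x hk
    exact ⟨W, hW.trans (hDV k), hxW, _, k, hW, a, ha, rfl⟩
  obtain ⟨t, ht⟩ := exists_glue (F (i + 1)) Q hQ (by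
    rintro W hW _ W' hW' _ ⟨k, hk, a, ha, rfl⟩ ⟨k', hk', a', ha', rfl⟩ x hx hx'
    refine ⟨W ⊓ W', inf_le_left, inf_le_right, ⟨hx, hx'⟩, ?_⟩
    refine ((truncation_res A.sheaf (i + 1) _ _).symm.trans ?_).trans
      (truncation_res A.sheaf (i + 1) _ _)
    rw [truncation_eq_iff]
    have h1 := (hc k k').res (inf_le_inf hk hk')
    have h2 := isSymbol_sum (A := A) (j := i + 1) fun l =>
      res A.sheaf (inf_le_left : W ⊓ W' ≤ W) (a l) - res A.sheaf (inf_le_right : W ⊓ W' ≤ W') (a' l)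
    have h3 := h1.sub h2
    have h4 : ((fun l => oRes R (structureSheafAlg g) (inf_le_inf hk hk') (c k k' l)) - fun l =>
        A.ε (W ⊓ W') (res A.sheaf (inf_le_left : W ⊓ W' ≤ W) (a l) -
          res A.sheaf (inf_le_right : W ⊓ W' ≤ W') (a' l))) = 0 := by
      funext l
      rw [Pi.sub_apply, he, map_sub, map_sub, ε_res, ε_res, ha, ha', oRes_oRes, oRes_oRes,
        oRes_oRes, oRes_oRes]
      exact sub_self _
    rw [h4] at h3
    have h5 := h3.locallyMem hA
    simp only [map_sub, map_sum, map_smul, res_res, smul_sub, Finset.sum_sub_distrib] at h5 ⊢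
    convert h5 using 1
    abel)
  refine ⟨t, eq_of_locally_restr_eq (F i) fun x hx => ?_⟩
  obtain ⟨W, hW, hxW, t', k, hk, a, ha, rfl⟩ := hQ x hx
  refine ⟨W, hW, hxW, ?_⟩
  refine (transition_restr A.sheaf i hW t).symm.trans ?_
  refine (congrArg (transition A.sheaf i W) (ht W hW _ ⟨k, hk, a, ha, rfl⟩)).trans ?_
  refine (transition_truncation A.sheaf i _).trans ?_
  rw [map_sub, truncation_res, hm, (truncation_eq_zero_iff A.sheaf i _).2, sub_zero]
  · exact restr_restr (F := (F i).presheaf) _ _ _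
  · exact locallyMem_of_mem (sum_gen_mem (i := 0) fun l => mem_adic_zero _)

/-- Local lifts of `o` agree modulo `𝔪`, hence define a section of `A / 𝔪`. It lifts step by step
through the truncations, and completeness of the sheaf yields a section of `A`. -/
theorem ε_surjective (hA : A.IsDeformation) {V : Y.Opens} (hV : IsAffineOpen V) :
    Function.Surjective (A.ε V) := by
  intro o
  let F := fun i => (quotTensor (algToModuleSheaf A.sheaf) (maximalIdeal R ^ (i + 1)))
  let Q : ∀ W : Y.Opens, W ≤ V → (F 0).presheaf.obj (op W) → Prop := fun W hW t =>
    ∃ a, A.ε W a = oRes R _ hW o ∧ t = truncation A.sheaf 0 W a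
  have hloc := (A.isIso_aug_iff.1 hA.isIso_aug).1 V o
  obtain ⟨s0, hs0⟩ := exists_glue (F 0) Q
    (fun x hx => by
      obtain ⟨W, hW, hxW, a, ha⟩ := hloc x hx
      exact ⟨W, hW, hxW, _, a, ha, rfl⟩)
    (by
      rintro W hW _ W' hW' _ ⟨a, ha, rfl⟩ ⟨a', ha', rfl⟩ x hx hx'
      refine ⟨W ⊓ W', inf_le_left, inf_le_right, ⟨hx, hx'⟩, ?_⟩
      refine ((truncation_res A.sheaf 0 _ _).symm.trans ?_).trans (truncation_res A.sheaf 0 _ _)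
      rw [truncation_eq_iff, ← ε_eq_zero_iff hA, map_sub, ε_res, ε_res, ha, ha', oRes_oRes,
        oRes_oRes, sub_self])
  choose T hT using fun i => exists_transition_eq hA hV i
  let s : ∀ i, QSec A.sheaf i V := fun i => Nat.rec s0 (fun i t => T i t) i
  obtain ⟨a, ha, -⟩ := (sheafComplete_iff A.sheaf).1 hA.complete V s fun i => hT i (s i)
  refine ⟨a, eq_of_locally_oRes_eq _ fun x hx => ?_⟩
  obtain ⟨W, hW, hxW, a', ha'⟩ := hloc x hx
  refine ⟨W, hW, hxW, ?_⟩
  have h1 : truncation A.sheaf 0 W (res A.sheaf hW a) = truncation A.sheaf 0 W a' := by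
    rw [truncation_res, ← hs0 W hW _ ⟨a', ha', rfl⟩]
    exact congrArg (restr (F := (F 0).presheaf) hW) (ha 0)
  rw [← ε_res, ← ha', ← sub_eq_zero, ← map_sub, ε_eq_zero_iff hA]
  exact (truncation_eq_iff A.sheaf 0 _ _).1 h1

theorem IsDeformation.exists_locallyMem_limit (hA : A.IsDeformation) {V : Y.Opens}
    (x : ℕ → Sec A.sheaf V) (hx : ∀ n, LocallyMem A.sheaf n (x (n + 1) - x n)) :
    ∃ y, ∀ n, LocallyMem A.sheaf n (y - x n) := by
  obtain ⟨y, hy, -⟩ := (sheafComplete_iff A.sheaf).1 hA.complete V (fun i => truncation A.sheaf i V (x (i + 1))) fun i => by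
    rw [transition_truncation]
    exact (truncation_eq_iff A.sheaf i _ _).2 (hx (i + 1))
  refine ⟨y, fun n => ?_⟩
  cases n with
  | zero => exact locallyMem_of_mem (mem_adic_zero _)
  | succ n => exact (truncation_eq_iff A.sheaf n _ _).1 (hy n)

theorem IsDeformation.eq_zero_of_locallyMem (hA : A.IsDeformation) {V : Y.Opens}
    {x : Sec A.sheaf V} (hx : ∀ n, LocallyMem A.sheaf n x) : x = 0 := by
  obtain ⟨y, -, hy⟩ := (sheafComplete_iff A.sheaf).1 hA.complete V (fun i => 0) fun i => map_zero (transition A.sheaf i V)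
  rw [hy x fun i => (truncation_eq_zero_iff A.sheaf i x).2 (hx _),
    hy 0 fun i => map_zero (truncation A.sheaf i V)]

/-- The local filtration is separated and complete because the sheaf is complete. The symbol of a
section lifts to global coefficients by `ε_surjective`, and subtracting their combination raises the
degree; so `adic_eq_of_filtration` applies. -/
theorem IsDeformation.locallyAdic_eq (hA : A.IsDeformation) {V : Y.Opens} (hV : IsAffineOpen V)
    (j : ℕ) : locallyAdic A.sheaf V j = adic R (Sec A.sheaf V) j := by
  refine adic_eq_of_filtration (locallyAdic A.sheaf V) (fun i j h a ha => LocallyMem.antitone h ha)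
    (fun j a ha => locallyMem_of_mem ha) (fun x hx => hA.eq_zero_of_locallyMem hx)
    (fun x hx => hA.exists_locallyMem_limit x hx) (fun j z hz => ?_) j
  obtain ⟨c, hc⟩ := exists_isSymbol hA hz
  choose a ha using fun l => ε_surjective hA hV (c l)
  have h1 := hc.sub (isSymbol_sum a)
  rw [show (fun l => A.ε V (a l)) = c from funext ha, sub_self] at h1
  refine Submodule.mem_sup.2 ⟨_, sum_gen_mem (i := 0) (a := a) fun l => mem_adic_zero _, _,
    h1.locallyMem hA, ?_⟩
  abel

theorem IsDeformation.locallyMem_iff (hA : A.IsDeformation) {V : Y.Opens} (hV : IsAffineOpen V)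
    {j : ℕ} {a : Sec A.sheaf V} : LocallyMem A.sheaf j a ↔ a ∈ adic R (Sec A.sheaf V) j := by
  rw [← hA.locallyAdic_eq hV]
  rfl

/-- The sections of a deformation of the structure sheaf over an affine open set form a
deformation. -/
theorem IsDeformation.isFormalDeformation (hA : A.IsDeformation) {V : Y.Opens}
    (hV : IsAffineOpen V) : IsFormalDeformation (A.ε V) where
  complete := isAdicComplete_of_limits
    (fun x hx => hA.eq_zero_of_locallyMem fun n => locallyMem_of_mem (hx n))
    fun x hx => by
      simp only [← hA.locallyMem_iff hV] at hx ⊢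
      exact hA.exists_locallyMem_limit x hx
  grFlat := fun j a ha l => (hA.locallyMem_iff hV).1
    (LocallyMem.of_sum_gen hA.flat ((hA.locallyMem_iff hV).2 ha) l)
  surjective := ε_surjective hA hV
  eq_zero_iff := fun a => (ε_eq_zero_iff hA).trans (hA.locallyMem_iff hV)

end AugSheaf

end AffineSections

/-! ### Extension of gauge transformations from global sections -/

noncomputable section GaugeExtension

open IsLocalRing

variable {K R : Type u} [Field K] [CommRing R] [IsLocalRing R] [Algebra K R]
variable [hR : Fact (IsParameterAlgebra K R)]

theorem isAdicComplete_overResidue {C : Type u} [CommRing C] [Algebra K C] :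
    IsAdicComplete (maximalIdeal R) (OverResidue K R C) :=
  isAdicComplete_of_adic_eq_bot (n := 1) adic_overResidue

section

variable {R : Type u} [CommRing R]

/-- The homomorphism on sections given by a homomorphism of sheaves of algebras. -/
def secMap {X : TopCat.{u}} {S S' : TopCat.Sheaf (AlgCat.{u} R) X} (G : S ⟶ S')
    (V : Opens X) : Sec S V →ₐ[R] Sec S' V := (G.hom.app (op V)).hom

theorem secMap_res {X : TopCat.{u}} {S S' : TopCat.Sheaf (AlgCat.{u} R) X} (G : S ⟶ S')
    {V W : Opens X} (h : W ≤ V) (a : Sec S V) :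
    secMap G W (res S h a) = res S' h (secMap G V a) :=
  congrArg (fun f => f.hom a) (G.hom.naturality (homOfLE h).op)

end

section

variable {Y : Scheme.{u}} {g : Y ⟶ Spec (CommRingCat.of K)}

theorem AlgebraicGeometry.IsAffineOpen.isAwayMap {V : Y.Opens} (hV : IsAffineOpen V)
    (s : OSec R (structureSheafAlg g) V) :
    IsAwayMap (oRes R (structureSheafAlg g) (Y.basicOpen_le (show Γ(Y, V) from s))) s where
  isUnit := RingedSpace.isUnit_res_basicOpen _ (show Γ(Y, V) from s)
  surjective x := by
    obtain ⟨n, y, hy⟩ := exists_eq_pow_mul_of_isAffineOpen Y V hV s x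
    exact ⟨n, y, hy.symm⟩
  exists_pow_mul_eq_zero d hd := exists_of_res_zero_of_qcqs hV.isCompact hV.isQuasiSeparated
    (f := (show Γ(Y, V) from d)) (s := (show Γ(Y, V) from s)) hd

theorem isBasis_range_basicOpen [IsAffine Y] :
    Opens.IsBasis (Set.range fun s : Γ(Y, ⊤) => Y.basicOpen s) := isBasis_basicOpen Y

theorem exists_basicOpen_le [IsAffine Y] {V : Y.Opens} {x : Y} (hx : x ∈ V) :
    ∃ s : Γ(Y, ⊤), Y.basicOpen s ≤ V ∧ x ∈ Y.basicOpen s := by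
  obtain ⟨s, hs, hxs⟩ := (isAffineOpen_top Y).exists_basicOpen_le ⟨x, hx⟩ trivial
  exact ⟨s, hs, hxs⟩

end

variable [IsNoetherianRing R] {Y : Scheme.{u}} [IsAffine Y] {g : Y ⟶ Spec (CommRingCat.of K)}
  {A A' : AugSheaf K R (structureSheafAlg g)}

namespace AugSheaf

theorem IsDeformation.isFormalDeformation_top (hA : A.IsDeformation) :
    IsFormalDeformation (A.ε ⊤) := hA.isFormalDeformation (isAffineOpen_top Y)

theorem IsDeformation.isFormalDeformation_basicOpen (hA : A.IsDeformation) (s : Γ(Y, ⊤)) :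
    IsFormalDeformation (A.ε (Y.basicOpen s)) :=
  hA.isFormalDeformation ((isAffineOpen_top Y).basicOpen s)

theorem IsDeformation.isDenseAt_res (hA : A.IsDeformation) (s : Γ(Y, ⊤)) :
    ∃ t, IsDenseAt (res A.sheaf (le_top : Y.basicOpen s ≤ ⊤)) t := by
  obtain ⟨t, rfl⟩ := hA.isFormalDeformation_top.surjective s
  exact ⟨t, hA.isFormalDeformation_top.isDenseAt (hA.isFormalDeformation_basicOpen _)
    (fun a => A.ε_res le_top a) ((isAffineOpen_top Y).isAwayMap _)⟩

/-- Over a basic open set the global sections are dense up to powers of an element, and basic open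
sets form a basis. -/
theorem sheafHom_ext (hA : A.IsDeformation) (hA' : A'.IsDeformation)
    {G₁ G₂ : A.sheaf ⟶ A'.sheaf} (h : ∀ a, secMap G₁ ⊤ a = secMap G₂ ⊤ a) : G₁ = G₂ := by
  refine Sheaf.hom_ext (TopCat.Sheaf.hom_ext _ _ (isBasis_range_basicOpen (Y := Y)) fun s => ?_)
  obtain ⟨t, ht⟩ := hA.isDenseAt_res s
  have := (hA'.isFormalDeformation_basicOpen s).complete
  have e : secMap G₁ _ = secMap G₂ _ := ht.algHom_ext fun a => by
    rw [secMap_res, secMap_res, h]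
  exact congrArg AlgCat.ofHom e

/-- Over each basic open set the map comes from the universal property; compatibility with
restrictions and with augmentations follows from density. -/
theorem exists_sheafHom (hA : A.IsDeformation) (hA' : A'.IsDeformation)
    (h : Sec A.sheaf ⊤ →ₐ[R] Sec A'.sheaf ⊤) (hh : ∀ a, A'.ε ⊤ (h a) = A.ε ⊤ a) :
    ∃ G : A.sheaf ⟶ A'.sheaf, (∀ a, secMap G ⊤ a = h a) ∧
      ∀ V a, A'.ε V (secMap G V a) = A.ε V a := by
  have key : ∀ s : Γ(Y, ⊤), ∃ G : Sec A.sheaf (Y.basicOpen s) →ₐ[R] Sec A'.sheaf (Y.basicOpen s),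
      ∀ a, G (res A.sheaf le_top a) = res A'.sheaf le_top (h a) := by
    intro s
    obtain ⟨t, rfl⟩ := hA.isFormalDeformation_top.surjective s
    have hθ := (isAffineOpen_top Y).isAwayMap (A.ε ⊤ t)
    have hA'' := hA'.isFormalDeformation_basicOpen (A.ε ⊤ t)
    have := hA''.complete
    refine hA.isFormalDeformation_top.exists_extension (hA.isFormalDeformation_basicOpen _)
      (fun a => A.ε_res le_top a) hθ ((res A'.sheaf le_top).comp h) ?_
    -- Invertibility is detected by the augmentation, which `h` preserves, and there the element is
    -- the restricted function itself.
    refine hA''.isUnit_of_isUnit ?_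
    rw [AlgHom.comp_apply, ε_res, hh]
    exact hθ.isUnit
  choose G hG using key
  let B : Γ(Y, ⊤) → Y.Opens := fun s => Y.basicOpen s
  let α : (inducedFunctor B).op ⋙ A.sheaf.presheaf ⟶ (inducedFunctor B).op ⋙ A'.sheaf.presheaf :=
    { app := fun s => AlgCat.ofHom (G s.unop)
      naturality := fun s t i => by
        have hts : B t.unop ≤ B s.unop := i.unop.hom.le
        obtain ⟨t', ht'⟩ := hA.isDenseAt_res s.unop
        have := (hA'.isFormalDeformation_basicOpen t.unop).complete
        have e : (G t.unop).comp (res A.sheaf hts) = (res A'.sheaf hts).comp (G s.unop) :=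
          ht'.algHom_ext fun a => by
            rw [AlgHom.comp_apply, AlgHom.comp_apply, res_res, hG, hG, res_res]
        exact congrArg AlgCat.ofHom e }
  let G' : A.sheaf ⟶ A'.sheaf :=
    ⟨TopCat.Sheaf.restrictHomEquivHom _ _ (isBasis_range_basicOpen (Y := Y)) α⟩
  have hG' : ∀ s, secMap G' (B s) = G s := fun s =>
    congrArg AlgCat.Hom.hom (TopCat.Sheaf.extend_hom_app _ _ (isBasis_range_basicOpen (Y := Y)) α s)
  refine ⟨G', fun a => eq_of_locally_res_eq _ fun x hx => ?_, fun V a =>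
    eq_of_locally_oRes_eq _ fun x hx => ?_⟩
  · obtain ⟨s, hs, hxs⟩ := exists_basicOpen_le hx
    refine ⟨B s, hs, hxs, ?_⟩
    rw [← secMap_res, hG']
    exact hG s a
  · obtain ⟨s, hs, hxs⟩ := exists_basicOpen_le hx
    refine ⟨B s, hs, hxs, ?_⟩
    rw [← ε_res, ← ε_res, ← secMap_res, hG']
    obtain ⟨t, ht⟩ := hA.isDenseAt_res s
    have := isAdicComplete_overResidue (K := K) (R := R)
      (C := (structureSheafAlg g).presheaf.obj (op (B s)))
    have h1 : (A'.ε (B s)).comp (G s) = A.ε (B s) := ht.algHom_ext fun b => by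
      rw [AlgHom.comp_apply, hG, ε_res, hh, ε_res]
    exact congrArg (fun f => f (res A.sheaf hs a)) h1

/-- Gauge transformations between the algebras of global sections extend uniquely to gauge
transformations of deformations of the structure sheaf. -/
theorem existsUnique_gauge (hA : A.IsDeformation) (hA' : A'.IsDeformation)
    (h : (A.sections ⊤).Gauge (A'.sections ⊤)) : ∃! h' : A.Gauge A', h'.sections ⊤ = h := by
  have hh := (AugAlgebra.map_comp_aug_iff (A := A.sections ⊤) (A' := A'.sections ⊤) h.iso.hom).1
    h.comm
  have hh' : ∀ a, A.ε ⊤ (h.iso.inv.hom a) = A'.ε ⊤ a := fun a =>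
    (hh (h.iso.inv.hom a)).symm.trans (congrArg (A'.ε ⊤)
      (congrArg (fun f => f.hom a) h.iso.inv_hom_id))
  obtain ⟨G, hG, hGε⟩ := exists_sheafHom hA hA' h.iso.hom.hom hh
  obtain ⟨G', hG', -⟩ := exists_sheafHom hA' hA h.iso.inv.hom hh'
  have h1 : G ≫ G' = 𝟙 _ := sheafHom_ext hA hA fun a =>
    (hG' _).trans ((congrArg h.iso.inv.hom (hG a)).trans
      (congrArg (fun f => f.hom a) h.iso.hom_inv_id))
  have h2 : G' ≫ G = 𝟙 _ := sheafHom_ext hA' hA' fun a =>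
    (hG _).trans ((congrArg h.iso.hom.hom (hG' a)).trans
      (congrArg (fun f => f.hom a) h.iso.inv_hom_id))
  refine ⟨⟨⟨G, G', h1, h2⟩, (map_comp_aug_iff G).2 hGε⟩, ?_, fun h'' e => ?_⟩
  · refine AugAlgebra.Gauge.ext (Iso.ext (ConcreteCategory.hom_ext _ _ fun a => ?_))
    exact hG a
  · refine AugSheaf.Gauge.ext (Iso.ext (sheafHom_ext hA hA' fun a => ?_))
    rw [hG, ← e]
    rfl

theorem IsDeformation.sections_top (hA : A.IsDeformation) : (A.sections ⊤).IsDeformation :=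
  (A.sections ⊤).isDeformation_iff.2 hA.isFormalDeformation_top

end AugSheaf

end GaugeExtension

/-! ### Gluing for deformations on a basis -/

noncomputable section BasisDeformations

open IsLocalRing

/-- A presheaf of `R`-algebras on a basis of the topology, whose algebras of sections are
deformations of those of the sheaf `O`. -/
structure BasisDeformation {K : Type u} (R : Type u) [Field K] [CommRing R] [IsLocalRing R]
    [Algebra K R] [IsNoetherianRing R] [Fact (IsParameterAlgebra K R)] {X : TopCat.{u}}
    (O : TopCat.Sheaf (CommAlgCat.{u} K) X) {I : Type u} (B : I → Opens X) where
  alg : I → AlgCat.{u} R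
  map : ∀ {i j : I}, B j ≤ B i → (alg i →ₐ[R] alg j)
  map_map : ∀ {i j k : I} (h : B j ≤ B i) (h' : B k ≤ B j) (a : alg i),
    map h' (map h a) = map (h'.trans h) a
  map_self : ∀ {i : I} (a : alg i), map le_rfl a = a
  ε : ∀ i, alg i →ₐ[R] OSec R O (B i)
  ε_map : ∀ {i j : I} (h : B j ≤ B i) (a : alg i), ε j (map h a) = oRes R O h (ε i a)
  isFormalDeformation : ∀ i, IsFormalDeformation (ε i)
  isBasis : Opens.IsBasis (Set.range B)

namespace BasisDeformation

variable {K R : Type u} [Field K] [CommRing R] [IsLocalRing R] [Algebra K R]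
variable [IsNoetherianRing R] [hR : Fact (IsParameterAlgebra K R)] {X : TopCat.{u}}
  {O : TopCat.Sheaf (CommAlgCat.{u} K) X} {I : Type u} {B : I → Opens X}
  (P : BasisDeformation R O B)

include P in
theorem exists_le {V : Opens X} {x : X} (hx : x ∈ V) : ∃ i, B i ≤ V ∧ x ∈ B i := by
  obtain ⟨_, ⟨_, ⟨i, rfl⟩, rfl⟩, hxi, hi⟩ := P.isBasis.exists_subset_of_mem_open hx V.isOpen
  exact ⟨i, hi, hxi⟩

/-- A downward closed set of basic open subsets of `B i` that covers `B i`. -/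
structure IsCovering (B : I → Opens X) (i : I) (S : Set I) : Prop where
  le : ∀ j ∈ S, B j ≤ B i
  down : ∀ j ∈ S, ∀ k, B k ≤ B j → k ∈ S
  exists_mem : ∀ x ∈ B i, ∃ j ∈ S, x ∈ B j

section

variable {i : I} {S : Set I} (hS : IsCovering B i S)

include hS

theorem oRes_ext {a b : OSec R O (B i)} (h : ∀ j (hj : j ∈ S),
    oRes R O (hS.le j hj) a = oRes R O (hS.le j hj) b) : a = b :=
  eq_of_locally_oRes_eq O fun x hx =>
    let ⟨j, hj, hxj⟩ := hS.exists_mem x hx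
    ⟨B j, hS.le j hj, hxj, h j hj⟩

/-- By induction on `n`: the leading coefficients have augmentations that vanish on the covering,
hence vanish since `O` is a sheaf. -/
theorem mem_adic_of_map {n : ℕ} {p : P.alg i}
    (hp : ∀ j (hj : j ∈ S), P.map (hS.le j hj) p ∈ adic R (P.alg j) n) : p ∈ adic R (P.alg i) n := by
  induction n with
  | zero => exact mem_adic_zero _
  | succ n ih =>
    obtain ⟨a, rfl⟩ := exists_sum_gen (ih fun j hj => adic_antitone n.le_succ (hp j hj))
    refine sum_gen_mem (i := 1) fun l => ?_
    rw [← (P.isFormalDeformation i).eq_zero_iff]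
    refine oRes_ext hS fun j hj => ?_
    rw [← P.ε_map, map_zero, (P.isFormalDeformation j).eq_zero_iff]
    have := hp j hj
    simp only [map_sum, map_smul] at this
    exact (P.isFormalDeformation j).grFlat n _ this l

/-- The errors of an approximation modulo `𝔪 ^ n` have leading coefficients whose augmentations are
compatible, by `GrFlat`. They glue to sections of `O` over `B i`, lift to `P.alg i` and give the
next correction. Compatibility only modulo `𝔪 ^ N` suffices, which also serves for truncated
sections. -/
theorem exists_map_sub_mem {N : ℕ} (p : ∀ j ∈ S, P.alg j)
    (hp : ∀ j (hj : j ∈ S) k (hk : B k ≤ B j), P.map hk (p j hj) - p k (hS.down j hj k hk) ∈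
      adic R (P.alg k) N) {n : ℕ} (hn : n ≤ N) :
    ∃ q : P.alg i, ∀ j (hj : j ∈ S), P.map (hS.le j hj) q - p j hj ∈ adic R (P.alg j) n := by
  induction n with
  | zero => exact ⟨0, fun j hj => mem_adic_zero _⟩
  | succ n ih =>
    obtain ⟨q, hq⟩ := ih (n.le_succ.trans hn)
    choose a ha using fun j hj => exists_sum_gen (hq j hj)
    have hc : ∀ j (hj : j ∈ S) k (hk : B k ≤ B j) l,
        oRes R O hk (P.ε j (a j hj l)) = P.ε k (a k (hS.down j hj k hk) l) := by
      intro j hj k hk l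
      rw [← P.ε_map, ← sub_eq_zero, ← map_sub, (P.isFormalDeformation k).eq_zero_iff]
      refine (P.isFormalDeformation k).grFlat n
        (fun l => P.map hk (a j hj l) - a k (hS.down j hj k hk) l) ?_ l
      have h1 := congrArg (P.map hk) (ha j hj)
      simp only [map_sub, map_sum, map_smul, P.map_map] at h1
      simp only [smul_sub, Finset.sum_sub_distrib]
      rw [← h1, ← ha k, sub_sub_sub_cancel_left, ← neg_sub]
      exact Submodule.neg_mem _ (adic_antitone hn (hp j hj k hk))
    have key : ∀ l, ∃ c : OSec R O (B i), ∀ j (hj : j ∈ S),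
        oRes R O (hS.le j hj) c = P.ε j (a j hj l) := by
      intro l
      let Q : ∀ W : Opens X, W ≤ B i → OSec R O W → Prop := fun W hW t =>
        ∃ (j : I) (hj : j ∈ S) (h : W ≤ B j), t = oRes R O h (P.ε j (a j hj l))
      obtain ⟨c, hc'⟩ := exists_glue O Q (fun x hx => by
          obtain ⟨j, hj, hxj⟩ := hS.exists_mem x hx
          exact ⟨B j, hS.le j hj, hxj, _, j, hj, le_rfl, rfl⟩)
        (by
          rintro W hW _ W' hW' _ ⟨j, hj, hWj, rfl⟩ ⟨j', hj', hWj', rfl⟩ x hx hx'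
          obtain ⟨k, hk, hxk⟩ := P.exists_le (V := W ⊓ W') ⟨hx, hx'⟩
          refine ⟨B k, hk.trans inf_le_left, hk.trans inf_le_right, hxk, ?_⟩
          refine ((oRes_oRes O _ _ _).trans ?_).trans (oRes_oRes O _ _ _).symm
          rw [hc j hj k, hc j' hj' k])
      refine ⟨c, fun j hj => ?_⟩
      refine hc' _ _ _ ⟨j, hj, le_rfl, ?_⟩
      rw [oRes_self]
    choose c hc' using key
    choose b hb using fun l => (P.isFormalDeformation i).surjective (c l)
    refine ⟨q - ∑ l, gen R n l • b l, fun j hj => ?_⟩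
    rw [map_sub, sub_right_comm, ha j hj, map_sum, ← Finset.sum_sub_distrib]
    simp only [map_smul, ← smul_sub]
    refine sum_gen_mem (i := 1) fun l => ?_
    rw [← (P.isFormalDeformation j).eq_zero_iff, map_sub, P.ε_map, hb, hc' l j hj, sub_self]

theorem existsUnique_glue (p : ∀ j ∈ S, P.alg j)
    (hp : ∀ j (hj : j ∈ S) k (hk : B k ≤ B j), P.map hk (p j hj) = p k (hS.down j hj k hk)) :
    ∃! q : P.alg i, ∀ j (hj : j ∈ S), P.map (hS.le j hj) q = p j hj := by
  have hcomp := fun j => (P.isFormalDeformation j).complete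
  have key : ∀ n, ∃ q : P.alg i, ∀ j (hj : j ∈ S),
      P.map (hS.le j hj) q - p j hj ∈ adic R (P.alg j) n := fun n =>
    P.exists_map_sub_mem hS p (fun j hj k hk => by
      rw [hp j hj k hk, sub_self]; exact Submodule.zero_mem _) le_rfl
  choose q hq using key
  obtain ⟨y, hy⟩ := exists_limit (R := R) (x := q) fun n => P.mem_adic_of_map hS fun j hj => by
    have := Submodule.sub_mem _ (adic_antitone n.le_succ (hq (n + 1) j hj)) (hq n j hj)
    rwa [sub_sub_sub_cancel_right, ← map_sub] at this
  refine ⟨y, fun j hj => ?_, fun y' hy' => ?_⟩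
  · rw [← sub_eq_zero]
    refine eq_zero_of_forall_mem_adic (R := R) fun n => ?_
    have := Submodule.add_mem _ ((P.map (hS.le j hj)).map_mem_adic (hy n)) (hq n j hj)
    rwa [map_sub, sub_add_sub_cancel] at this
  · rw [← sub_eq_zero]
    refine eq_zero_of_forall_mem_adic (R := R) fun n => P.mem_adic_of_map hS fun j hj => ?_
    have h1 := Submodule.add_mem _ ((P.map (hS.le j hj)).map_mem_adic (hy n)) (hq n j hj)
    have h2 : P.map (hS.le j hj) (y' - y) = -(P.map (hS.le j hj) (y - q n) +
        (P.map (hS.le j hj) (q n) - p j hj)) := by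
      rw [map_sub, map_sub, hy' j hj]; abel
    rw [h2]
    exact Submodule.neg_mem _ h1

end

/-- The compatible families of sections over the basic open subsets of `V`. -/
def family (V : Opens X) : Subalgebra R (∀ i : {i // B i ≤ V}, P.alg i.1) where
  carrier := {f | ∀ i j : {i // B i ≤ V}, ∀ h : B j.1 ≤ B i.1, P.map h (f i) = f j}
  mul_mem' {f f'} hf hf' i j h := by rw [Pi.mul_apply, map_mul, hf i j h, hf' i j h]; rfl
  add_mem' {f f'} hf hf' i j h := by rw [Pi.add_apply, map_add, hf i j h, hf' i j h]; rfl
  algebraMap_mem' r i j h := (P.map h).commutes r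

theorem family_map {V : Opens X} (f : P.family V) {i j : I} (hi : B i ≤ V) (h : B j ≤ B i) :
    P.map h (f.1 ⟨i, hi⟩) = f.1 ⟨j, h.trans hi⟩ :=
  f.2 ⟨i, hi⟩ ⟨j, h.trans hi⟩ h

/-- The restriction of compatible families. -/
def familyRes {V W : Opens X} (h : W ≤ V) : P.family V →ₐ[R] P.family W where
  toFun f := ⟨fun i => f.1 ⟨i.1, i.2.trans h⟩, fun _ _ hij => P.family_map f _ hij⟩
  map_one' := rfl
  map_mul' _ _ := rfl
  map_zero' := rfl
  map_add' _ _ := rfl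
  commutes' _ := rfl

/-- The presheaf of compatible families. -/
def presheaf : TopCat.Presheaf (AlgCat.{u} R) X where
  obj V := AlgCat.of R (P.family V.unop)
  map i := AlgCat.ofHom (P.familyRes i.unop.le)
  map_id _ := rfl
  map_comp _ _ := rfl

theorem isSheaf : P.presheaf.IsSheaf := by
  rw [TopCat.Presheaf.isSheaf_iff_isSheaf_comp (forget (AlgCat.{u} R))]
  refine TopCat.Presheaf.isSheaf_of_isSheafUniqueGluing_types _ fun {ι} U sf hsf => ?_
  let f : ∀ k, P.family (U k) := sf
  have hf : ∀ k k' i (hk : B i ≤ U k) (hk' : B i ≤ U k'), (f k).1 ⟨i, hk⟩ = (f k').1 ⟨i, hk'⟩ := by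
    intro k k' i hk hk'
    have h1 : P.familyRes (inf_le_left : U k ⊓ U k' ≤ U k) (f k) =
      P.familyRes (inf_le_right : U k ⊓ U k' ≤ U k') (f k') := hsf k k'
    exact congrArg (fun x => x.1 ⟨i, le_inf hk hk'⟩) h1
  -- The basic open sets subordinate to the cover. The choice of `k` is immaterial by `hf`.
  let S : I → Set I := fun i => {j | B j ≤ B i ∧ ∃ k, B j ≤ U k}
  have hS : ∀ i, B i ≤ iSup U → IsCovering B i (S i) := fun i hi =>
    { le := fun j hj => hj.1
      down := fun j hj k hk => ⟨hk.trans hj.1, hj.2.choose, hk.trans hj.2.choose_spec⟩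
      exists_mem := fun x hx => by
        obtain ⟨k, hk⟩ := Opens.mem_iSup.1 (hi hx)
        obtain ⟨j, hj, hxj⟩ := P.exists_le (V := B i ⊓ U k) ⟨hx, hk⟩
        exact ⟨j, ⟨hj.trans inf_le_left, k, hj.trans inf_le_right⟩, hxj⟩ }
  have key : ∀ i : {i // B i ≤ iSup U}, ∃! q : P.alg i.1, ∀ j (hj : j ∈ S i.1),
      P.map hj.1 q = (f hj.2.choose).1 ⟨j, hj.2.choose_spec⟩ := fun i =>
    P.existsUnique_glue (hS i.1 i.2) (fun j hj => (f hj.2.choose).1 ⟨j, hj.2.choose_spec⟩)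
      fun j hj k hk => by
        rw [P.family_map]
        exact hf _ _ _ _ _
  choose q hq hq' using key
  have hq2 : ∀ (i : {i // B i ≤ iSup U}) j (hj : B j ≤ B i.1) k (hk : B j ≤ U k),
      P.map hj (q i) = (f k).1 ⟨j, hk⟩ := fun i j hj k hk =>
    (hq i j ⟨hj, k, hk⟩).trans (hf _ _ _ _ _)
  let s : P.family (iSup U) := ⟨q, fun i j h => hq' j _ fun k hk => by
    rw [P.map_map]
    exact hq2 _ _ _ _ _⟩
  refine ⟨s, fun k => ?_, fun s' hs' => ?_⟩
  · refine Subtype.ext (funext fun i => ?_)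
    change q ⟨i.1, i.2.trans (le_iSup U k)⟩ = (f k).1 i
    rw [← hq2 ⟨i.1, i.2.trans (le_iSup U k)⟩ i.1 le_rfl k i.2, P.map_self]
  · let t : P.family (iSup U) := s'
    have ht : ∀ k, P.familyRes (le_iSup U k) t = f k := hs'
    refine Subtype.ext (funext fun i => hq' i _ fun j hj => ?_)
    rw [← ht]
    exact P.family_map t i.2 hj.1

/-- The sheaf of compatible families. -/
def sheaf : TopCat.Sheaf (AlgCat.{u} R) X := ⟨P.presheaf, P.isSheaf⟩

end BasisDeformation

end BasisDeformations

/-! ### The sheaf of compatible families is a deformation -/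

noncomputable section SheafOfBasisDeformation

open IsLocalRing

namespace BasisDeformation

variable {K R : Type u} [Field K] [CommRing R] [IsLocalRing R] [Algebra K R]
variable [IsNoetherianRing R] [hR : Fact (IsParameterAlgebra K R)] {X : TopCat.{u}}
  {O : TopCat.Sheaf (CommAlgCat.{u} K) X} {I : Type u} {B : I → Opens X}
  (P : BasisDeformation R O B)

/-- The component of a section over `V` on a basic open subset of `V`. -/
def comp {V : Opens X} {i : I} (hi : B i ≤ V) : Sec P.sheaf V →ₐ[R] P.alg i where
  toFun f := (show P.family V from f).1 ⟨i, hi⟩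
  map_one' := rfl
  map_mul' _ _ := rfl
  map_zero' := rfl
  map_add' _ _ := rfl
  commutes' _ := rfl

section

variable {V W : Opens X} {i j : I}

theorem comp_res (h : W ≤ V) (hi : B i ≤ W) (f : Sec P.sheaf V) :
    P.comp hi (res P.sheaf h f) = P.comp (hi.trans h) f := rfl

theorem map_comp (hi : B i ≤ V) (h : B j ≤ B i) (f : Sec P.sheaf V) :
    P.map h (P.comp hi f) = P.comp (h.trans hi) f := P.family_map f hi h

theorem comp_ext {f f' : Sec P.sheaf V} (h : ∀ i (hi : B i ≤ V), P.comp hi f = P.comp hi f') :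
    f = f' := Subtype.ext (funext fun i => h i.1 i.2)

theorem exists_comp_eq (q : ∀ i, B i ≤ V → P.alg i)
    (hq : ∀ i (hi : B i ≤ V) j (h : B j ≤ B i), P.map h (q i hi) = q j (h.trans hi)) :
    ∃ f : Sec P.sheaf V, ∀ i (hi : B i ≤ V), P.comp hi f = q i hi :=
  ⟨⟨fun i => q i.1 i.2, fun i j h => hq i.1 i.2 j.1 h⟩, fun _ _ => rfl⟩

variable (i) in
theorem comp_bijective : Function.Bijective (P.comp (le_refl (B i))) := by
  constructor
  · intro f f' h
    refine P.comp_ext fun j hj => ?_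
    rw [← P.map_comp le_rfl hj, ← P.map_comp le_rfl hj, h]
  · intro p
    obtain ⟨f, hf⟩ := P.exists_comp_eq (V := B i) (fun j hj => P.map hj p)
      fun j hj k hk => P.map_map _ _ _
    exact ⟨f, (hf i le_rfl).trans (P.map_self p)⟩

variable (i) in
/-- The sections over a basic open set. -/
def compEquiv : Sec P.sheaf (B i) ≃ₐ[R] P.alg i :=
  AlgEquiv.ofBijective (P.comp (le_refl (B i))) (P.comp_bijective i)

theorem comp_mem_adic_iff {n : ℕ} {f : Sec P.sheaf (B i)} :
    P.comp (le_refl (B i)) f ∈ adic R (P.alg i) n ↔ f ∈ adic R (Sec P.sheaf (B i)) n := by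
  refine ⟨fun h => ?_, fun h => AlgHom.map_mem_adic _ h⟩
  have := AlgHom.map_mem_adic (P.compEquiv i).symm.toAlgHom h
  rwa [show (P.compEquiv i).symm.toAlgHom (P.comp (le_refl (B i)) f) = f from
    (P.compEquiv i).symm_apply_apply f] at this

/-- Membership in `𝔪 ^ n` is a local property on a basis deformation by `mem_adic_of_map`, so local
membership holds on every basic open set, not only on small ones. -/
theorem locallyMem_iff {n : ℕ} {f : Sec P.sheaf V} :
    LocallyMem P.sheaf n f ↔ ∀ i (hi : B i ≤ V), P.comp hi f ∈ adic R (P.alg i) n := by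
  constructor
  · intro h i hi
    have hS : IsCovering B i {j | ∃ h : B j ≤ B i, P.comp (h.trans hi) f ∈ adic R (P.alg j) n} :=
      { le := fun j hj => hj.1
        down := fun j hj k hk => ⟨hk.trans hj.1, by
          rw [← P.map_comp (hj.1.trans hi) hk]
          exact AlgHom.map_mem_adic _ hj.2⟩
        exists_mem := fun x hx => by
          obtain ⟨W, hW, hxW, h'⟩ := h x (hi hx)
          obtain ⟨j, hj, hxj⟩ := P.exists_le (V := B i ⊓ W) ⟨hx, hxW⟩
          refine ⟨j, ⟨hj.trans inf_le_left, ?_⟩, hxj⟩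
          exact AlgHom.map_mem_adic (P.comp (hj.trans inf_le_right)) h' }
    refine P.mem_adic_of_map hS fun j hj => ?_
    rw [P.map_comp]
    exact hj.2
  · intro h x hx
    obtain ⟨i, hi, hxi⟩ := P.exists_le hx
    exact ⟨B i, hi, hxi, P.comp_mem_adic_iff.1 (h i hi)⟩

theorem exists_augmentation (f : Sec P.sheaf V) :
    ∃ o : OSec R O V, ∀ i (hi : B i ≤ V), oRes R O hi o = P.ε i (P.comp hi f) := by
  let Q : ∀ W : Opens X, W ≤ V → OSec R O W → Prop := fun W hW t =>
    ∃ (i : I) (hi : B i ≤ V) (h : W ≤ B i), t = oRes R O h (P.ε i (P.comp hi f))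
  obtain ⟨o, ho⟩ := exists_glue O Q (fun x hx => by
      obtain ⟨i, hi, hxi⟩ := P.exists_le hx
      exact ⟨B i, hi, hxi, _, i, hi, le_rfl, rfl⟩)
    (by
      rintro W hW _ W' hW' _ ⟨i, hi, h, rfl⟩ ⟨i', hi', h', rfl⟩ x hx hx'
      obtain ⟨k, hk, hxk⟩ := P.exists_le (V := W ⊓ W') ⟨hx, hx'⟩
      have hkW := hk.trans inf_le_left
      have hkW' := hk.trans inf_le_right
      refine ⟨B k, hkW, hkW', hxk, ?_⟩
      refine ((oRes_oRes O _ _ _).trans ?_).trans (oRes_oRes O _ _ _).symm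
      rw [← P.ε_map (hkW.trans h), ← P.ε_map (hkW'.trans h'), P.map_comp, P.map_comp])
  exact ⟨o, fun i hi => ho _ _ _ ⟨i, hi, le_rfl, (oRes_self _ _).symm⟩⟩

include P in
theorem oRes_basic_ext {o o' : OSec R O V} (h : ∀ i (hi : B i ≤ V), oRes R O hi o = oRes R O hi o') :
    o = o' :=
  eq_of_locally_oRes_eq O fun _ hx =>
    let ⟨i, hi, hxi⟩ := P.exists_le hx
    ⟨B i, hi, hxi, h i hi⟩

variable (V) in
/-- The augmentation on sections. -/
def augSec : Sec P.sheaf V →ₐ[R] OSec R O V where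
  toFun f := (P.exists_augmentation f).choose
  map_one' := P.oRes_basic_ext fun i hi => by
    rw [(P.exists_augmentation _).choose_spec, map_one, map_one, map_one]
  map_mul' f f' := P.oRes_basic_ext fun i hi => by
    rw [(P.exists_augmentation _).choose_spec, map_mul, map_mul, map_mul,
      (P.exists_augmentation f).choose_spec, (P.exists_augmentation f').choose_spec]
  map_zero' := P.oRes_basic_ext fun i hi => by
    rw [(P.exists_augmentation _).choose_spec, map_zero, map_zero, map_zero]
  map_add' f f' := P.oRes_basic_ext fun i hi => by
    rw [(P.exists_augmentation _).choose_spec, map_add, map_add, map_add,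
      (P.exists_augmentation f).choose_spec, (P.exists_augmentation f').choose_spec]
  commutes' r := P.oRes_basic_ext fun i hi => by
    rw [(P.exists_augmentation _).choose_spec, AlgHom.commutes, AlgHom.commutes, AlgHom.commutes]

theorem oRes_augSec (hi : B i ≤ V) (f : Sec P.sheaf V) :
    oRes R O hi (P.augSec V f) = P.ε i (P.comp hi f) :=
  (P.exists_augmentation f).choose_spec i hi

theorem augSec_res (h : W ≤ V) (f : Sec P.sheaf V) :
    P.augSec W (res P.sheaf h f) = oRes R O h (P.augSec V f) :=
  P.oRes_basic_ext fun i hi => by rw [oRes_augSec, oRes_oRes, oRes_augSec, comp_res]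

end

/-- The augmented sheaf given by a deformation on a basis. -/
def augSheaf : AugSheaf K R O where
  sheaf := P.sheaf
  aug := (AugSheaf.exists_of_augmentation P.sheaf P.augSec fun h a => P.augSec_res h a).choose

theorem augSheaf_ε (V : Opens X) (f : Sec P.sheaf V) : P.augSheaf.ε V f = P.augSec V f :=
  (AugSheaf.exists_of_augmentation P.sheaf P.augSec fun h a => P.augSec_res h a).choose_spec V f

theorem oRes_augSheaf_ε {V : Opens X} {i : I} (hi : B i ≤ V) (f : Sec P.sheaf V) :
    oRes R O hi (P.augSheaf.ε V f) = P.ε i (P.comp hi f) := by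
  rw [augSheaf_ε, oRes_augSec]

theorem augSheaf_isIso_aug : IsIso P.augSheaf.aug := by
  rw [AugSheaf.isIso_aug_iff]
  constructor
  · intro V o x hx
    obtain ⟨i, hi, hxi⟩ := P.exists_le hx
    obtain ⟨p, hp⟩ := (P.isFormalDeformation i).surjective (oRes R O hi o)
    obtain ⟨f, hf⟩ := (P.comp_bijective i).2 p
    refine ⟨B i, hi, hxi, f, ?_⟩
    have h1 := P.oRes_augSheaf_ε le_rfl f
    rw [oRes_self, hf, hp] at h1
    exact h1
  · intro V f
    refine Iff.trans ?_ (P.locallyMem_iff (n := 1) (f := f)).symm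
    rw [← forall₂_congr fun i hi => (P.isFormalDeformation i).eq_zero_iff (P.comp hi f)]
    constructor
    · intro h i hi
      exact (P.oRes_augSheaf_ε hi f).symm.trans ((congrArg (oRes R O hi) h).trans (map_zero _))
    · intro h
      refine P.oRes_basic_ext fun i hi => ?_
      rw [map_zero]
      exact (P.oRes_augSheaf_ε hi f).trans (h i hi)

theorem flat_sec (i : I) : Module.Flat R (Sec P.sheaf (B i)) := by
  have := (P.isFormalDeformation i).complete
  have := flat_of_grFlat (P.isFormalDeformation i).grFlat
  exact Module.Flat.of_linearEquiv (P.compEquiv i).toLinearEquiv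

/-- A linear relation in the stalk already holds over some basic open set, where the sections are
flat; the trivialization found there maps to the stalk. -/
theorem sheafFlat : SheafFlat (algToModuleSheaf P.sheaf) := by
  intro x
  let M := (algToModuleSheaf P.sheaf).presheaf
  let γ : ∀ (W : Opens X), x ∈ W → Sec P.sheaf W →ₗ[R] M.stalk x := fun W hW => (M.germ W x hW).hom
  have hγ : ∀ (W W' : Opens X) (h : W' ≤ W) (hx' : x ∈ W') (b : Sec P.sheaf W),
      γ W' hx' (res P.sheaf h b) = γ W (h hx') b := fun W W' h hx' b =>
    TopCat.Presheaf.germ_res_apply M (homOfLE h) x hx' b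
  refine Module.Flat.of_forall_isTrivialRelation fun {l} {r} {t} hrt => ?_
  have h1 : ∀ k, ∃ (W : Opens X) (hW : x ∈ W) (b : Sec P.sheaf W), γ W hW b = t k := fun k =>
    M.exists_germ_eq (t k)
  choose W hW b hb using h1
  let W' : Opens X := ⟨⋂ k, (W k : Set X), isOpen_iInter_of_finite fun k => (W k).isOpen⟩
  have hW' : ∀ k, W' ≤ W k := fun k => Set.iInter_subset (fun k => (W k : Set X)) k
  have hxW' : x ∈ W' := Set.mem_iInter.2 hW
  let b' : Fin l → Sec P.sheaf W' := fun k => res P.sheaf (hW' k) (b k)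
  have hb' : ∀ k, γ W' hxW' (b' k) = t k := fun k => (hγ _ _ _ _ _).trans (hb k)
  have h2 : γ W' hxW' (∑ k, r k • b' k) = γ W' hxW' 0 := by
    rw [map_sum, map_zero, ← hrt]
    exact Finset.sum_congr rfl fun k _ => by rw [map_smul, hb']
  obtain ⟨W₁, hx₁, j, j', h3⟩ := M.germ_eq x hxW' hxW' _ _ h2
  have h4 : res P.sheaf j.le (∑ k, r k • b' k) = res P.sheaf j'.le 0 := h3
  obtain ⟨i, hi, hxi⟩ := P.exists_le hx₁
  have h5 : ∑ k, r k • res P.sheaf (hi.trans j.le) (b' k) = 0 := by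
    have := congrArg (res P.sheaf hi) h4
    simpa only [res_res, map_sum, map_smul, map_zero] using this
  have := P.flat_sec i
  obtain ⟨m, c, y, h6, h7⟩ := Module.Flat.isTrivialRelation_of_sum_smul_eq_zero h5
  refine ⟨m, c, fun k => γ (B i) hxi (y k), fun k => ?_, h7⟩
  rw [← hb' k, ← hγ _ _ (hi.trans j.le) hxi]
  refine (congrArg (γ (B i) hxi) (h6 k)).trans ((map_sum _ _ _).trans ?_)
  exact Finset.sum_congr rfl fun k _ => map_smul _ _ _

/-- Local lifts of `s` on basic open sets are compatible modulo `𝔪 ^ (n + 1)`, so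
`exists_map_sub_mem` replaces them by a single lift over `B i`. -/
theorem exists_truncation_eq {V : Opens X} (n : ℕ) (s : QSec P.sheaf n V) {i : I} (hi : B i ≤ V) :
    ∃ f : Sec P.sheaf (B i), truncation P.sheaf n (B i) f = restr
      (F := (quotTensor (algToModuleSheaf P.sheaf) (maximalIdeal R ^ (n + 1))).presheaf) hi s := by
  let F := quotTensor (algToModuleSheaf P.sheaf) (maximalIdeal R ^ (n + 1))
  let S : Set I := {j | ∃ h : B j ≤ B i, ∃ f : Sec P.sheaf (B j),
    truncation P.sheaf n (B j) f = restr (F := F.presheaf) (h.trans hi) s}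
  have hS : IsCovering B i S :=
    { le := fun j hj => hj.1
      down := fun j hj k hk => by
        obtain ⟨h, f, hf⟩ := hj
        refine ⟨hk.trans h, res P.sheaf hk f, ?_⟩
        rw [truncation_res, hf]
        exact restr_restr (F := F.presheaf) _ _ _
      exists_mem := fun x hx => by
        obtain ⟨W, hW, hxW, a, ha⟩ := truncation_locally_surjective P.sheaf n s x (hi hx)
        obtain ⟨j, hj, hxj⟩ := P.exists_le (V := B i ⊓ W) ⟨hx, hxW⟩
        refine ⟨j, ⟨hj.trans inf_le_left, res P.sheaf (hj.trans inf_le_right) a, ?_⟩, hxj⟩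
        rw [truncation_res, ha]
        exact restr_restr (F := F.presheaf) _ _ _ }
  choose f hf using fun j (hj : j ∈ S) => hj.2
  obtain ⟨q, hq⟩ := P.exists_map_sub_mem hS (N := n + 1) (n := n + 1)
    (fun j hj => P.comp le_rfl (f j hj)) (fun j hj k hk => by
      have h1 : LocallyMem P.sheaf (n + 1) (res P.sheaf hk (f j hj) - f k (hS.down j hj k hk)) := by
        rw [← truncation_eq_iff, truncation_res, hf, hf]
        exact restr_restr (F := F.presheaf) _ _ _
      have h2 := P.locallyMem_iff.1 h1 k le_rfl
      rwa [map_sub, P.comp_res, ← P.map_comp le_rfl hk] at h2) le_rfl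
  obtain ⟨f', rfl⟩ := (P.comp_bijective i).2 q
  refine ⟨f', eq_of_locally_restr_eq F fun x hx => ?_⟩
  obtain ⟨j, hj, hxj⟩ := hS.exists_mem x hx
  refine ⟨B j, hS.le j hj, hxj, ?_⟩
  refine (truncation_res P.sheaf n _ _).symm.trans (Eq.trans ?_
    (restr_restr (F := F.presheaf) hi (hS.le j hj) s).symm)
  rw [← hf j hj, truncation_eq_iff]
  refine locallyMem_of_mem (P.comp_mem_adic_iff.1 ?_)
  have h1 := hq j hj
  rwa [P.map_comp] at h1

/-- On each basic open set the truncated sections lift, and the lifts converge in the complete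
algebra there. The limits are compatible because the lifts are so modulo growing powers of `𝔪`. -/
theorem sheafComplete : SheafComplete (maximalIdeal R) (algToModuleSheaf P.sheaf) := by
  rw [sheafComplete_iff]
  intro V s hs
  have hcomp := fun j => (P.isFormalDeformation j).complete
  choose f hf using fun n i (hi : B i ≤ V) => P.exists_truncation_eq n (s n) hi
  have hf1 : ∀ n i (hi : B i ≤ V), P.comp le_rfl (f (n + 1) i hi) - P.comp le_rfl (f n i hi) ∈
      adic R (P.alg i) (n + 1) := by
    intro n i hi
    rw [← map_sub]
    refine P.locallyMem_iff.1 ?_ i le_rfl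
    rw [← truncation_eq_iff, ← transition_truncation, hf, hf, transition_restr, hs]
  have hf2 : ∀ n i (hi : B i ≤ V) j (h : B j ≤ B i), P.map h (P.comp le_rfl (f n i hi)) -
      P.comp le_rfl (f n j (h.trans hi)) ∈ adic R (P.alg j) (n + 1) := by
    intro n i hi j h
    rw [P.map_comp, ← P.comp_res h le_rfl, ← map_sub]
    refine P.locallyMem_iff.1 ?_ j le_rfl
    rw [← truncation_eq_iff, truncation_res, hf, hf]
    exact restr_restr (F := (quotTensor (algToModuleSheaf P.sheaf)
      (maximalIdeal R ^ (n + 1))).presheaf) _ _ _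
  have hlim : ∀ i (hi : B i ≤ V), ∃ y : P.alg i, ∀ n, y - P.comp le_rfl (f n i hi) ∈
      adic R (P.alg i) n := fun i hi =>
    exists_limit (R := R) (x := fun n => P.comp le_rfl (f n i hi))
      fun n => adic_antitone n.le_succ (hf1 n i hi)
  choose y hy using hlim
  -- Truncation at `n` means modulo `𝔪 ^ (n + 1)`, one power more than the limit provides;
  -- comparison with the next lift gains it.
  have hy' : ∀ i (hi : B i ≤ V) n, y i hi - P.comp le_rfl (f n i hi) ∈ adic R (P.alg i) (n + 1) := by
    intro i hi n
    have := Submodule.add_mem _ (hy i hi (n + 1)) (hf1 n i hi)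
    rwa [sub_add_sub_cancel] at this
  obtain ⟨a, ha⟩ := P.exists_comp_eq y fun i hi j h => by
    rw [← sub_eq_zero]
    refine eq_zero_of_forall_mem_adic (R := R) fun n => ?_
    have h1 := AlgHom.map_mem_adic (P.map h) (hy i hi n)
    have h2 := adic_antitone n.le_succ (hf2 n i hi j h)
    have h3 := Submodule.sub_mem _ (Submodule.add_mem _ h1 h2) (hy j (h.trans hi) n)
    rw [map_sub] at h3
    convert h3 using 1
    abel
  refine ⟨a, fun n => ?_, fun a' ha' => ?_⟩
  · refine eq_of_locally_restr_eq (quotTensor (algToModuleSheaf P.sheaf)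
      (maximalIdeal R ^ (n + 1))) fun x hx => ?_
    obtain ⟨i, hi, hxi⟩ := P.exists_le hx
    refine ⟨B i, hi, hxi, ?_⟩
    rw [← truncation_res, ← hf, truncation_eq_iff]
    refine locallyMem_of_mem (P.comp_mem_adic_iff.1 ?_)
    rw [map_sub, P.comp_res, ha]
    exact hy' i hi n
  · refine P.comp_ext fun i hi => ?_
    rw [← sub_eq_zero]
    refine eq_zero_of_forall_mem_adic (R := R) fun n => adic_antitone n.le_succ ?_
    have h1 : LocallyMem P.sheaf (n + 1) (res P.sheaf hi a' - f n i hi) := by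
      rw [← truncation_eq_iff, truncation_res, hf, ha']
    have h2 := P.locallyMem_iff.1 h1 i le_rfl
    rw [map_sub, P.comp_res] at h2
    have h3 := Submodule.sub_mem _ h2 (hy' i hi n)
    rwa [sub_sub_sub_cancel_right, ← ha i hi] at h3

theorem augSheaf_isDeformation : P.augSheaf.IsDeformation :=
  ⟨P.sheafFlat, P.sheafComplete, P.augSheaf_isIso_aug⟩

end BasisDeformation

end SheafOfBasisDeformation

/-! ### Existence of a deformation of the structure sheaf -/

noncomputable section Localizing

open IsLocalRing

variable {K R : Type u} [Field K] [CommRing R] [IsLocalRing R] [Algebra K R]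
variable [hR : Fact (IsParameterAlgebra K R)]

theorem AugAlgebra.exists_gauge_of_algEquiv {C : Type u} [CommRing C] [Algebra K C]
    {A A' : AugAlgebra K R C} (φ : A.alg ≃ₐ[R] A'.alg) (hφ : ∀ a, A'.augHom (φ a) = A.augHom a) :
    ∃ h : A.Gauge A', ∀ a, h.iso.hom a = φ a :=
  ⟨⟨φ.toAlgebraIso, (AugAlgebra.map_comp_aug_iff _).2 hφ⟩, fun _ => rfl⟩

variable [IsNoetherianRing R]
  {Y : Scheme.{u}} {g : Y ⟶ Spec (CommRingCat.of K)}

/-- The homomorphism `ρ : A → B` exhibits the complete algebra `B` as the completed localization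
of `A` at `t`. -/
structure IsCompletedLocalization {A B : AlgCat.{u} R} (ρ : A →ₐ[R] B) (t : A) : Prop where
  isDenseAt : IsDenseAt ρ t
  exists_lift : ∀ (D : Type u) [Ring D] [Algebra R D] [IsAdicComplete (maximalIdeal R) D]
    (h : A →ₐ[R] D), IsUnit (h t) → ∃ h' : B →ₐ[R] D, ∀ a, h' (ρ a) = h a

/-- The homomorphisms `ρ s : A → P s` exhibit the deformation `P` on the basis of basic open sets
as the localization of the deformation `A` of the algebra of global functions. -/
structure IsBasisLocalization {A : AlgCat.{u} R} (ε : A →ₐ[R] OSec R (structureSheafAlg g) ⊤)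
    (P : BasisDeformation R (structureSheafAlg g) fun s : Γ(Y, ⊤) => Y.basicOpen s)
    (ρ : ∀ s, A →ₐ[R] P.alg s) : Prop where
  isCompletedLocalization : ∀ s, ∃ t, ε t = s ∧ IsCompletedLocalization (ρ s) t
  map_apply : ∀ s t (h : Y.basicOpen t ≤ Y.basicOpen s) a, P.map h (ρ s a) = ρ t a
  ε_apply : ∀ s a, P.ε s (ρ s a) = oRes R _ le_top (ε a)

variable [IsAffine Y] in
/-- A deformation of the algebra of global functions extends to a deformation on the basis of
basic open sets. -/
theorem exists_basisDeformation {A : AlgCat.{u} R} {ε : A →ₐ[R] OSec R (structureSheafAlg g) ⊤}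
    (hA : IsFormalDeformation ε) :
    ∃ (P : BasisDeformation R (structureSheafAlg g) fun s : Γ(Y, ⊤) => Y.basicOpen s)
      (ρ : ∀ s, A →ₐ[R] P.alg s), IsBasisLocalization ε P ρ := by
  let B : Γ(Y, ⊤) → Y.Opens := fun s => Y.basicOpen s
  let O := structureSheafAlg g
  have hθ : ∀ s : OSec R O ⊤, IsAwayMap (oRes R O (le_top : B s ≤ ⊤)) s :=
    fun s => (isAffineOpen_top Y).isAwayMap s
  choose t ht using fun s : Γ(Y, ⊤) => hA.surjective s
  have hθt : ∀ s : Γ(Y, ⊤), IsAwayMap (oRes R O (le_top : B s ≤ ⊤)) (ε (t s)) := fun s => by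
    rw [ht]; exact hθ s
  choose L ρ e he hρ using fun s : Γ(Y, ⊤) =>
    hA.exists_localization adic_overResidue (hθt s)
  have hcomp := fun s => (he s).complete
  have hdense : ∀ s, IsDenseAt (ρ s) (t s) := fun s => hA.isDenseAt (he s) (hρ s) (hθt s)
  -- Restrictions come from the universal property of `L s`; functoriality and compatibility with
  -- augmentations then follow from density.
  have hmap : ∀ s s', B s' ≤ B s → ∃ r : L s →ₐ[R] L s', ∀ a, r (ρ s a) = ρ s' a := by
    intro s s' h
    refine hA.exists_extension (he s) (hρ s) (hθt s) (ρ s') ((he s').isUnit_of_isUnit ?_)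
    rw [hρ, ← oRes_oRes O (le_top : B s ≤ ⊤) h]
    exact (hθt s).isUnit.map _
  choose r hr using hmap
  refine ⟨⟨L, fun {s s'} h => r s s' h, fun {s s' s''} h h' a => ?_, fun {s} a => ?_, e,
    fun {s s'} h a => ?_, he, isBasis_range_basicOpen⟩, ρ, fun s => ⟨t s, ht s, hdense s,
      fun D _ _ _ h hh => hA.exists_extension (he s) (hρ s) (hθt s) h hh⟩, hr, hρ⟩
  · have h1 : (r s' s'' h').comp (r s s' h) = r s s'' (h'.trans h) :=
      (hdense s).algHom_ext fun a => by rw [AlgHom.comp_apply, hr, hr, hr]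
    exact congrArg (fun f => f a) h1
  · have h1 : r s s le_rfl = AlgHom.id R (L s) := (hdense s).algHom_ext fun a => hr _ _ _ _
    exact congrArg (fun f => f a) h1
  · have := isAdicComplete_overResidue (K := K) (R := R) (C := O.presheaf.obj (op (B s')))
    have h1 : (e s').comp (r s s' h) = (oRes R O h).comp (e s) :=
      (hdense s).algHom_ext fun a => by
        rw [AlgHom.comp_apply, AlgHom.comp_apply, hr, hρ, hρ, oRes_oRes]
    exact congrArg (fun f => f a) h1

section

variable {A : AlgCat.{u} R} {ε : A →ₐ[R] OSec R (structureSheafAlg g) ⊤}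

/-- The basic open set of the function `1` is the whole space. Localizing the complete algebra `A`
at a lift of `1` changes nothing, since that lift is already a unit. -/
theorem exists_algEquiv_sections (hA : IsFormalDeformation ε)
    {P : BasisDeformation R (structureSheafAlg g) fun s : Γ(Y, ⊤) => Y.basicOpen s}
    {ρ : ∀ s, A →ₐ[R] P.alg s} (hP : IsBasisLocalization ε P ρ) :
    ∃ φ : A ≃ₐ[R] Sec P.sheaf ⊤, (∀ s a, P.comp le_top (φ a) = ρ s a) ∧
      ∀ a, P.augSheaf.ε ⊤ (φ a) = ε a := by
  have := hA.complete
  let e : Γ(Y, ⊤) := 1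
  obtain ⟨t₁, ht₁, ht, hlift⟩ := hP.isCompletedLocalization e
  -- The identity of `A` extends to the localization at `t₁`, which gives the inverse of `ρ e`.
  obtain ⟨h', hh'⟩ := hlift A (AlgHom.id R A) (hA.isUnit_of_isUnit (by
    rw [AlgHom.id_apply, ht₁]; exact isUnit_one))
  have hcomp := (P.isFormalDeformation e).complete
  have hh'' : (ρ e).comp h' = AlgHom.id R _ := ht.algHom_ext fun a => by
    rw [AlgHom.comp_apply, hh']; rfl
  have htop : ∀ s : Γ(Y, ⊤), Y.basicOpen s ≤ Y.basicOpen e := fun s => by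
    rw [Y.basicOpen_of_isUnit isUnit_one]; exact le_top
  let φ : A →ₐ[R] P.family ⊤ := (AlgHom.pi fun s : {s : Γ(Y, ⊤) // Y.basicOpen s ≤ ⊤} =>
    ρ s.1).codRestrict (P.family ⊤) fun a s s' h => hP.map_apply s.1 s'.1 h a
  let φ' : A →ₐ[R] Sec P.sheaf ⊤ := φ
  have hφ : ∀ s a, P.comp le_top (φ' a) = ρ s a := fun s a => rfl
  have hbij : Function.Bijective φ' := by
    constructor
    · intro a b hab
      rw [← AlgHom.id_apply (R := R) a, ← AlgHom.id_apply (R := R) b, ← hh', ← hh', ← hφ,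
        ← hφ, hab]
    · intro f
      refine ⟨h' (P.comp le_top f), P.comp_ext fun s hs => ?_⟩
      have h1 : ρ e (h' (P.comp le_top f)) = P.comp le_top f :=
        congrArg (fun f' => f' (P.comp le_top f)) hh''
      rw [hφ, ← hP.map_apply e s (htop s), h1, P.map_comp]
  refine ⟨AlgEquiv.ofBijective φ' hbij, hφ, fun a => P.oRes_basic_ext fun s hs => ?_⟩
  rw [← hP.ε_apply, ← hφ]
  exact P.oRes_augSheaf_ε hs (φ' a)

end

variable [IsAffine Y] in
/-- A deformation of the algebra of global functions is isomorphic to the global sections of a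
deformation of the structure sheaf. -/
theorem AugAlgebra.IsDeformation.exists_augSheaf
    {A : AugAlgebra K R ((structureSheafAlg g).presheaf.obj (op ⊤))} (hA : A.IsDeformation) :
    ∃ 𝒜 : AugSheaf K R (structureSheafAlg g), 𝒜.IsDeformation ∧
      Nonempty (A.Gauge (𝒜.sections ⊤)) := by
  rw [AugAlgebra.isDeformation_iff] at hA
  obtain ⟨P, ρ, hP⟩ := exists_basisDeformation hA
  obtain ⟨φ, -, hφ⟩ := exists_algEquiv_sections hA hP
  exact ⟨P.augSheaf, P.augSheaf_isDeformation,
    ⟨(AugAlgebra.exists_gauge_of_algEquiv (A' := P.augSheaf.sections ⊤) φ hφ).choose⟩⟩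

end Localizing

/-! ### Extension of derivations and Poisson brackets to localizations -/

noncomputable section PoissonExtension

open IsLocalRing

variable {R : Type u} [CommRing R]

/-- The linear map `δ` is a derivation along the algebra homomorphism `g`. -/
def IsDerivationAlong {A B : Type*} [Ring A] [Algebra R A] [Ring B] [Algebra R B] (g : A →ₐ[R] B)
    (δ : A →ₗ[R] B) : Prop :=
  ∀ x y, δ (x * y) = δ x * g y + g x * δ y

theorem IsDerivationAlong.sub {A B : Type*} [Ring A] [Algebra R A] [Ring B] [Algebra R B]
    {g : A →ₐ[R] B} {δ δ' : A →ₗ[R] B} (h : IsDerivationAlong g δ) (h' : IsDerivationAlong g δ') :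
    IsDerivationAlong g (δ - δ') := fun x y => by
  simp only [LinearMap.sub_apply]
  rw [h, h', sub_mul, mul_sub]
  abel

theorem IsDerivationAlong.add {A B : Type*} [Ring A] [Algebra R A] [Ring B] [Algebra R B]
    {g : A →ₐ[R] B} {δ δ' : A →ₗ[R] B} (h : IsDerivationAlong g δ) (h' : IsDerivationAlong g δ') :
    IsDerivationAlong g (δ + δ') := fun x y => by
  simp only [LinearMap.add_apply]
  rw [h, h', add_mul, mul_add]
  abel

theorem IsDerivationAlong.smul {A B : Type*} [Ring A] [Algebra R A] [Ring B] [Algebra R B]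
    {g : A →ₐ[R] B} {δ : A →ₗ[R] B} (r : R) (h : IsDerivationAlong g δ) :
    IsDerivationAlong g (r • δ) := fun x y => by
  simp only [LinearMap.smul_apply]
  rw [h, smul_add, smul_mul_assoc, mul_smul_comm]

section

variable {B : Type u} [Ring B] [Algebra R B]

theorem PoissonStructure.isDerivationAlong_left (π : PoissonStructure R B) (b : B) :
    IsDerivationAlong (AlgHom.id R B) (π.bracket.flip b) := fun x y => π.leibniz_left x y b

theorem PoissonStructure.isDerivationAlong_right (π : PoissonStructure R B) (b : B) :
    IsDerivationAlong (AlgHom.id R B) (π.bracket b) := fun x y => π.leibniz_right b x y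

end

section

variable {B : Type u} [Ring B] [Algebra R B]

/-- The Jacobiator of a bracket, as a linear map in its first argument. -/
def jacobiator (β : B →ₗ[R] B →ₗ[R] B) (b c : B) : B →ₗ[R] B :=
  β.flip (β b c) + (β b).comp (β c) + (β c).comp (β.flip b)

theorem jacobiator_apply (β : B →ₗ[R] B →ₗ[R] B) (a b c : B) :
    jacobiator β b c a = β a (β b c) + β b (β c a) + β c (β a b) := rfl

theorem jacobiator_cyclic (β : B →ₗ[R] B →ₗ[R] B) (a b c : B) :
    jacobiator β b c a = jacobiator β c a b := by
  rw [jacobiator_apply, jacobiator_apply]; abel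

/-- In the expansion on a product, the mixed terms cancel by antisymmetry and commutativity. Hence
the Jacobi identity can be tested on a dense image, one argument at a time. -/
theorem isDerivationAlong_jacobiator (hcomm : ∀ x y : B, x * y = y * x)
    {β : B →ₗ[R] B →ₗ[R] B} (hanti : ∀ x y, β x y = -β y x)
    (hl : ∀ z, IsDerivationAlong (AlgHom.id R B) (β.flip z))
    (hr : ∀ z, IsDerivationAlong (AlgHom.id R B) (β z)) (b c : B) :
    IsDerivationAlong (AlgHom.id R B) (jacobiator β b c) := by
  intro x y
  have hl' : ∀ z x y, β (x * y) z = β x z * y + x * β y z := fun z x y => hl z x y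
  have hr' : ∀ z x y, β z (x * y) = β z x * y + x * β z y := fun z x y => hr z x y
  simp only [jacobiator_apply, hl', hr', map_add, AlgHom.id_apply]
  rw [hanti x b, hanti y b, hcomm (β b x) (β c y)]
  simp only [map_neg, neg_mul, mul_neg, add_mul, mul_add]
  rw [hcomm (β c y) (β b x)]
  abel

end

variable [IsLocalRing R]

section

variable {B : Type*} [Ring B] [Algebra R B]

theorem mem_adic_trivSqZeroExt_iff {n : ℕ} {x : TrivSqZeroExt B B} :
    x ∈ adic R (TrivSqZeroExt B B) n ↔ x.fst ∈ adic R B n ∧ x.snd ∈ adic R B n := by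
  constructor
  · intro h
    exact ⟨AlgHom.map_mem_adic (TrivSqZeroExt.fstHom R B B) h,
      map_mem_adic ((TrivSqZeroExt.sndHom B B).restrictScalars R) h⟩
  · rintro ⟨h1, h2⟩
    rw [← TrivSqZeroExt.inl_fst_add_inr_snd_eq x]
    exact Submodule.add_mem _ (AlgHom.map_mem_adic (TrivSqZeroExt.inlAlgHom R B B) h1)
      (map_mem_adic ((TrivSqZeroExt.inrHom B B).restrictScalars R) h2)

theorem isAdicComplete_trivSqZeroExt [IsAdicComplete (maximalIdeal R) B] :
    IsAdicComplete (maximalIdeal R) (TrivSqZeroExt B B) := by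
  refine isAdicComplete_of_limits (fun x hx => ?_) fun x hx => ?_
  · exact TrivSqZeroExt.ext
      (eq_zero_of_forall_mem_adic (R := R) fun n => (mem_adic_trivSqZeroExt_iff.1 (hx n)).1)
      (eq_zero_of_forall_mem_adic (R := R) fun n => (mem_adic_trivSqZeroExt_iff.1 (hx n)).2)
  · obtain ⟨y, hy⟩ := exists_limit (R := R) (x := fun n => (x n).fst)
      fun n => (mem_adic_trivSqZeroExt_iff.1 (hx n)).1
    obtain ⟨z, hz⟩ := exists_limit (R := R) (x := fun n => (x n).snd)
      fun n => (mem_adic_trivSqZeroExt_iff.1 (hx n)).2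
    refine ⟨(y, z), fun n => mem_adic_trivSqZeroExt_iff.2 ⟨hy n, hz n⟩⟩

end

section

variable {A B B' : Type*} [Ring A] [Algebra R A] [Ring B] [Algebra R B] [Ring B'] [Algebra R B']
  {ρ : A →ₐ[R] B} {t : A} (hρ : IsDenseAt ρ t)

include hρ

theorem IsDenseAt.derivation_ext [IsHausdorff (maximalIdeal R) B'] {g : B →ₐ[R] B'}
    {δ δ' : B →ₗ[R] B'} (hδ : IsDerivationAlong g δ) (hδ' : IsDerivationAlong g δ')
    (h : ∀ a, δ (ρ a) = δ' (ρ a)) : δ = δ' :=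
  LinearMap.ext fun b => sub_eq_zero.1 (hρ.derivation_eq_zero (hδ.sub hδ')
    (fun a => sub_eq_zero.2 (h a)) b)

/-- The commutator with a fixed element is a derivation. First the elements of the image are
central, since their commutators vanish on the image; then the same argument applies to any element.
-/
theorem IsDenseAt.mul_comm [IsHausdorff (maximalIdeal R) B] (hA : ∀ a b : A, a * b = b * a)
    (x y : B) : x * y = y * x := by
  have key : ∀ z : B, IsDerivationAlong (AlgHom.id R B)
      (LinearMap.mulRight R z - LinearMap.mulLeft R z) := fun z x y => by
    simp only [LinearMap.sub_apply, LinearMap.mulRight_apply, LinearMap.mulLeft_apply,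
      AlgHom.id_apply]
    noncomm_ring
  have h1 : ∀ (a : A) (y : B), y * ρ a - ρ a * y = 0 := fun a y =>
    hρ.derivation_eq_zero (key (ρ a)) (fun b => by
      simp only [LinearMap.sub_apply, LinearMap.mulRight_apply, LinearMap.mulLeft_apply]
      rw [← map_mul, ← map_mul, hA, sub_self]) y
  exact sub_eq_zero.1 (hρ.derivation_eq_zero (key y) (fun a => by
    simp only [LinearMap.sub_apply, LinearMap.mulRight_apply, LinearMap.mulLeft_apply]
    rw [← neg_sub, h1, neg_zero]) x)

end

section

/-- The pair of `ρ` and `d` is an algebra homomorphism to the dual numbers over `B`, a complete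
algebra in which `t` is a unit because its first component is. The universal property extends it,
and the second component is the derivation. -/
theorem IsCompletedLocalization.exists_derivation {A B : AlgCat.{u} R} {ρ : A →ₐ[R] B} {t : A}
    (hρ : IsCompletedLocalization ρ t) [IsAdicComplete (maximalIdeal R) B] {d : A →ₗ[R] B}
    (hd : IsDerivationAlong ρ d) :
    ∃ δ : B →ₗ[R] B, IsDerivationAlong (AlgHom.id R B) δ ∧ ∀ a, δ (ρ a) = d a := by
  have := isAdicComplete_trivSqZeroExt (R := R) (B := B)
  have hd1 : d 1 = 0 := by
    have := hd 1 1
    rw [mul_one, map_one ρ, one_mul, mul_one] at this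
    exact left_eq_add.1 this
  let h : A →ₐ[R] TrivSqZeroExt B B := AlgHom.ofLinearMap
    { toFun := fun a => (ρ a, d a)
      map_add' := fun a b => TrivSqZeroExt.ext (map_add ρ a b) (map_add d a b)
      map_smul' := fun r a => TrivSqZeroExt.ext (map_smul ρ r a) (map_smul d r a) }
    (TrivSqZeroExt.ext (map_one ρ) hd1)
    (fun a b => TrivSqZeroExt.ext (map_mul ρ a b) ((hd a b).trans (add_comm _ _)))
  obtain ⟨h', hh'⟩ := hρ.exists_lift _ h
    (TrivSqZeroExt.isUnit_iff_isUnit_fst.2 hρ.isDenseAt.isUnit)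
  have h1 : (TrivSqZeroExt.fstHom R B B).comp h' = AlgHom.id R B :=
    hρ.isDenseAt.algHom_ext fun a => congrArg TrivSqZeroExt.fst (hh' a)
  have h2 : ∀ b, (h' b).fst = b := fun b => congrArg (fun f => f b) h1
  refine ⟨((TrivSqZeroExt.sndHom B B).restrictScalars R).comp h'.toLinearMap, fun x y => ?_,
    fun a => congrArg TrivSqZeroExt.snd (hh' a)⟩
  change (h' (x * y)).snd = (h' x).snd * y + x * (h' y).snd
  rw [map_mul, TrivSqZeroExt.snd_mul, h2, h2, add_comm]
  rfl

/-- Families of derivations that depend linearly on a parameter extend to the localization. -/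
theorem IsCompletedLocalization.exists_derivation_family {A B : AlgCat.{u} R} {ρ : A →ₐ[R] B}
    {t : A} (hρ : IsCompletedLocalization ρ t) [IsAdicComplete (maximalIdeal R) B] {M : Type*}
    [AddCommGroup M] [Module R M] {d : M →ₗ[R] A →ₗ[R] B} (hd : ∀ m, IsDerivationAlong ρ (d m)) :
    ∃ δ : M →ₗ[R] B →ₗ[R] B, (∀ m, IsDerivationAlong (AlgHom.id R B) (δ m)) ∧
      ∀ m a, δ m (ρ a) = d m a := by
  choose δ hδ hδd using fun m => hρ.exists_derivation (hd m)
  refine ⟨⟨⟨δ, fun m m' => ?_⟩, fun r m => ?_⟩, hδ, hδd⟩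
  · refine hρ.isDenseAt.derivation_ext (hδ _) ((hδ m).add (hδ m')) fun a => ?_
    rw [hδd, LinearMap.add_apply, hδd, hδd, map_add, LinearMap.add_apply]
  · refine hρ.isDenseAt.derivation_ext (hδ _) ((hδ m).smul r) fun a => ?_
    rw [hδd, RingHom.id_apply, LinearMap.smul_apply, hδd, map_smul, LinearMap.smul_apply]

end

namespace PoissonStructure

variable {A B : Type u} [Ring A] [Algebra R A] [Ring B] [Algebra R B]

variable {B' : Type u} [Ring B'] [Algebra R B']

theorem map_bracket_of_isDenseAt [IsHausdorff (maximalIdeal R) B'] (π : PoissonStructure R B)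
    (π' : PoissonStructure R B') {ρ : A →ₐ[R] B} {t : A} (hρ : IsDenseAt ρ t) (g : B →ₐ[R] B')
    (h : ∀ a b, g (π.bracket (ρ a) (ρ b)) = π'.bracket (g (ρ a)) (g (ρ b))) (x y : B) :
    g (π.bracket x y) = π'.bracket (g x) (g y) := by
  have hr : ∀ z, IsDerivationAlong g (g.toLinearMap.comp (π.bracket z)) := fun z x y => by
    simp [π.leibniz_right]
  have hl : ∀ z, IsDerivationAlong g (g.toLinearMap.comp (π.bracket.flip z)) := fun z x y => by
    simp [π.leibniz_left]
  have hr' : ∀ z, IsDerivationAlong g ((π'.bracket z).comp g.toLinearMap) := fun z x y => by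
    simp [π'.leibniz_right]
  have hl' : ∀ z, IsDerivationAlong g ((π'.bracket.flip z).comp g.toLinearMap) := fun z x y => by
    simp [π'.leibniz_left]
  have h1 : ∀ a y, g (π.bracket (ρ a) y) = π'.bracket (g (ρ a)) (g y) := fun a y =>
    congrArg (fun f => f y) (hρ.derivation_ext (hr (ρ a)) (hr' (g (ρ a))) (h a))
  exact congrArg (fun f => f x) (hρ.derivation_ext (hl y) (hl' (g y)) fun a => h1 a y)

theorem bracket_mem_of_isDenseAt (π : PoissonStructure R B) {ρ : A →ₐ[R] B} {t : A}
    (hρ : IsDenseAt ρ t) {j : ℕ} (h : ∀ a b, π.bracket (ρ a) (ρ b) ∈ adic R B j) (x y : B) :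
    π.bracket x y ∈ adic R B j :=
  hρ.derivation_mem (g := AlgHom.id R B) (π.isDerivationAlong_left y) (fun a =>
    hρ.derivation_mem (g := AlgHom.id R B) (π.isDerivationAlong_right (ρ a)) (h a) y) x

end PoissonStructure

/-- The bracket extends first in its second argument, then in its first. Each identity compares
expressions that are derivations in the arguments still to be extended, so it follows from its
validity on the image of `A`. -/
theorem IsCompletedLocalization.exists_poissonStructure {A B : AlgCat.{u} R}
    {ρ : A →ₐ[R] B} {t : A} (hρ : IsCompletedLocalization ρ t)
    [IsAdicComplete (maximalIdeal R) B] (π : PoissonStructure R A) :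
    ∃ π' : PoissonStructure R B, ∀ a b, π'.bracket (ρ a) (ρ b) = ρ (π.bracket a b) := by
  have hcomm := hρ.isDenseAt.mul_comm π.mul_comm
  obtain ⟨δ, hδ, hδρ⟩ := hρ.exists_derivation_family
    (d := (LinearMap.llcomp R A A B ρ.toLinearMap).comp π.bracket)
    (fun a x y => by simp [π.leibniz_right])
  have hδ' : ∀ b, IsDerivationAlong ρ (δ.flip b) := by
    intro b x y
    -- The right side of the Leibniz rule in the first argument is itself a derivation in the second
    -- one, thanks to commutativity; so density reduces the rule to elements of `A`.
    have hL : IsDerivationAlong (AlgHom.id R B) ((LinearMap.mulRight R (ρ y)).comp (δ x) +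
        (LinearMap.mulLeft R (ρ x)).comp (δ y)) := by
      intro z w
      have h1 := hδ x z w
      have h2 := hδ y z w
      simp only [AlgHom.id_apply] at h1 h2
      simp only [LinearMap.add_apply, LinearMap.comp_apply, LinearMap.mulRight_apply,
        LinearMap.mulLeft_apply, AlgHom.id_apply, h1, h2]
      simp only [add_mul, mul_add, mul_assoc]
      rw [hcomm w (ρ y), ← mul_assoc (ρ x) z, hcomm (ρ x) z]
      simp only [mul_assoc]
      abel
    exact congrArg (fun f => f b) (hρ.isDenseAt.derivation_ext (hδ (x * y)) hL fun a => by
      simp [hδρ, π.leibniz_left])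
  obtain ⟨β', hβ', hβρ'⟩ := hρ.exists_derivation_family hδ'
  let β := β'.flip
  have hβ : ∀ a b, β (ρ a) (ρ b) = ρ (π.bracket a b) := fun a b =>
    (hβρ' (ρ b) a).trans (hδρ a b)
  have hl : ∀ z, IsDerivationAlong (AlgHom.id R B) (β.flip z) := fun z => hβ' z
  have hr : ∀ z, IsDerivationAlong (AlgHom.id R B) (β z) := by
    intro z x y
    have hL : IsDerivationAlong (AlgHom.id R B) ((LinearMap.mulRight R y).comp (β' x) +
        (LinearMap.mulLeft R x).comp (β' y)) := by
      intro z w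
      have h1 := hβ' x z w
      have h2 := hβ' y z w
      simp only [AlgHom.id_apply] at h1 h2
      simp only [LinearMap.add_apply, LinearMap.comp_apply, LinearMap.mulRight_apply,
        LinearMap.mulLeft_apply, AlgHom.id_apply, h1, h2]
      simp only [add_mul, mul_add, mul_assoc]
      rw [hcomm w y, ← mul_assoc x z, hcomm x z]
      simp only [mul_assoc]
      abel
    refine congrArg (fun f => f z) (hρ.isDenseAt.derivation_ext (hβ' (x * y)) hL fun a => ?_)
    have h1 := hδ a x y
    simp only [AlgHom.id_apply] at h1
    simp [hβρ', h1]
  have hanti : ∀ x y, β x y = -β y x := by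
    have h1 : ∀ a y, (β (ρ a) + β.flip (ρ a)) y = 0 := fun a y =>
      hρ.isDenseAt.derivation_eq_zero (g := AlgHom.id R B) ((hr _).add (hl _)) (fun b => by
        change β (ρ a) (ρ b) + β (ρ b) (ρ a) = 0
        rw [hβ, hβ, π.antisymm, map_neg, neg_add_cancel]) y
    intro x y
    refine eq_neg_of_add_eq_zero_left ?_
    exact hρ.isDenseAt.derivation_eq_zero (g := AlgHom.id R B) ((hl y).add (hr y)) (fun a =>
      h1 a y) x
  -- Cyclic symmetry rotates each argument in turn into the first place, so that density removes the
  -- restriction to the image one argument at a time.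
  have hJ := isDerivationAlong_jacobiator hcomm hanti hl hr
  have hJ1 : ∀ a b x, jacobiator β (ρ a) (ρ b) x = 0 := fun a b =>
    hρ.isDenseAt.derivation_eq_zero (hJ _ _) fun c => by
      rw [jacobiator_apply, hβ, hβ, hβ, hβ, hβ, hβ, ← map_add, ← map_add, π.jacobi, map_zero]
  have hJ2 : ∀ a x y, jacobiator β (ρ a) x y = 0 := fun a x =>
    hρ.isDenseAt.derivation_eq_zero (hJ _ _) fun c => by
      rw [jacobiator_cyclic, jacobiator_cyclic]; exact hJ1 c a x
  have hJ3 : ∀ x y z, jacobiator β x y z = 0 := fun x y =>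
    hρ.isDenseAt.derivation_eq_zero (hJ _ _) fun c => by
      rw [jacobiator_cyclic, jacobiator_cyclic]; exact hJ2 c x y
  exact ⟨⟨hcomm, β, hanti, fun a b c => hJ3 b c a, fun a b c => hr a b c, fun a b c => hl c a b⟩,
    hβ⟩

end PoissonExtension

/-! ### Poisson deformations of the structure sheaf -/

noncomputable section PoissonSheaves

open IsLocalRing

variable {K R : Type u} [Field K] [CommRing R] [IsLocalRing R] [Algebra K R]
variable [hR : Fact (IsParameterAlgebra K R)]

theorem PoissonAugAlgebra.aug_bracket_iff {C : Type u} [CommRing C] [Algebra K C]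
    (A : PoissonAugAlgebra K R C) :
    (∀ (k l : ResidueField R) (a b : A.alg),
      A.aug ((k * l) ⊗ₜ[R] A.poisson.bracket a b : ResidueField R ⊗[R] A.alg) = 0) ↔
    ∀ a b, A.augHom (A.poisson.bracket a b) = 0 := by
  constructor
  · intro h a b
    have := h 1 1 a b
    rwa [mul_one] at this
  · intro h k l a b
    obtain ⟨r, hr⟩ := residue_surjective (k * l)
    rw [← hr, A.aug_tmul, map_smul, h, smul_zero]
    rfl

section

variable [IsNoetherianRing R] {X : TopCat.{u}}
  {O : TopCat.Sheaf (CommAlgCat.{u} K) X} {I : Type u} {B : I → Opens X}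

namespace BasisDeformation

variable (P : BasisDeformation R O B)

/-- A compatible family of Poisson structures on the algebras of a deformation on a basis induces
Poisson structures on the algebras of sections. -/
def poissonStructure (π : ∀ i, PoissonStructure R (P.alg i))
    (hπ : ∀ {i j} (h : B j ≤ B i) (x y : P.alg i),
      P.map h ((π i).bracket x y) = (π j).bracket (P.map h x) (P.map h y)) (V : Opens X) :
    PoissonStructure R (Sec P.sheaf V) :=
  have hmap : ∀ (f f' : Sec P.sheaf V) i (hi : B i ≤ V) j (h : B j ≤ B i),
      P.map h ((π i).bracket (P.comp hi f) (P.comp hi f')) =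
        (π j).bracket (P.comp (h.trans hi) f) (P.comp (h.trans hi) f') := fun f f' i hi j h => by
    rw [hπ, P.map_comp, P.map_comp]
  let br : Sec P.sheaf V → Sec P.sheaf V → Sec P.sheaf V := fun f f' =>
    (P.exists_comp_eq (fun i hi => (π i).bracket (P.comp hi f) (P.comp hi f')) (hmap f f')).choose
  have hbr : ∀ f f' i (hi : B i ≤ V),
      P.comp hi (br f f') = (π i).bracket (P.comp hi f) (P.comp hi f') := fun f f' =>
    (P.exists_comp_eq (fun i hi => (π i).bracket (P.comp hi f) (P.comp hi f'))
      (hmap f f')).choose_spec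
  { mul_comm := fun f f' => P.comp_ext fun i hi => by
      rw [map_mul, map_mul, (π i).mul_comm]
    bracket := LinearMap.mk₂ R br
      (fun f f' f'' => P.comp_ext fun i hi => by simp [hbr])
      (fun r f f' => P.comp_ext fun i hi => by simp [hbr])
      (fun f f' f'' => P.comp_ext fun i hi => by simp [hbr])
      (fun r f f' => P.comp_ext fun i hi => by simp [hbr])
    antisymm := fun f f' => P.comp_ext fun i hi => by
      rw [LinearMap.mk₂_apply, LinearMap.mk₂_apply, map_neg, hbr, hbr, (π i).antisymm]
    jacobi := fun f f' f'' => P.comp_ext fun i hi => by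
      simp only [LinearMap.mk₂_apply, map_add, hbr, (π i).jacobi, map_zero]
    leibniz_right := fun f f' f'' => P.comp_ext fun i hi => by
      simp only [LinearMap.mk₂_apply, map_add, map_mul, hbr, (π i).leibniz_right]
    leibniz_left := fun f f' f'' => P.comp_ext fun i hi => by
      simp only [LinearMap.mk₂_apply, map_add, map_mul, hbr, (π i).leibniz_left] }

theorem comp_bracket (π : ∀ i, PoissonStructure R (P.alg i))
    (hπ : ∀ {i j} (h : B j ≤ B i) (x y : P.alg i),
      P.map h ((π i).bracket x y) = (π j).bracket (P.map h x) (P.map h y)) {V : Opens X} {i : I}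
    (hi : B i ≤ V) (f f' : Sec P.sheaf V) :
    P.comp hi ((P.poissonStructure π hπ V).bracket f f') =
      (π i).bracket (P.comp hi f) (P.comp hi f') :=
  (P.exists_comp_eq (fun i hi => (π i).bracket (P.comp hi f) (P.comp hi f')) fun i hi j h => by
    rw [hπ, P.map_comp, P.map_comp]).choose_spec i hi

/-- The augmented sheaf of Poisson algebras given by a deformation on a basis with a compatible
family of Poisson structures. -/
def poissonAugSheaf (π : ∀ i, PoissonStructure R (P.alg i))
    (hπ : ∀ {i j} (h : B j ≤ B i) (x y : P.alg i),
      P.map h ((π i).bracket x y) = (π j).bracket (P.map h x) (P.map h y)) :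
    PoissonAugSheaf K R O where
  toAugSheaf := P.augSheaf
  poisson V := P.poissonStructure π hπ V.unop
  map_bracket {_ W} i f f' := P.comp_ext (V := W.unop) fun _ hj =>
    (P.comp_bracket π hπ (hj.trans i.unop.le) f f').trans
      (P.comp_bracket π hπ hj (res P.sheaf i.unop.le f) (res P.sheaf i.unop.le f')).symm

end BasisDeformation

end

variable [IsNoetherianRing R] {Y : Scheme.{u}} [IsAffine Y] {g : Y ⟶ Spec (CommRingCat.of K)}

/-- A Poisson deformation of the algebra of global functions is isomorphic to the global sections
of a Poisson deformation of the structure sheaf. -/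
theorem PoissonAugAlgebra.IsDeformation.exists_poissonAugSheaf
    {A : PoissonAugAlgebra K R ((structureSheafAlg g).presheaf.obj (op ⊤))}
    (hA : A.IsDeformation) :
    ∃ 𝒜 : PoissonAugSheaf K R (structureSheafAlg g), 𝒜.IsDeformation ∧
      Nonempty (A.Gauge (𝒜.sections ⊤)) := by
  have hA' := (AugAlgebra.isDeformation_iff _).1 hA.isDeformation
  have hbr := A.aug_bracket_iff.1 hA.aug_bracket
  obtain ⟨P, ρ, hP⟩ := exists_basisDeformation hA'
  obtain ⟨φ, hφρ, hφ⟩ := exists_algEquiv_sections hA' hP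
  have hcomp := fun i => (P.isFormalDeformation i).complete
  choose t _ ht using hP.isCompletedLocalization
  choose π hπρ using fun s => haveI := hcomp s; (ht s).exists_poissonStructure A.poisson
  have hπ : ∀ {s s' : Γ(Y, ⊤)} (h : Y.basicOpen s' ≤ Y.basicOpen s) (x y : P.alg s),
      P.map h ((π s).bracket x y) = (π s').bracket (P.map h x) (P.map h y) := fun {s s'} h =>
    (π s).map_bracket_of_isDenseAt (π s') (ht s).isDenseAt (P.map h) fun a b => by
      rw [hπρ, hP.map_apply, hP.map_apply, hP.map_apply, hπρ]
  -- The condition on the augmentation says that brackets lie in `𝔪`, and this passes from `A` to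
  -- the localization by density.
  have hzero : ∀ s (x y : P.alg s), P.ε s ((π s).bracket x y) = 0 := by
    intro s x y
    rw [(P.isFormalDeformation s).eq_zero_iff]
    refine (π s).bracket_mem_of_isDenseAt (ht s).isDenseAt (fun a b => ?_) x y
    rw [hπρ]
    exact AlgHom.map_mem_adic _ ((hA'.eq_zero_iff _).1 (hbr a b))
  refine ⟨P.poissonAugSheaf π hπ, ⟨P.augSheaf_isDeformation, fun V => ?_⟩, ?_⟩
  · refine (PoissonAugAlgebra.aug_bracket_iff ((P.poissonAugSheaf π hπ).sections V)).2 fun f f' => ?_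
    refine P.oRes_basic_ext fun s hs => ?_
    rw [map_zero]
    refine (P.oRes_augSheaf_ε hs _).trans ?_
    exact (congrArg (P.ε s) (P.comp_bracket π hπ hs f f')).trans (hzero _ _ _)
  · obtain ⟨h, hh⟩ := AugAlgebra.exists_gauge_of_algEquiv (A := A.toAugAlgebra)
      (A' := P.augSheaf.sections ⊤) φ hφ
    have hφbr : ∀ a b, φ (A.poisson.bracket a b) =
        (P.poissonStructure π hπ ⊤).bracket (φ a) (φ b) := fun a b =>
      P.comp_ext fun s hs => by
        rw [P.comp_bracket π hπ hs, hφρ, hφρ, hφρ, hπρ]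
    exact ⟨⟨h, fun a b => (hh _).trans ((hφbr a b).trans (congrArg₂
      (fun x y => (P.poissonStructure π hπ ⊤).bracket x y) (hh a) (hh b)).symm)⟩⟩

namespace PoissonAugSheaf

variable {A A' : PoissonAugSheaf K R (structureSheafAlg g)}

theorem IsDeformation.sections_top (hA : A.IsDeformation) : (A.sections ⊤).IsDeformation :=
  ⟨hA.isDeformation.sections_top, hA.aug_bracket ⊤⟩

/-- The claim is local, and over a basic open set both sides are biderivations that agree on
restrictions of global sections, which are dense. -/
theorem secMap_bracket (hA : A.IsDeformation) (hA' : A'.IsDeformation) (G : A.sheaf ⟶ A'.sheaf)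
    (h : ∀ a b, secMap G ⊤ ((A.poisson (op ⊤)).bracket a b) =
      (A'.poisson (op ⊤)).bracket (secMap G ⊤ a) (secMap G ⊤ b)) (V : Y.Opens)
    (a b : Sec A.sheaf V) : secMap G V ((A.poisson (op V)).bracket a b) =
      (A'.poisson (op V)).bracket (secMap G V a) (secMap G V b) := by
  have hres : ∀ {V W : Y.Opens} (h : W ≤ V) (a b : Sec A.sheaf V),
      res A.sheaf h ((A.poisson (op V)).bracket a b) =
        (A.poisson (op W)).bracket (res A.sheaf h a) (res A.sheaf h b) := fun h =>
    A.map_bracket (homOfLE h).op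
  have hres' : ∀ {V W : Y.Opens} (h : W ≤ V) (a b : Sec A'.sheaf V),
      res A'.sheaf h ((A'.poisson (op V)).bracket a b) =
        (A'.poisson (op W)).bracket (res A'.sheaf h a) (res A'.sheaf h b) := fun h =>
    A'.map_bracket (homOfLE h).op
  refine eq_of_locally_res_eq _ fun x hx => ?_
  obtain ⟨s, hs, hxs⟩ := exists_basicOpen_le hx
  refine ⟨Y.basicOpen s, hs, hxs, ?_⟩
  obtain ⟨t, ht⟩ := hA.isDeformation.isDenseAt_res s
  have := (hA'.isDeformation.isFormalDeformation_basicOpen s).complete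
  rw [← secMap_res, hres, hres', ← secMap_res, ← secMap_res]
  refine (A.poisson _).map_bracket_of_isDenseAt (A'.poisson _) ht (secMap G _) (fun a b => ?_) _ _
  rw [← hres, secMap_res, secMap_res, secMap_res, h, hres']

/-- Gauge transformations between the Poisson algebras of global sections extend uniquely to gauge
transformations of Poisson deformations of the structure sheaf. -/
theorem existsUnique_gauge (hA : A.IsDeformation) (hA' : A'.IsDeformation)
    (h : (A.sections ⊤).Gauge (A'.sections ⊤)) : ∃! h' : A.Gauge A', h'.sections ⊤ = h := by
  obtain ⟨G, hG, hG'⟩ := AugSheaf.existsUnique_gauge hA.isDeformation hA'.isDeformation h.toGauge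
  have hGh : ∀ a, secMap G.iso.hom ⊤ a = h.iso.hom a := fun a =>
    congrArg (fun e => e.iso.hom.hom a) hG
  have hbr := secMap_bracket hA hA' G.iso.hom fun a b => by
    rw [hGh, hGh, hGh]
    exact h.map_bracket a b
  refine ⟨⟨G, fun V => hbr V.unop⟩, ?_, fun h' e => ?_⟩
  · exact PoissonAugAlgebra.Gauge.ext (congrArg AugAlgebra.Gauge.iso hG)
  · exact PoissonAugSheaf.Gauge.ext (congrArg AugSheaf.Gauge.iso
      (hG' h'.toGauge (congrArg PoissonAugAlgebra.Gauge.toGauge e)))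

end PoissonAugSheaf

end PoissonSheaves

theorem mainTheorem3 {K R : Type u} [Field K] [CommRing R] [IsLocalRing R] [Algebra K R]
    (hR : IsParameterAlgebra K R)
    (X : Scheme.{u}) (f : X ⟶ Spec (CommRingCat.of K))
    [IsIntegral X] [IsSeparated f] [LocallyOfFiniteType f] [QuasiCompact f]
    (U : X.Opens) (hU : IsAffineOpen U) :
    -- associative deformations
    ((∀ 𝒜 : AugSheaf K R (openStructureSheaf f U), 𝒜.IsDeformation →
        (𝒜.sections ⊤).IsDeformation) ∧
      (∀ A : AugAlgebra K R ((openStructureSheaf f U).presheaf.obj (op ⊤)), A.IsDeformation →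
        ∃ 𝒜 : AugSheaf K R (openStructureSheaf f U), 𝒜.IsDeformation ∧
          Nonempty (A.Gauge (𝒜.sections ⊤))) ∧
      (∀ 𝒜 𝒜' : AugSheaf K R (openStructureSheaf f U), 𝒜.IsDeformation → 𝒜'.IsDeformation →
        ∀ h : (𝒜.sections ⊤).Gauge (𝒜'.sections ⊤),
          ∃! h' : 𝒜.Gauge 𝒜', h'.sections ⊤ = h)) ∧
    -- Poisson deformations
    ((∀ 𝒜 : PoissonAugSheaf K R (openStructureSheaf f U), 𝒜.IsDeformation →
        (𝒜.sections ⊤).IsDeformation) ∧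
      (∀ A : PoissonAugAlgebra K R ((openStructureSheaf f U).presheaf.obj (op ⊤)),
        A.IsDeformation →
        ∃ 𝒜 : PoissonAugSheaf K R (openStructureSheaf f U), 𝒜.IsDeformation ∧
          Nonempty (A.Gauge (𝒜.sections ⊤))) ∧
      (∀ 𝒜 𝒜' : PoissonAugSheaf K R (openStructureSheaf f U),
        𝒜.IsDeformation → 𝒜'.IsDeformation →
        ∀ h : (𝒜.sections ⊤).Gauge (𝒜'.sections ⊤),
          ∃! h' : 𝒜.Gauge 𝒜', h'.sections ⊤ = h)) := by
  have : Fact (IsParameterAlgebra K R) := ⟨hR⟩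
  have := hR.noetherian
  -- Everything takes place on the affine scheme `U` over `K`, whose global functions form `C`.
  have : IsAffine (U : Scheme.{u}) := hU
  exact ⟨⟨fun _ h𝒜 => AugSheaf.IsDeformation.sections_top (g := U.ι ≫ f) h𝒜,
      fun _ hA => AugAlgebra.IsDeformation.exists_augSheaf (g := U.ι ≫ f) hA,
      fun _ _ h𝒜 h𝒜' => AugSheaf.existsUnique_gauge (g := U.ι ≫ f) h𝒜 h𝒜'⟩,
    fun _ h𝒜 => PoissonAugSheaf.IsDeformation.sections_top (g := U.ι ≫ f) h𝒜,
    fun _ hA => PoissonAugAlgebra.IsDeformation.exists_poissonAugSheaf (g := U.ι ≫ f) hA,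
    fun _ _ h𝒜 h𝒜' => PoissonAugSheaf.existsUnique_gauge (g := U.ι ≫ f) h𝒜 h𝒜'⟩
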